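/- **Setting.** An *alignment* is a pair $(R,t)$ of a rotation matrix $R\in\mathbb{R}^{2\times2}$ ($R^TR=I$, $\det R=1$) and a vector $t\in\mathbb{R}^2$; it moves a point $p$ to $Rp-t$. Let $n\ge 3$ and let $A=((p_1,\ell_1),\dots,(p_n,\ell_n))$, where each $p_i$ is a point and each $\ell_i$ a line in $\mathbb{R}^2$. For a permutation $\pi$ of $[n]$ put $A_\pi=((p_1,\ell_{\pi(1)}),\dots,(p_n,\ell_{\pi(n)}))$. Let $z\ge1$ and $D_z((p,\ell),(R,t))=\min_{q\in\ell}\|Rp-t-q\|_z$. Let $r>0$ and let $\mathrm{lip}:[0,\infty)\to[0,\infty)$ be $r$-log-Lipschitz: non-decreasing, with $\mathrm{lip}(cx)\le c^r\,\mathrm{lip}(x)$ for all $c\ge1$, $x\ge0$. Put $$\mathrm{cost}\big(((p_i,\ell_i))_i,(R,t)\big)=\sum_{i=1}^n \mathrm{lip}\big(D_z((p_i,\ell_i),(R,t))\big),$$ and let $w=1$ if $z=2$, $w=\sqrt2$ otherwise. Write $J=\begin{pmatrix}0&-1\\1&0\end{pmatrix}$ and $\|\cdot\|=\|\cdot\|_2$.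 **Z-Configs**$(v,p,q,y)$, for a unit vector $v=(v_1,v_2)$ with $v_2\ne0$ and points $p,q,y$. Let $r_1=\|p-q\|$, $r_2=\|p-y\|$, $r_3=\|q-y\|$, $P=r_1\begin{pmatrix}v_1/v_2&1\\0&0\end{pmatrix}$, $Q=P^T$. If $r_1=0$ let $Z=r_2I$. Otherwise let $d_1=\frac{r_1^2+r_2^2-r_3^2}{2r_1}$, $d_2=\sqrt{|r_2^2-d_1^2|}$, let $\beta=1$ if $(y-p)^TJ(q-p)>0$ and $\beta=-1$ otherwise, and $Z=P+\frac{d_1}{r_1}(Q-P)+\beta\frac{d_2}{r_1}J(Q-P)$. Return $(P,Q,Z)$. **Align** of a tuple of pairs $(p_1,\ell_1),\dots,(p_m,\ell_m)$. Choose unit vectors $v_i$ and $b_i\ge0$ with $\ell_i=\{q: v_i^Tq=b_i\}$. For all $j,k,l\in[m]$ with $j\ne k$ form a set $F$ of alignments: * If $|v_j^Tv_k|\neq1$: let $u_i=Jv_i$ and let $U$ be the rotation matrix with rows $u_j^T,(Ju_j)^T$; let $(P',Q',Z')=$ Z-Configs$(Uu_k,p_j,p_k,p_l)$ and $P=U^TP'$,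 $Q=U^TQ'$, $Z=U^TZ'$; let $s$ be the point of $\ell_j\cap\ell_k$ and $c_l=b_l-v_l^Ts$. Then $F$ consists of all alignments $(R,t)$ for which there is $x\in\operatorname{argmin}_{\|x\|=1}|v_l^TZx-c_l|$ with $Rp_j-t=Px+s$, $Rp_k-t=Qx+s$, $Rp_l-t=Zx+s$. * If $|v_j^Tv_k|=1$: $F$ consists of the alignments $(R,t)$ that minimize the Euclidean distance from $Rp_k-t$ to $\ell_k$ among all alignments with $Rp_j-t\in\ell_j$. From $F$ select a set of alignments: if only finitely many rotations $R$ occur in $F$, one arbitrary $(R,t)\in F$ for each of these rotations, and otherwise one arbitrary element of $F$. The output of Align is the union of the selected sets over all $j,k,l$. **Align+Match**$(A,\mathrm{cost})$. Let $X$ be the union over all $i_1,i_2,i_3,j_1,j_2,j_3\in[n]$ of the outputs of Align$\big((p_{i_1},\ell_{j_1}),(p_{i_2},\ell_{j_2}),(p_{i_3},\ell_{j_3})\big)$. For each $(R,t)\in X$ choose a permutation $\hat\pi_{(R,t)}$ that minimizes $\mathrm{cost}(A_\pi,(R,t))$ over all $\pi$. Return a triple $(\tilde R,\tilde t,\tilde\pi)$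 of minimal $\mathrm{cost}(A_{\tilde\pi},(\tilde R,\tilde t))$ among the triples $(R,t,\hat\pi_{(R,t)})$, $(R,t)\in X$. **Theorem.** The minimum of $\mathrm{cost}(A_\pi,(R,t))$ over all alignments $(R,t)$ and permutations $\pi$ of $[n]$ exists, and every possible output $(\tilde R,\tilde t,\tilde\pi)$ of Align+Match$(A,\mathrm{cost})$ satisfies $$\mathrm{cost}\big(A_{\tilde\pi},(\tilde R,\tilde t)\big)\le (16w)^r\cdot\min_{(R,t,\pi)}\mathrm{cost}\big(A_\pi,(R,t)\big).$$ Moreover, such an output can be computed in $n^{O(1)}$ time: there is one real RAM program (exact arithmetic $+,-,\cdot,/,\sqrt{\ }$ and comparisons of reals, evaluation of $\mathrm{lip}$, and of the $\ell_z$ distance from a point to a line, each at unit cost) which, for all $n\ge3$, $A$, $z$, $r$, $\mathrm{lip}$ as above, halts within $K n^{d}$ operations, with constants $K,d$ that depend on nothing, and returns an output of Align+Match$(A,\mathrm{cost})$. -/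

import Mathlib

open scoped NNReal

noncomputable section

namespace PointsToLines

/-! ### Points, lines, alignments -/

/-- The Euclidean plane. -/
abbrev Point := EuclideanSpace ℝ (Fin 2)

/-- The set `{q | aᵀ q = c}`. -/
def hyperplane (a : Point) (c : ℝ) : Set Point := {q | inner ℝ a q = c}

/-- A line on the plane, presented by an arbitrary nonzero normal vector and an offset. -/
structure Line where
  normal : Point
  offset : ℝ
  normal_ne : normal ≠ 0

/-- The points of a line. -/
def Line.carrier (L : Line) : Set Point := hyperplane L.normal L.offset

/-- An alignment `(R, t)`: a rotation matrix (`Rᵀ R = 1`, `det R = 1`) and a translation vector. -/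
abbrev RigidMotion := Matrix.specialOrthogonalGroup (Fin 2) ℝ × Point

/-- The point `R p - t`. -/
def RigidMotion.move (g : RigidMotion) (p : Point) : Point :=
  Matrix.toEuclideanLin (g.1 : Matrix (Fin 2) (Fin 2) ℝ) p - g.2

/-! ### The cost function -/

/-- The `ℓ_z` norm on the plane. -/
def lzNorm (z : ℝ) (x : Point) : ℝ≥0 := (‖x 0‖₊ ^ z + ‖x 1‖₊ ^ z) ^ (1 / z)

/-- The `ℓ_z` distance from a point to a set. -/
def lzDist (z : ℝ) (y : Point) (S : Set Point) : ℝ≥0 := ⨅ q : S, lzNorm z (y - q)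

/-- `D_z((p, ℓ), (R, t)) = min_{q ∈ ℓ} ‖R p - t - q‖_z`. -/
def Dz (z : ℝ) (a : Point × Line) (g : RigidMotion) : ℝ≥0 :=
  lzDist z (g.move a.1) a.2.carrier

/-- `h : [0, ∞) → [0, ∞)` is `r`-log-Lipschitz. -/
def IsLogLipschitz (r : ℝ) (h : ℝ≥0 → ℝ≥0) : Prop :=
  0 < r ∧ Monotone h ∧ ∀ c x : ℝ≥0, 1 ≤ c → h (c * x) ≤ c ^ r * h x

/-- `cost(A, q) = f(lip(D(a₁, q)), …, lip(D(aₙ, q)))`. -/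
def frameworkCost {X Q : Type*} {n : ℕ} (f : (Fin n → ℝ≥0) → ℝ≥0) (lip : ℝ≥0 → ℝ≥0)
    (D : X → Q → ℝ≥0) (A : Fin n → X) (q : Q) : ℝ≥0 :=
  f fun i => lip (D (A i) q)

/-- The `ℓ_1` norm of a vector with nonnegative entries. -/
def l1 {n : ℕ} (v : Fin n → ℝ≥0) : ℝ≥0 := ∑ i, v i

/-- The cost with `D = D_z` and `f = ‖·‖_1`. -/
def cost {n : ℕ} (z : ℝ) (lip : ℝ≥0 → ℝ≥0) (A : Fin n → Point × Line) (g : RigidMotion) : ℝ≥0 :=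
  frameworkCost l1 lip (Dz z) A g

/-- `A_π = ((p₁, ℓ_{π(1)}), …, (pₙ, ℓ_{π(n)}))`. -/
def rematch {n : ℕ} (A : Fin n → Point × Line) (π : Equiv.Perm (Fin n)) : Fin n → Point × Line :=
  fun i => ((A i).1, (A (π i)).2)

/-- `π` is an optimal matching for `(A, (R, t), cost)`. -/
def IsOptimalMatching {n : ℕ} (z : ℝ) (lip : ℝ≥0 → ℝ≥0) (A : Fin n → Point × Line)
    (g : RigidMotion) (π : Equiv.Perm (Fin n)) : Prop :=
  ∀ σ : Equiv.Perm (Fin n), cost z lip (rematch A π) g ≤ cost z lip (rematch A σ) g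

/-- `w = 1` if `z = 2` and `w = √2` otherwise. -/
def wFactor (z : ℝ) : ℝ≥0 := if z = 2 then 1 else NNReal.sqrt 2

/-! ### The subroutine Z-Configs -/

/-- The counter-clockwise rotation by a right angle. -/
def quarterTurn : Matrix (Fin 2) (Fin 2) ℝ := !![0, -1; 1, 0]

/-- The counter-clockwise perpendicular vector. -/
def perp (u : Point) : Point := Matrix.toEuclideanLin quarterTurn u

/-- For a unit vector `u`, the rotation matrix with rows `u`, `perp u`; it takes `u` to `(1, 0)`. -/
def toXAxis (u : Point) : Matrix (Fin 2) (Fin 2) ℝ := !![u 0, u 1; perp u 0, perp u 1]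

/-- `Z-Configs(v, p, q, z)`. As `x` runs over the unit vectors, `(P x, Q x, Z x)` runs over the
positions of the (rigidly moved) triple `(p, q, z)` with the first point on the `x`-axis and the
second one on the line spanned by `v`. If `p = q`, both are at the origin, and `z` runs over
a circle around it. -/
def zConfigs (v p q z : Point) :
    Matrix (Fin 2) (Fin 2) ℝ × Matrix (Fin 2) (Fin 2) ℝ × Matrix (Fin 2) (Fin 2) ℝ :=
  let r₁ := dist p q
  let r₂ := dist p z
  let r₃ := dist q z
  let d₁ := (r₁ ^ 2 + r₂ ^ 2 - r₃ ^ 2) / (2 * r₁)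
  let d₂ := √|r₂ ^ 2 - d₁ ^ 2|
  let P : Matrix (Fin 2) (Fin 2) ℝ := r₁ • !![v 0 / v 1, 1; 0, 0]
  let Q := P.transpose
  let b : ℝ := if 0 < inner ℝ (z - p) (perp (q - p)) then 1 else -1
  let Z : Matrix (Fin 2) (Fin 2) ℝ :=
    if r₁ = 0 then r₂ • 1 else P + (d₁ / r₁) • (Q - P) + (b * (d₂ / r₁)) • (quarterTurn * (Q - P))
  (P, Q, Z)

/-! ### The algorithm Align -/

/-- `x ∈ argmin_{‖y‖ = 1} |vᵀ Z y - c|`. -/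
def IsUnitArgmin (v : Point) (Z : Matrix (Fin 2) (Fin 2) ℝ) (c : ℝ) (x : Point) : Prop :=
  ‖x‖ = 1 ∧ ∀ y : Point, ‖y‖ = 1 →
    |inner ℝ v (Matrix.toEuclideanLin Z x) - c| ≤ |inner ℝ v (Matrix.toEuclideanLin Z y) - c|

/-- The alignments found in an iteration in which the lines `j` and `k` are not parallel; here
`ℓ_i = {q | v_iᵀ q = b_i}` with a unit vector `v_i`, so that `perp (v i)` spans the direction of
`ℓ_i`. The configurations are computed relative to the intersection point `s` of `ℓ_j` and `ℓ_k`. -/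
def crossingAlignments {m : ℕ} (A : Fin m → Point × Line) (v : Fin m → Point) (b : Fin m → ℝ)
    (j k l : Fin m) : Set RigidMotion :=
  let U := toXAxis (perp (v j))
  let M := zConfigs (Matrix.toEuclideanLin U (perp (v k))) (A j).1 (A k).1 (A l).1
  let P := U.transpose * M.1
  let Q := U.transpose * M.2.1
  let Z := U.transpose * M.2.2
  {g | ∃ s x : Point, s ∈ (A j).2.carrier ∩ (A k).2.carrier ∧
    IsUnitArgmin (v l) Z (b l - inner ℝ (v l) s) x ∧
    g.move (A j).1 = Matrix.toEuclideanLin P x + s ∧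
    g.move (A k).1 = Matrix.toEuclideanLin Q x + s ∧
    g.move (A l).1 = Matrix.toEuclideanLin Z x + s}

/-- The alignments that are eligible in an iteration in which the lines `j` and `k` are parallel:
`p_j` is put on `ℓ_j` and, subject to this, `p_k` as close as possible to `ℓ_k`. -/
def parallelAlignments {m : ℕ} (A : Fin m → Point × Line) (j k : Fin m) : Set RigidMotion :=
  {g | g.move (A j).1 ∈ (A j).2.carrier ∧
    ∀ g' : RigidMotion, g'.move (A j).1 ∈ (A j).2.carrier →
      Metric.infDist (g.move (A k).1) (A k).2.carrier ≤
        Metric.infDist (g'.move (A k).1) (A k).2.carrier}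

/-- `C` is a choice of constantly many alignments of `F`: if finitely many rotations occur in `F`,
one alignment of `F` for each of them, and otherwise one arbitrary alignment of `F`. -/
def IsSelection (F C : Set RigidMotion) : Prop :=
  C ⊆ F ∧
    (((Prod.fst '' F).Finite ∧ ∀ R ∈ Prod.fst '' F, ∃! g : RigidMotion, g ∈ C ∧ g.1 = R) ∨
      ((Prod.fst '' F).Infinite ∧ ∃ g : RigidMotion, C = {g}))

/-- `C` is an output of a call to `Align(A)`. -/
def IsAlignOutput {m : ℕ} (A : Fin m → Point × Line) (C : Set RigidMotion) : Prop :=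
  ∃ (v : Fin m → Point) (b : Fin m → ℝ),
    (∀ i, ‖v i‖ = 1 ∧ 0 ≤ b i ∧ (A i).2.carrier = hyperplane (v i) (b i)) ∧
    ∃ C' : Fin m → Fin m → Fin m → Set RigidMotion,
      (∀ j k l, j ≠ k →
        (|inner ℝ (v j) (v k)| ≠ 1 → IsSelection (crossingAlignments A v b j k l) (C' j k l)) ∧
        (|inner ℝ (v j) (v k)| = 1 → IsSelection (parallelAlignments A j k) (C' j k l))) ∧
      C = {g | ∃ j k l, j ≠ k ∧ g ∈ C' j k l}

/-! ### The algorithm Align+Match -/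

/-- `(g, π)` is an output of a call to `Align+Match(A, cost)`. -/
def IsAlignMatchOutput {n : ℕ} (z : ℝ) (lip : ℝ≥0 → ℝ≥0) (A : Fin n → Point × Line)
    (out : RigidMotion × Equiv.Perm (Fin n)) : Prop :=
  ∃ (X' : (Fin 3 → Fin n) → (Fin 3 → Fin n) → Set RigidMotion)
    (πhat : RigidMotion → Equiv.Perm (Fin n)),
    (∀ i j : Fin 3 → Fin n,
      IsAlignOutput (fun a : Fin 3 => ((A (i a)).1, (A (j a)).2)) (X' i j)) ∧
    (∀ g, (∃ i j, g ∈ X' i j) → IsOptimalMatching z lip A g (πhat g)) ∧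
    ∃ S : Set (RigidMotion × Equiv.Perm (Fin n)),
      S = {u | (∃ i j, u.1 ∈ X' i j) ∧ u.2 = πhat u.1} ∧
      out ∈ S ∧ ∀ u ∈ S, cost z lip (rematch A out.2) out.1 ≤ cost z lip (rematch A u.2) u.1

end PointsToLines

/-! ### A real RAM

Structured programs over a memory with cells for natural numbers and cells for real numbers. Cells
are grouped in arrays; the name of an array is fixed in the program text, the indices are computed.
Real arithmetic and comparisons are exact. There is no conversion between the two kinds of cells.
Every operation has unit cost. -/

namespace RealRAM

open PointsToLines

/-- The cost function that a program is given as part of its input is accessed by evaluating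
`lip` on a nonnegative number, and the `ℓ_z` distance from a point to a line. -/
structure Oracle where
  lip : ℝ≥0 → ℝ≥0
  z : ℝ

structure Mem where
  /-- array name, index -/
  nat : ℕ → ℕ → ℕ
  /-- array name, row, column -/
  real : ℕ → ℕ → ℕ → ℝ

/-- Expressions for natural numbers (subtraction is truncated). -/
inductive NExp where
  | const (k : ℕ)
  | get (a : ℕ) (i : NExp)
  | add (e₁ e₂ : NExp)
  | sub (e₁ e₂ : NExp)

def NExp.eval (σ : Mem) : NExp → ℕ
  | const k => k
  | get a i => σ.nat a (i.eval σ)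
  | add e₁ e₂ => e₁.eval σ + e₂.eval σ
  | sub e₁ e₂ => e₁.eval σ - e₂.eval σ

/-- The number of operations of an evaluation. -/
def NExp.time : NExp → ℕ
  | const _ => 1
  | get _ i => i.time + 1
  | add e₁ e₂ => e₁.time + e₂.time + 1
  | sub e₁ e₂ => e₁.time + e₂.time + 1

/-- Expressions for real numbers. The only constants are natural numbers. -/
inductive RExp where
  | const (k : ℕ)
  | get (a : ℕ) (i j : NExp)
  | add (e₁ e₂ : RExp)
  | sub (e₁ e₂ : RExp)
  | mul (e₁ e₂ : RExp)
  | div (e₁ e₂ : RExp)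
  | sqrt (e : RExp)
  /-- the value of `lip` -/
  | lip (e : RExp)
  /-- the `ℓ_z` distance from the point `(y₁, y₂)` to the line `a₁ q₁ + a₂ q₂ = c` -/
  | lineDist (y₁ y₂ a₁ a₂ c : RExp)

def RExp.eval (O : Oracle) (σ : Mem) : RExp → ℝ
  | const k => k
  | get a i j => σ.real a (i.eval σ) (j.eval σ)
  | add e₁ e₂ => e₁.eval O σ + e₂.eval O σ
  | sub e₁ e₂ => e₁.eval O σ - e₂.eval O σ
  | mul e₁ e₂ => e₁.eval O σ * e₂.eval O σ
  | div e₁ e₂ => e₁.eval O σ / e₂.eval O σ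
  | sqrt e => √(e.eval O σ)
  | lip e => O.lip (e.eval O σ).toNNReal
  | lineDist y₁ y₂ a₁ a₂ c =>
      lzDist O.z !₂[y₁.eval O σ, y₂.eval O σ]
        (hyperplane !₂[a₁.eval O σ, a₂.eval O σ] (c.eval O σ))

/-- The number of operations of an evaluation. -/
def RExp.time : RExp → ℕ
  | const _ => 1
  | get _ i j => i.time + j.time + 1
  | add e₁ e₂ => e₁.time + e₂.time + 1
  | sub e₁ e₂ => e₁.time + e₂.time + 1
  | mul e₁ e₂ => e₁.time + e₂.time + 1
  | div e₁ e₂ => e₁.time + e₂.time + 1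
  | sqrt e => e.time + 1
  | lip e => e.time + 1
  | lineDist y₁ y₂ a₁ a₂ c => y₁.time + y₂.time + a₁.time + a₂.time + c.time + 1

/-- Tests. -/
inductive Test where
  | natLe (e₁ e₂ : NExp)
  | realLe (e₁ e₂ : RExp)
  | not (t : Test)
  | and (t₁ t₂ : Test)

def Test.holds (O : Oracle) (σ : Mem) : Test → Prop
  | natLe e₁ e₂ => e₁.eval σ ≤ e₂.eval σ
  | realLe e₁ e₂ => e₁.eval O σ ≤ e₂.eval O σ
  | not t => ¬ t.holds O σ
  | and t₁ t₂ => t₁.holds O σ ∧ t₂.holds O σ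

/-- The number of operations of a test. -/
def Test.time : Test → ℕ
  | natLe e₁ e₂ => e₁.time + e₂.time + 1
  | realLe e₁ e₂ => e₁.time + e₂.time + 1
  | not t => t.time + 1
  | and t₁ t₂ => t₁.time + t₂.time + 1

/-- Programs. -/
inductive Prog where
  | skip
  | setNat (a : ℕ) (i : NExp) (e : NExp)
  | setReal (a : ℕ) (i j : NExp) (e : RExp)
  | seq (P₁ P₂ : Prog)
  | ite (t : Test) (P₁ P₂ : Prog)
  | loop (t : Test) (P : Prog)

def Mem.writeNat (m : Mem) (a i x : ℕ) : Mem :=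
  ⟨Function.update m.nat a (Function.update (m.nat a) i x), m.real⟩

def Mem.writeReal (m : Mem) (a i j : ℕ) (x : ℝ) : Mem :=
  ⟨m.nat, Function.update m.real a
    (Function.update (m.real a) i (Function.update (m.real a i) j x))⟩

/-- `Run O P σ τ T`: started in the memory `σ`, the program `P` halts in the memory `τ` after
exactly `T` operations. -/
inductive Run (O : Oracle) : Prog → Mem → Mem → ℕ → Prop where
  | skip (σ : Mem) : Run O .skip σ σ 1
  | setNat (a : ℕ) (i e : NExp) (σ : Mem) :
      Run O (.setNat a i e) σ (σ.writeNat a (i.eval σ) (e.eval σ)) (i.time + e.time + 1)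
  | setReal (a : ℕ) (i j : NExp) (e : RExp) (σ : Mem) :
      Run O (.setReal a i j e) σ (σ.writeReal a (i.eval σ) (j.eval σ) (e.eval O σ))
        (i.time + j.time + e.time + 1)
  | seq {P₁ P₂ : Prog} {σ₁ σ₂ σ₃ : Mem} {T₁ T₂ : ℕ} :
      Run O P₁ σ₁ σ₂ T₁ → Run O P₂ σ₂ σ₃ T₂ → Run O (.seq P₁ P₂) σ₁ σ₃ (T₁ + T₂)
  | iteTrue {t : Test} {P₁ P₂ : Prog} {σ τ : Mem} {T : ℕ} :
      t.holds O σ → Run O P₁ σ τ T → Run O (.ite t P₁ P₂) σ τ (t.time + T)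
  | iteFalse {t : Test} {P₁ P₂ : Prog} {σ τ : Mem} {T : ℕ} :
      ¬ t.holds O σ → Run O P₂ σ τ T → Run O (.ite t P₁ P₂) σ τ (t.time + T)
  | loopTrue {t : Test} {P : Prog} {σ₁ σ₂ σ₃ : Mem} {T₁ T₂ : ℕ} :
      t.holds O σ₁ → Run O P σ₁ σ₂ T₁ → Run O (.loop t P) σ₂ σ₃ T₂ →
      Run O (.loop t P) σ₁ σ₃ (t.time + T₁ + T₂)
  | loopFalse {t : Test} {P : Prog} {σ : Mem} :
      ¬ t.holds O σ → Run O (.loop t P) σ σ t.time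

/-- The input memory: `n` in the cell `nat 0 0`, the point `p_i` in the columns `0, 1` and the
normal and the offset of the line `ℓ_i` in the columns `2, 3, 4` of the row `i` of `real 0`; all
other cells hold zero. -/
def inputMem {n : ℕ} (A : Fin n → Point × Line) : Mem where
  nat a i := if a = 0 ∧ i = 0 then n else 0
  real a i j :=
    if h : i < n then
      if a = 0 then
        match j with
        | 0 => (A ⟨i, h⟩).1 0
        | 1 => (A ⟨i, h⟩).1 1
        | 2 => (A ⟨i, h⟩).2.normal 0
        | 3 => (A ⟨i, h⟩).2.normal 1
        | 4 => (A ⟨i, h⟩).2.offset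
        | _ => 0
      else 0
    else 0

/-- The memory holds the output `(R, t, π)`: the entries of `R` in the rows `0, 1` and those of `t`
in the row `2` of `real 1`, and `π` in `nat 1`. -/
def HoldsOutput {n : ℕ} (σ : Mem) (out : RigidMotion × Equiv.Perm (Fin n)) : Prop :=
  (∀ i j : Fin 2, σ.real 1 i j = (out.1.1 : Matrix (Fin 2) (Fin 2) ℝ) i j) ∧
  (∀ j : Fin 2, σ.real 1 2 j = out.1.2 j) ∧
  ∀ i : Fin n, σ.nat 1 i = (out.2 i : ℕ)

end RealRAM

end

/-!
For a fixed line, every `ℓ_z` distance to it is a constant multiple of the modulus of the line's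
equation, so an alignment can be judged by the *gaps* `⟪a, R p - t⟫ - c` of the pairs alone: if all
gaps are at most `16` times those of an optimal alignment, then the cost is at most `16 ^ r` times
the optimal one, whatever `z` is.

Start with an optimal alignment. A translation makes one gap vanish and at most doubles the others,
namely one that puts the first reached point on its line; a further translation along this line does
the same for a second gap, if some other line is not parallel to it. Now `t` is an affine function
of the rotation, and so the gaps become functions `⟪aᵢ, u⟫ - cᵢ` of the first column `u` of the
rotation matrix. Each of them has at most two closest approaches to `0` on the unit circle, and
turning `u` to the nearest one among these multiplies the others by at most `4`. The result is
determined by three pairs, and it is one of the alignments that Align tries.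

Each of these alignments has a closed form in terms of field operations and square roots, and for
each of them an optimal permutation is found by the Hungarian method.
-/

noncomputable section

namespace PointsToLines

open scoped RealInnerProductSpace

/-! ### Level sets of a linear function on the unit circle -/

section Coordinates

theorem Point.ext {p q : Point} (h₀ : p 0 = q 0) (h₁ : p 1 = q 1) : p = q :=
  PiLp.ext (Fin.forall_fin_two.2 ⟨h₀, h₁⟩)

theorem inner_eq_coords (p q : Point) : ⟪p, q⟫ = p 0 * q 0 + p 1 * q 1 := by
  simp [PiLp.inner_apply, Fin.sum_univ_two, mul_comm]

theorem norm_sq_eq_coords (p : Point) : ‖p‖ ^ 2 = p 0 ^ 2 + p 1 ^ 2 := by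
  simp [EuclideanSpace.norm_sq_eq, Fin.sum_univ_two]

theorem norm_eq_one_iff_coords {p : Point} : ‖p‖ = 1 ↔ p 0 ^ 2 + p 1 ^ 2 = 1 := by
  rw [← norm_sq_eq_coords, pow_eq_one_iff_of_nonneg (norm_nonneg p) two_ne_zero]

theorem toEuclideanLin_apply_zero (M : Matrix (Fin 2) (Fin 2) ℝ) (p : Point) :
    Matrix.toEuclideanLin M p 0 = M 0 0 * p 0 + M 0 1 * p 1 := by
  simp [Matrix.toLpLin_apply]

theorem toEuclideanLin_apply_one (M : Matrix (Fin 2) (Fin 2) ℝ) (p : Point) :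
    Matrix.toEuclideanLin M p 1 = M 1 0 * p 0 + M 1 1 * p 1 := by
  simp [Matrix.toLpLin_apply]

@[simp] theorem perp_apply_zero (p : Point) : perp p 0 = -p 1 := by
  simp [perp, toEuclideanLin_apply_zero, quarterTurn]

@[simp] theorem perp_apply_one (p : Point) : perp p 1 = p 0 := by
  simp [perp, toEuclideanLin_apply_one, quarterTurn]

@[simp] theorem inner_perp_self (p : Point) : ⟪p, perp p⟫ = 0 := by
  rw [inner_eq_coords, perp_apply_zero, perp_apply_one]; ring

@[simp] theorem norm_perp (p : Point) : ‖perp p‖ = ‖p‖ := by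
  rw [← sq_eq_sq₀ (norm_nonneg _) (norm_nonneg _), norm_sq_eq_coords, norm_sq_eq_coords,
    perp_apply_zero, perp_apply_one]
  ring

theorem norm_sq_smul_eq_add_perp (a p : Point) :
    ‖a‖ ^ 2 • p = ⟪a, p⟫ • a + ⟪perp a, p⟫ • perp a := by
  rw [norm_sq_eq_coords, inner_eq_coords, inner_eq_coords]
  apply Point.ext <;> simp <;> ring

theorem inner_sq_add_inner_perp_sq (a p : Point) :
    ⟪a, p⟫ ^ 2 + ⟪perp a, p⟫ ^ 2 = ‖a‖ ^ 2 * ‖p‖ ^ 2 := by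
  simp only [norm_sq_eq_coords, inner_eq_coords, perp_apply_zero, perp_apply_one]
  ring

end Coordinates

section SphereArgmin

theorem abs_sub_eq_abs_sub_clamp_add {lo hi x : ℝ} (hlo : lo ≤ x) (hhi : x ≤ hi) (c : ℝ) :
    |x - c| = |x - max lo (min hi c)| + |max lo (min hi c) - c| := by
  rcases le_total hi c with hc | hc
  · rw [min_eq_left hc, max_eq_right (hlo.trans hhi), abs_of_nonpos (by linarith),
      abs_of_nonpos (by linarith), abs_of_nonpos (by linarith)]
    ring
  rw [min_eq_right hc]
  rcases le_total lo c with hc' | hc'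
  · rw [max_eq_right hc', sub_self, abs_zero, add_zero]
  · rw [max_eq_left hc', abs_of_nonneg (by linarith), abs_of_nonneg (by linarith),
      abs_of_nonneg (by linarith)]
    ring

variable {V : Type*} [NormedAddCommGroup V]

/-- The value closest to `c` in `[-‖a‖, ‖a‖]`, which contains the range of `⟪a, ·⟫` on the unit
sphere. -/
def clampedLevel (a : V) (c : ℝ) : ℝ := max (-‖a‖) (min ‖a‖ c)

theorem abs_clampedLevel_le (a : V) (c : ℝ) : |clampedLevel a c| ≤ ‖a‖ :=
  abs_le.2 ⟨le_max_left _ _, max_le (by linarith [norm_nonneg a]) (min_le_left _ _)⟩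

theorem clampedLevel_sq_le (a : V) (c : ℝ) : clampedLevel a c ^ 2 ≤ ‖a‖ ^ 2 :=
  sq_le_sq' (abs_le.1 (abs_clampedLevel_le a c)).1 (abs_le.1 (abs_clampedLevel_le a c)).2

variable [InnerProductSpace ℝ V] {a u : V} {c : ℝ}

/-- `u` minimizes the distance `|⟪a, u⟫ - c|` to the level `c` over the unit sphere. -/
def IsSphereArgmin (a : V) (c : ℝ) (u : V) : Prop :=
  ‖u‖ = 1 ∧ ∀ y : V, ‖y‖ = 1 → |⟪a, u⟫ - c| ≤ |⟪a, y⟫ - c|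

theorem abs_inner_sub_eq_add (hu : ‖u‖ = 1) (a : V) (c : ℝ) :
    |⟪a, u⟫ - c| = |⟪a, u⟫ - clampedLevel a c| + |clampedLevel a c - c| := by
  have hinner : |⟪a, u⟫| ≤ ‖a‖ := by simpa [hu] using abs_real_inner_le_norm a u
  exact abs_sub_eq_abs_sub_clamp_add (abs_le.1 hinner).1 (abs_le.1 hinner).2 c

theorem isSphereArgmin_of_inner_eq (hu : ‖u‖ = 1) (h : ⟪a, u⟫ = clampedLevel a c) :
    IsSphereArgmin a c u := by
  refine ⟨hu, fun y hy => ?_⟩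
  rw [abs_inner_sub_eq_add hu, abs_inner_sub_eq_add hy, h, sub_self, abs_zero, zero_add]
  exact le_add_of_nonneg_left (abs_nonneg _)

theorem isSphereArgmin_zero_iff : IsSphereArgmin (0 : V) c u ↔ ‖u‖ = 1 := by
  simp [IsSphereArgmin]

theorem IsSphereArgmin.inner_eq {y : V} (h : IsSphereArgmin a c u) (hy : ‖y‖ = 1)
    (hy' : ⟪a, y⟫ = clampedLevel a c) : ⟪a, u⟫ = clampedLevel a c := by
  have hle := h.2 y hy
  rw [abs_inner_sub_eq_add h.1, abs_inner_sub_eq_add hy, hy', sub_self, abs_zero, zero_add,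
    add_le_iff_nonpos_left] at hle
  exact sub_eq_zero.1 (abs_nonpos_iff.1 hle)

end SphereArgmin

section CirclePt

variable {a u u' : Point} {c : ℝ}

/-- For `a ≠ 0`, the two points of the unit circle on which `⟪a, ·⟫` takes the value closest to `c`
(they coincide if this value is `±‖a‖`), indexed by the sign of their component along `perp a`.
For `a = 0` all unit vectors are equally good, and the choice is `(1, 0)`. -/
def circlePt (s : ℤˣ) (a : Point) (c : ℝ) : Point :=
  if a = 0 then !₂[1, 0]
  else (‖a‖ ^ 2)⁻¹ •
    (clampedLevel a c • a + (s * √(‖a‖ ^ 2 - clampedLevel a c ^ 2)) • perp a)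

theorem units_int_sq (s : ℤˣ) : (s : ℝ) ^ 2 = 1 := by
  rcases Int.units_eq_one_or s with rfl | rfl <;> simp

theorem sqrt_sub_clampedLevel_sq (a : Point) (c : ℝ) :
    √(‖a‖ ^ 2 - clampedLevel a c ^ 2) ^ 2 = ‖a‖ ^ 2 - clampedLevel a c ^ 2 :=
  Real.sq_sqrt (sub_nonneg.2 (clampedLevel_sq_le a c))

theorem inner_circlePt (s : ℤˣ) (a : Point) (c : ℝ) : ⟪a, circlePt s a c⟫ = clampedLevel a c := by
  by_cases ha : a = 0
  · simp [ha, clampedLevel]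
  · have : ‖a‖ ≠ 0 := norm_ne_zero_iff.2 ha
    rw [circlePt, if_neg ha, real_inner_smul_right, inner_add_right, real_inner_smul_right,
      real_inner_smul_right, inner_perp_self, real_inner_self_eq_norm_sq]
    field_simp
    ring

theorem inner_perp_circlePt (s : ℤˣ) (ha : a ≠ 0) (c : ℝ) :
    ⟪perp a, circlePt s a c⟫ = s * √(‖a‖ ^ 2 - clampedLevel a c ^ 2) := by
  have : ‖a‖ ≠ 0 := norm_ne_zero_iff.2 ha
  rw [circlePt, if_neg ha, real_inner_smul_right, inner_add_right, real_inner_smul_right,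
    real_inner_smul_right, real_inner_comm, inner_perp_self, real_inner_self_eq_norm_sq, norm_perp]
  field_simp
  ring

@[simp] theorem norm_circlePt (s : ℤˣ) (a : Point) (c : ℝ) : ‖circlePt s a c‖ = 1 := by
  by_cases ha : a = 0
  · simp [norm_eq_one_iff_coords, circlePt, ha]
  · have hsq := inner_sq_add_inner_perp_sq a (circlePt s a c)
    rw [inner_circlePt, inner_perp_circlePt s ha, mul_pow, units_int_sq, one_mul,
      sqrt_sub_clampedLevel_sq, add_sub_cancel, eq_comm, mul_eq_left₀ (by simpa using ha)] at hsq
    exact (pow_eq_one_iff_of_nonneg (norm_nonneg _) two_ne_zero).1 hsq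

theorem isSphereArgmin_circlePt (s : ℤˣ) (a : Point) (c : ℝ) :
    IsSphereArgmin a c (circlePt s a c) :=
  isSphereArgmin_of_inner_eq (norm_circlePt s a c) (inner_circlePt s a c)

theorem isSphereArgmin_iff_exists_circlePt (ha : a ≠ 0) :
    IsSphereArgmin a c u ↔ ∃ s, u = circlePt s a c := by
  refine ⟨fun h => ?_, by rintro ⟨s, rfl⟩; exact isSphereArgmin_circlePt s a c⟩
  have hinner := h.inner_eq (norm_circlePt 1 a c) (inner_circlePt 1 a c)
  have hperp : ⟪perp a, u⟫ ^ 2 = √(‖a‖ ^ 2 - clampedLevel a c ^ 2) ^ 2 := by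
    have hsq := inner_sq_add_inner_perp_sq a u
    rw [hinner, h.1] at hsq
    rw [sqrt_sub_clampedLevel_sq]
    linarith
  obtain ⟨s, hs⟩ : ∃ s : ℤˣ, ⟪perp a, u⟫ = s * √(‖a‖ ^ 2 - clampedLevel a c ^ 2) := by
    rcases sq_eq_sq_iff_eq_or_eq_neg.1 hperp with h' | h'
    · exact ⟨1, by simp [h']⟩
    · exact ⟨-1, by simp [h']⟩
  refine ⟨s, ?_⟩
  rw [circlePt, if_neg ha, eq_inv_smul_iff₀ (by simpa using ha), norm_sq_smul_eq_add_perp, hinner,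
    hs]

theorem norm_mul_norm_sub_circlePt_mul (ha : a ≠ 0) (hu : ‖u‖ = 1) (c : ℝ) :
    ‖a‖ * (‖u - circlePt 1 a c‖ * ‖u - circlePt (-1) a c‖) =
      2 * |⟪a, u⟫ - clampedLevel a c| := by
  have hN : ‖a‖ ^ 2 ≠ 0 := by simpa using ha
  have hroot := sqrt_sub_clampedLevel_sq a c
  have hpyth := inner_sq_add_inner_perp_sq a u
  have hnorm_sub : ∀ s : ℤˣ, ‖a‖ ^ 2 * ‖u - circlePt s a c‖ ^ 2 =
      2 * (‖a‖ ^ 2 - clampedLevel a c * ⟪a, u⟫ -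
        s * √(‖a‖ ^ 2 - clampedLevel a c ^ 2) * ⟪perp a, u⟫) := fun s => by
    have hinner : ‖a‖ ^ 2 * ⟪u, circlePt s a c⟫ = clampedLevel a c * ⟪a, u⟫ +
        s * √(‖a‖ ^ 2 - clampedLevel a c ^ 2) * ⟪perp a, u⟫ := by
      rw [circlePt, if_neg ha, real_inner_smul_right, mul_inv_cancel_left₀ hN, inner_add_right,
        real_inner_smul_right, real_inner_smul_right, real_inner_comm, real_inner_comm (perp a)]
    rw [norm_sub_sq_real, hu, norm_circlePt]
    linear_combination -2 * hinner
  have hpos := hnorm_sub 1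
  have hneg := hnorm_sub (-1)
  push_cast at hpos hneg
  rw [← sq_eq_sq₀ (by positivity) (by positivity), mul_pow, mul_pow, mul_pow, sq_abs]
  apply mul_left_cancel₀ hN
  rw [hu] at hpyth
  generalize √(‖a‖ ^ 2 - clampedLevel a c ^ 2) = w at *
  set m := clampedLevel a c
  calc ‖a‖ ^ 2 * (‖a‖ ^ 2 * (‖u - circlePt 1 a c‖ ^ 2 * ‖u - circlePt (-1) a c‖ ^ 2))
      = (‖a‖ ^ 2 * ‖u - circlePt 1 a c‖ ^ 2) * (‖a‖ ^ 2 * ‖u - circlePt (-1) a c‖ ^ 2) := by ring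
    _ = 4 * ((‖a‖ ^ 2 - m * ⟪a, u⟫) ^ 2 - w ^ 2 * ⟪perp a, u⟫ ^ 2) := by rw [hpos, hneg]; ring
    _ = ‖a‖ ^ 2 * (2 ^ 2 * (⟪a, u⟫ - m) ^ 2) := by
      linear_combination (-4 * ⟪perp a, u⟫ ^ 2) * hroot - 4 * (‖a‖ ^ 2 - m ^ 2) * hpyth

/-- By the triangle inequality, `u'` is at most twice as far from each of the two minimizers as
`u`, and the product of the distances to them is proportional to `|⟪a, ·⟫ - c|`. -/
theorem abs_inner_sub_le_four_mul (ha : a ≠ 0) (hu : ‖u‖ = 1) (hu' : ‖u'‖ = 1)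
    (hle : ∀ y, IsSphereArgmin a c y → ‖u - u'‖ ≤ ‖u - y‖) :
    |⟪a, u'⟫ - c| ≤ 4 * |⟪a, u⟫ - c| := by
  have hnorm : 0 < ‖a‖ := norm_pos_iff.2 ha
  have htwice : ∀ s : ℤˣ, ‖u' - circlePt s a c‖ ≤ 2 * ‖u - circlePt s a c‖ := fun s => by
    have htri := norm_sub_le_norm_sub_add_norm_sub u' u (circlePt s a c)
    have hs := hle _ (isSphereArgmin_circlePt s a c)
    rw [norm_sub_rev u' u] at htri
    linarith
  have hclamped : |⟪a, u'⟫ - clampedLevel a c| ≤ 4 * |⟪a, u⟫ - clampedLevel a c| := by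
    have hmul := mul_le_mul_of_nonneg_left
      (mul_le_mul (htwice 1) (htwice (-1)) (norm_nonneg _) (by positivity)) hnorm.le
    rw [norm_mul_norm_sub_circlePt_mul ha hu'] at hmul
    linarith [norm_mul_norm_sub_circlePt_mul ha hu c]
  rw [abs_inner_sub_eq_add hu, abs_inner_sub_eq_add hu']
  linarith [abs_nonneg (clampedLevel a c - c)]

end CirclePt

/-! ### Determinants, rotations, and alignments -/

section Det

/-- The determinant of the matrix with the columns `a`, `b`. -/
def det (a b : Point) : ℝ := ⟪perp a, b⟫

variable {a b q q' : Point}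

theorem det_eq_coords (a b : Point) : det a b = a 0 * b 1 - a 1 * b 0 := by
  rw [det, inner_eq_coords, perp_apply_zero, perp_apply_one]; ring

theorem eq_of_inner_eq (h : det a b ≠ 0) (ha : ⟪a, q⟫ = ⟪a, q'⟫) (hb : ⟪b, q⟫ = ⟪b, q'⟫) :
    q = q' := by
  rw [inner_eq_coords, inner_eq_coords] at ha hb
  apply Point.ext <;> apply mul_left_cancel₀ h <;> rw [det_eq_coords]
  · linear_combination b 1 * ha - a 1 * hb
  · linear_combination a 0 * hb - b 0 * ha

theorem inner_eq_zero_of_det_eq_zero (ha : a ≠ 0) (h : det a b = 0) (hq : ⟪a, q⟫ = 0) :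
    ⟪b, q⟫ = 0 := by
  have hsmul := norm_sq_smul_eq_add_perp a b
  rw [← det, h, zero_smul, add_zero] at hsmul
  have hinner : ‖a‖ ^ 2 * ⟪b, q⟫ = 0 := by
    rw [← real_inner_smul_left, hsmul, real_inner_smul_left, hq, mul_zero]
  exact (mul_eq_zero.1 hinner).resolve_left (by simpa using ha)

/-- If `det a b ≠ 0`, the point `q` with `⟪a, q⟫ = x` and `⟪b, q⟫ = y` (Cramer's rule). -/
def cramerPoint (a b : Point) (x y : ℝ) : Point := (det a b)⁻¹ • (y • perp a - x • perp b)

theorem inner_perp_right (a b : Point) : ⟪a, perp b⟫ = -det a b := by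
  rw [det_eq_coords, inner_eq_coords, perp_apply_zero, perp_apply_one]; ring

theorem inner_left_cramerPoint (h : det a b ≠ 0) (x y : ℝ) : ⟪a, cramerPoint a b x y⟫ = x := by
  rw [cramerPoint, real_inner_smul_right, inner_sub_right, real_inner_smul_right,
    real_inner_smul_right, inner_perp_self, inner_perp_right]
  field_simp
  ring

theorem inner_right_cramerPoint (h : det a b ≠ 0) (x y : ℝ) : ⟪b, cramerPoint a b x y⟫ = y := by
  rw [cramerPoint, real_inner_smul_right, inner_sub_right, real_inner_smul_right,
    real_inner_smul_right, inner_perp_self, real_inner_comm, ← det]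
  field_simp
  ring

end Det

section Rotate

/-- The product of `u` and `p` as complex numbers. If `u` is a unit vector, this is the image of `p`
under the rotation that takes `(1, 0)` to `u`. -/
def rotate (u p : Point) : Point := u 0 • p + u 1 • perp p

theorem rotate_apply_zero (u p : Point) : rotate u p 0 = u 0 * p 0 - u 1 * p 1 := by
  simp only [rotate, PiLp.add_apply, PiLp.smul_apply, perp_apply_zero, smul_eq_mul]; ring

theorem rotate_apply_one (u p : Point) : rotate u p 1 = u 0 * p 1 + u 1 * p 0 := by
  simp only [rotate, PiLp.add_apply, PiLp.smul_apply, perp_apply_one, smul_eq_mul]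

theorem rotate_comm (u p : Point) : rotate u p = rotate p u := by
  apply Point.ext <;> simp only [rotate_apply_zero, rotate_apply_one] <;> ring

theorem rotate_rotate (u v p : Point) : rotate u (rotate v p) = rotate (rotate u v) p := by
  apply Point.ext <;> simp only [rotate_apply_zero, rotate_apply_one] <;> ring

theorem rotate_sub (u p q : Point) : rotate u (p - q) = rotate u p - rotate u q := by
  apply Point.ext <;> simp only [rotate_apply_zero, rotate_apply_one, PiLp.sub_apply] <;> ring

theorem rotate_smul (u : Point) (c : ℝ) (p : Point) : rotate u (c • p) = c • rotate u p := by
  apply Point.ext <;>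
    simp only [rotate_apply_zero, rotate_apply_one, PiLp.smul_apply, smul_eq_mul] <;> ring

@[simp] theorem norm_rotate (u p : Point) : ‖rotate u p‖ = ‖u‖ * ‖p‖ := by
  rw [← sq_eq_sq₀ (norm_nonneg _) (by positivity), mul_pow]
  simp only [norm_sq_eq_coords, rotate_apply_zero, rotate_apply_one]
  ring

theorem exists_rotate_eq {p q : Point} (h : ‖p‖ = ‖q‖) : ∃ u : Point, ‖u‖ = 1 ∧ rotate u p = q := by
  by_cases hp : p = 0
  · have hq : q = 0 := by rwa [hp, norm_zero, eq_comm, norm_eq_zero] at h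
    exact ⟨!₂[1, 0], by simp [norm_eq_one_iff_coords], by rw [hp, hq, rotate_comm]; simp [rotate]⟩
  have hp' : ‖p‖ ^ 2 ≠ 0 := by simpa using hp
  have hrot : rotate ((‖p‖ ^ 2)⁻¹ • !₂[⟪p, q⟫, ⟪perp p, q⟫]) p = q := by
    apply smul_right_injective _ hp'
    simp only [norm_sq_smul_eq_add_perp p q, rotate, PiLp.smul_apply, smul_add, smul_smul,
      smul_eq_mul, mul_inv_cancel_left₀ hp', Matrix.cons_val_zero, Matrix.cons_val_one]
  refine ⟨_, ?_, hrot⟩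
  have hnorm := norm_rotate ((‖p‖ ^ 2)⁻¹ • !₂[⟪p, q⟫, ⟪perp p, q⟫]) p
  rw [hrot, ← h, eq_comm] at hnorm
  exact (mul_eq_right₀ (norm_ne_zero_iff.2 hp)).1 hnorm

end Rotate

namespace RigidMotion

variable {g g' : RigidMotion} {u : Point}

/-- The first column of the rotation matrix, that is, the image of `(1, 0)`. -/
def dir (g : RigidMotion) : Point :=
  !₂[(g.1 : Matrix (Fin 2) (Fin 2) ℝ) 0 0, (g.1 : Matrix (Fin 2) (Fin 2) ℝ) 1 0]

theorem matrix_eq (g : RigidMotion) :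
    (g.1 : Matrix (Fin 2) (Fin 2) ℝ) = !![g.dir 0, -g.dir 1; g.dir 1, g.dir 0] := by
  obtain ⟨hdiag, hanti, -⟩ := Matrix.mem_specialOrthogonalGroup_fin_two_iff.1 g.1.2
  rw [Matrix.eta_fin_two (g.1 : Matrix (Fin 2) (Fin 2) ℝ), hanti, ← hdiag]
  rfl

@[simp] theorem norm_dir (g : RigidMotion) : ‖g.dir‖ = 1 := by
  obtain ⟨-, hanti, hsq⟩ := Matrix.mem_specialOrthogonalGroup_fin_two_iff.1 g.1.2
  rw [hanti, neg_sq] at hsq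
  exact norm_eq_one_iff_coords.2 hsq

theorem fst_eq_fst_iff : g.1 = g'.1 ↔ g.dir = g'.dir := by
  refine ⟨fun h => by rw [dir, h, dir], fun h => Subtype.ext ?_⟩
  rw [matrix_eq, matrix_eq, h]

theorem ext (hdir : g.dir = g'.dir) (hsnd : g.2 = g'.2) : g = g' :=
  Prod.ext (fst_eq_fst_iff.2 hdir) hsnd

/-- The alignment whose rotation takes `(1, 0)` to `u`. -/
def ofDir (u : Point) (hu : ‖u‖ = 1) (t : Point) : RigidMotion :=
  (⟨!![u 0, -u 1; u 1, u 0], Matrix.of_mem_specialOrthogonalGroup_fin_two_iff.2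
    ⟨rfl, rfl, by rwa [neg_sq, ← norm_eq_one_iff_coords]⟩⟩, t)

@[simp] theorem dir_ofDir (hu : ‖u‖ = 1) (t : Point) : (ofDir u hu t).dir = u :=
  Point.ext rfl rfl

theorem move_eq (g : RigidMotion) (p : Point) : g.move p = rotate g.dir p - g.2 := by
  rw [move, matrix_eq]
  congr 1
  apply Point.ext <;>
    simp only [toEuclideanLin_apply_zero, toEuclideanLin_apply_one, rotate_apply_zero,
      rotate_apply_one, Matrix.of_apply, Matrix.cons_val', Matrix.cons_val_zero,
      Matrix.cons_val_one, Matrix.cons_val_fin_one] <;> ring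

theorem move_ofDir (hu : ‖u‖ = 1) (t p : Point) : (ofDir u hu t).move p = rotate u p - t := by
  rw [move_eq, dir_ofDir]
  rfl

theorem move_sub_move (g : RigidMotion) (p q : Point) :
    g.move q - g.move p = rotate g.dir (q - p) := by
  rw [move_eq, move_eq, rotate_sub, sub_sub_sub_cancel_right]

end RigidMotion

/-! ### Distances to a line -/

section DistanceToLine

/-- The value of the equation of `L` at `q`, the common measure of all the distances to `L`. -/
def Line.residual (L : Line) (q : Point) : ℝ := ⟪L.normal, q⟫ - L.offset

theorem Line.mem_carrier_iff {L : Line} {q : Point} : q ∈ L.carrier ↔ L.residual q = 0 :=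
  sub_eq_zero.symm

theorem Line.residual_add (L : Line) (q v : Point) :
    L.residual (q + v) = L.residual q + ⟪L.normal, v⟫ := by
  rw [residual, residual, inner_add_right]; ring

theorem Line.residual_sub (L : Line) (q v : Point) :
    L.residual (q - v) = L.residual q - ⟪L.normal, v⟫ := by
  rw [residual, residual, inner_sub_right]; ring

/-- The orthogonal projection of the origin to `L`. -/
def Line.foot (L : Line) : Point := (L.offset / ‖L.normal‖ ^ 2) • L.normal

theorem Line.residual_foot (L : Line) : L.residual L.foot = 0 := by
  have := norm_ne_zero_iff.2 L.normal_ne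
  rw [residual, foot, real_inner_smul_right, real_inner_self_eq_norm_sq]
  field_simp
  ring

theorem Line.exists_residual_eq_zero_dist_eq (L : Line) (q : Point) :
    ∃ q', L.residual q' = 0 ∧ dist q q' = |L.residual q| / ‖L.normal‖ := by
  have := norm_ne_zero_iff.2 L.normal_ne
  refine ⟨q - (L.residual q / ‖L.normal‖ ^ 2) • L.normal, ?_, ?_⟩
  · rw [residual_sub, real_inner_smul_right, real_inner_self_eq_norm_sq]
    field_simp
    ring
  · rw [dist_eq_norm, sub_sub_cancel, norm_smul, Real.norm_eq_abs, abs_div, abs_pow, abs_norm]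
    field_simp

theorem Line.abs_residual_sub_le (L : Line) (q q' : Point) :
    |L.residual q - L.residual q'| ≤ ‖L.normal‖ * dist q q' := by
  rw [residual, residual, sub_sub_sub_cancel_right, ← inner_sub_right, dist_eq_norm]
  exact abs_real_inner_le_norm _ _

theorem Line.infDist_carrier (L : Line) (q : Point) :
    Metric.infDist q L.carrier = |L.residual q| / ‖L.normal‖ := by
  obtain ⟨q', hq', hdist⟩ := L.exists_residual_eq_zero_dist_eq q
  refine le_antisymm (hdist ▸ Metric.infDist_le_dist_of_mem (mem_carrier_iff.2 hq')) ?_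
  refine (Metric.le_infDist ⟨q', mem_carrier_iff.2 hq'⟩).2 fun y hy => ?_
  rw [div_le_iff₀ (norm_pos_iff.2 L.normal_ne), mul_comm]
  simpa [mem_carrier_iff.1 hy] using L.abs_residual_sub_le q y

theorem Line.infDist_carrier_le_iff {L : Line} {q q' : Point} :
    Metric.infDist q L.carrier ≤ Metric.infDist q' L.carrier ↔
      |L.residual q| ≤ |L.residual q'| := by
  rw [infDist_carrier, infDist_carrier, div_le_div_iff_of_pos_right (norm_pos_iff.2 L.normal_ne)]

theorem lzNorm_smul {z : ℝ} (hz : z ≠ 0) (c : ℝ) (x : Point) :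
    lzNorm z (c • x) = ‖c‖₊ * lzNorm z x := by
  simp only [lzNorm, PiLp.smul_apply, smul_eq_mul, nnnorm_mul, NNReal.mul_rpow]
  rw [← mul_add, NNReal.mul_rpow, ← NNReal.rpow_mul, mul_one_div_cancel hz, NNReal.rpow_one]

theorem lzDist_hyperplane_eq_lzDist_zero (z : ℝ) (y a : Point) (c : ℝ) :
    lzDist z y (hyperplane a c) = ⨅ w : hyperplane a (⟪a, y⟫ - c), lzNorm z w :=
  ((Equiv.subLeft y).subtypeEquiv fun q => by
    simp [hyperplane, inner_sub_right, sub_right_inj]).iInf_congr fun _ => rfl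

theorem iInf_lzNorm_hyperplane {z : ℝ} (hz : z ≠ 0) (a : Point) (s : ℝ) :
    ⨅ w : hyperplane a s, lzNorm z w = (⨅ w : hyperplane a 1, lzNorm z w) * ‖s‖₊ := by
  rcases eq_or_ne s 0 with rfl | hs
  · rw [nnnorm_zero, mul_zero, ← nonpos_iff_eq_zero]
    refine (ciInf_le (OrderBot.bddBelow _) ⟨0, by simp [hyperplane]⟩).trans ?_
    simp [lzNorm, hz, NNReal.zero_rpow]
  · rw [NNReal.iInf_mul]
    refine (((LinearEquiv.smulOfNeZero ℝ Point s hs).toEquiv.subtypeEquiv fun w => ?_).iInf_congr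
      fun w => ?_).symm
    · simp [hyperplane, inner_smul_right, hs]
    · exact (lzNorm_smul hz s w).trans (mul_comm _ _)

theorem exists_Dz_eq {z : ℝ} (hz : z ≠ 0) (L : Line) :
    ∃ κ : ℝ≥0, ∀ (p : Point) (g : RigidMotion), Dz z (p, L) g = κ * ‖L.residual (g.move p)‖₊ :=
  ⟨⨅ w : hyperplane L.normal 1, lzNorm z w, fun _ _ =>
    (lzDist_hyperplane_eq_lzDist_zero z _ _ _).trans (iInf_lzNorm_hyperplane hz _ _)⟩

end DistanceToLine

/-! ### Feasible alignments -/

section Feasible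

/-- The signed gap between the moved point and the line of a pair. All the costs of an alignment
are functions of its absolute value. -/
def gap (a : Point × Line) (g : RigidMotion) : ℝ := a.2.residual (g.move a.1)

/-- The alignments considered in an iteration of Align: those that put the point of `a` on its
line and, unless the two lines are parallel, also the point of `b` on its line. -/
def feasible (a b : Point × Line) : Set RigidMotion :=
  {g | gap a g = 0 ∧ (det a.2.normal b.2.normal ≠ 0 → gap b g = 0)}

/-- The translation that makes the rotation with first column `u` feasible; if the lines are
parallel, it puts the point of `a` at the foot of its line. It is defined for all vectors `u`, of
which it is an affine function. -/
def feasibleShift (a b : Point × Line) (u : Point) : Point :=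
  if det a.2.normal b.2.normal = 0 then rotate u a.1 - a.2.foot
  else cramerPoint a.2.normal b.2.normal (a.2.residual (rotate u a.1)) (b.2.residual (rotate u b.1))

/-- The gap of `c` after the rotation `u` and its feasible translation, extended to an affine
function of all vectors `u`. -/
def feasibleGap (a b c : Point × Line) (u : Point) : ℝ :=
  c.2.residual (rotate u c.1 - feasibleShift a b u)

/-- The linear part of `feasibleGap a b c`, computed by interpolation. -/
def gapSlope (a b c : Point × Line) : Point :=
  !₂[feasibleGap a b c !₂[1, 0] - feasibleGap a b c 0,
    feasibleGap a b c !₂[0, 1] - feasibleGap a b c 0]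

/-- The negative of the constant part of `feasibleGap a b c`, so that a zero of the gap is
a solution `u` of `⟪gapSlope a b c, u⟫ = gapLevel a b c`. -/
def gapLevel (a b c : Point × Line) : ℝ := -feasibleGap a b c 0

variable {a b c : Point × Line} {u : Point} {g : RigidMotion}

theorem gap_eq (a : Point × Line) (g : RigidMotion) :
    gap a g = a.2.residual (rotate g.dir a.1) - ⟪a.2.normal, g.2⟫ := by
  rw [gap, RigidMotion.move_eq, Line.residual_sub]

theorem gap_ofDir (a : Point × Line) (hu : ‖u‖ = 1) (t : Point) :
    gap a (.ofDir u hu t) = a.2.residual (rotate u a.1) - ⟪a.2.normal, t⟫ := by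
  rw [gap, RigidMotion.move_ofDir, Line.residual_sub]

theorem ofDir_feasibleShift_mem_feasible (a b : Point × Line) (hu : ‖u‖ = 1) :
    .ofDir u hu (feasibleShift a b u) ∈ feasible a b := by
  rw [feasible, Set.mem_ofPred_eq, gap_ofDir, gap_ofDir, feasibleShift]
  split_ifs with hdet
  · exact ⟨by rw [← Line.residual_sub, sub_sub_cancel, Line.residual_foot], fun h => absurd hdet h⟩
  · rw [inner_left_cramerPoint hdet, inner_right_cramerPoint hdet]
    exact ⟨sub_self _, fun _ => sub_self _⟩

/-- Feasible alignments with the same rotation differ by a translation along the common direction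
of the lines. -/
theorem gap_eq_feasibleGap (hc : det a.2.normal b.2.normal = 0 → det a.2.normal c.2.normal = 0)
    (hg : g ∈ feasible a b) : gap c g = feasibleGap a b c g.dir := by
  obtain ⟨ha, hb⟩ := hg
  obtain ⟨ha', hb'⟩ := ofDir_feasibleShift_mem_feasible a b g.norm_dir
  rw [gap_ofDir] at ha' hb'
  rw [gap_eq] at ha hb
  have hat : ⟪a.2.normal, g.2 - feasibleShift a b g.dir⟫ = 0 := by rw [inner_sub_right]; linarith
  rw [gap_eq, feasibleGap, Line.residual_sub, sub_right_inj, ← sub_eq_zero, ← inner_sub_right]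
  by_cases hdet : det a.2.normal b.2.normal = 0
  · exact inner_eq_zero_of_det_eq_zero a.2.normal_ne (hc hdet) hat
  · have hbt : ⟪b.2.normal, g.2 - feasibleShift a b g.dir⟫ = 0 := by
      rw [inner_sub_right]; linarith [hb hdet, hb' hdet]
    have : g.2 - feasibleShift a b g.dir = 0 :=
      eq_of_inner_eq hdet (by rw [hat, inner_zero_right]) (by rw [hbt, inner_zero_right])
    rw [this, inner_zero_right]

theorem feasibleGap_eq (a b c : Point × Line) (u : Point) :
    feasibleGap a b c u = ⟪gapSlope a b c, u⟫ - gapLevel a b c := by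
  rw [gapSlope, gapLevel]
  simp only [feasibleGap, feasibleShift]
  split_ifs <;>
  · simp only [inner_eq_coords, Line.residual, cramerPoint, rotate_apply_zero, rotate_apply_one,
      PiLp.sub_apply, PiLp.smul_apply, smul_eq_mul, perp_apply_zero, perp_apply_one,
      Matrix.cons_val_zero, Matrix.cons_val_one, PiLp.zero_apply]
    ring

/-- The alignments selected in an iteration of Align: the feasible ones that move the point of `c`
closest to its line. -/
def closest (a b c : Point × Line) : Set RigidMotion :=
  {g ∈ feasible a b | ∀ g' ∈ feasible a b, |gap c g| ≤ |gap c g'|}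

theorem mem_closest_iff (hc : det a.2.normal b.2.normal = 0 → det a.2.normal c.2.normal = 0)
    (hg : g ∈ feasible a b) :
    g ∈ closest a b c ↔ IsSphereArgmin (gapSlope a b c) (gapLevel a b c) g.dir := by
  have gap_eq_inner : ∀ g ∈ feasible a b, gap c g = ⟪gapSlope a b c, g.dir⟫ - gapLevel a b c :=
    fun g hg => (gap_eq_feasibleGap hc hg).trans (feasibleGap_eq a b c g.dir)
  constructor
  · refine fun h => ⟨g.norm_dir, fun u hu => ?_⟩
    have hu_mem := ofDir_feasibleShift_mem_feasible a b hu
    simpa only [gap_eq_inner _ hg, gap_eq_inner _ hu_mem, RigidMotion.dir_ofDir]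
      using h.2 _ hu_mem
  · refine fun h => ⟨hg, fun g' hg' => ?_⟩
    rw [gap_eq_inner g hg, gap_eq_inner g' hg']
    exact h.2 g'.dir g'.norm_dir

/-- A closed form for two alignments that represent all the rotations of `closest a b c` if there
are finitely many of them, and coincide otherwise. -/
def candidate (a b c : Point × Line) (s : ℤˣ) : RigidMotion :=
  .ofDir (circlePt s (gapSlope a b c) (gapLevel a b c)) (norm_circlePt _ _ _)
    (feasibleShift a b (circlePt s (gapSlope a b c) (gapLevel a b c)))

theorem candidate_mem_closest
    (hc : det a.2.normal b.2.normal = 0 → det a.2.normal c.2.normal = 0) (s : ℤˣ) :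
    candidate a b c s ∈ closest a b c :=
  (mem_closest_iff hc (ofDir_feasibleShift_mem_feasible a b _)).2
    ((RigidMotion.dir_ofDir _ _).symm ▸ isSphereArgmin_circlePt s _ _)

theorem candidate_eq_of_fst_eq {s s' : ℤˣ}
    (h : (candidate a b c s).1 = (candidate a b c s').1) :
    candidate a b c s = candidate a b c s' := by
  have hdir := RigidMotion.fst_eq_fst_iff.1 h
  refine RigidMotion.ext hdir ?_
  simp only [candidate, RigidMotion.dir_ofDir] at hdir
  exact congrArg (feasibleShift a b) hdir

theorem infinite_sphere_one : (Metric.sphere (0 : Point) 1).Infinite :=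
  (isPreconnected_sphere (by simp [← Module.finrank_eq_rank]) 0 1).infinite_of_nontrivial
    ⟨!₂[1, 0], by simp [norm_eq_one_iff_coords], !₂[-1, 0], by simp [norm_eq_one_iff_coords],
      fun h => by norm_num [PiLp.ext_iff] at h⟩

theorem infinite_rotations_closest
    (hc : det a.2.normal b.2.normal = 0 → det a.2.normal c.2.normal = 0)
    (hslope : gapSlope a b c = 0) : (Prod.fst '' closest a b c).Infinite := by
  have := infinite_sphere_one.to_subtype
  refine Set.infinite_of_injective_forall_mem
    (f := fun u : Metric.sphere (0 : Point) 1 =>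
      (RigidMotion.ofDir u (norm_eq_of_mem_sphere u) (feasibleShift a b u)).1)
    (fun u u' huu' => Subtype.ext ?_) fun u => ⟨_, ?_, rfl⟩
  · simpa using RigidMotion.fst_eq_fst_iff.1 huu'
  · rw [mem_closest_iff hc (ofDir_feasibleShift_mem_feasible a b _), hslope,
      isSphereArgmin_zero_iff]
    exact RigidMotion.norm_dir _

theorem exists_candidate_fst_eq
    (hc : det a.2.normal b.2.normal = 0 → det a.2.normal c.2.normal = 0)
    (hslope : gapSlope a b c ≠ 0) (hg : g ∈ closest a b c) : ∃ s, (candidate a b c s).1 = g.1 := by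
  obtain ⟨s, hs⟩ := (isSphereArgmin_iff_exists_circlePt hslope).1 ((mem_closest_iff hc hg.1).1 hg)
  exact ⟨s, RigidMotion.fst_eq_fst_iff.2 (by rw [candidate, RigidMotion.dir_ofDir, hs])⟩

theorem finite_rotations_closest
    (hc : det a.2.normal b.2.normal = 0 → det a.2.normal c.2.normal = 0)
    (hslope : gapSlope a b c ≠ 0) : (Prod.fst '' closest a b c).Finite := by
  refine (Set.finite_range fun s => (candidate a b c s).1).subset ?_
  rintro _ ⟨g, hg, rfl⟩
  exact exists_candidate_fst_eq hc hslope hg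

theorem isSelection_range_candidate
    (hc : det a.2.normal b.2.normal = 0 → det a.2.normal c.2.normal = 0) :
    IsSelection (closest a b c) (Set.range (candidate a b c)) := by
  refine ⟨Set.range_subset_iff.2 (candidate_mem_closest hc), ?_⟩
  by_cases hslope : gapSlope a b c = 0
  · refine .inr ⟨infinite_rotations_closest hc hslope, candidate a b c 1, ?_⟩
    exact Set.range_eq_singleton_iff.2 fun s => by simp [candidate, hslope, circlePt]
  · refine .inl ⟨finite_rotations_closest hc hslope, ?_⟩
    rintro _ ⟨g, hg, rfl⟩
    obtain ⟨s, hs⟩ := exists_candidate_fst_eq hc hslope hg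
    refine ⟨_, ⟨⟨s, rfl⟩, hs⟩, ?_⟩
    rintro _ ⟨⟨s', rfl⟩, hs'⟩
    exact candidate_eq_of_fst_eq (hs'.trans hs.symm)

end Feasible

/-! ### The configurations found by Z-Configs -/

section ZConfigs

variable {v w p q y : Point}

theorem toEuclideanLin_transpose_toXAxis_mul (u : Point) (M : Matrix (Fin 2) (Fin 2) ℝ)
    (x : Point) : Matrix.toEuclideanLin ((toXAxis u).transpose * M) x =
      rotate u (Matrix.toEuclideanLin M x) := by
  apply Point.ext <;>
    simp [toEuclideanLin_apply_zero, toEuclideanLin_apply_one, rotate_apply_zero, rotate_apply_one,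
      toXAxis] <;> ring

theorem toEuclideanLin_quarterTurn_mul (M : Matrix (Fin 2) (Fin 2) ℝ) (x : Point) :
    Matrix.toEuclideanLin (quarterTurn * M) x = perp (Matrix.toEuclideanLin M x) := by
  rw [perp, Matrix.toLpLin_mul_same, LinearMap.comp_apply]

theorem zConfigs_fst_apply_one (v p q y x : Point) :
    Matrix.toEuclideanLin (zConfigs v p q y).1 x 1 = 0 := by
  simp [zConfigs, toEuclideanLin_apply_one]

theorem zConfigs_snd_apply (hv : v 1 ≠ 0) (p q y x : Point) :
    Matrix.toEuclideanLin (zConfigs v p q y).2.1 x = (dist p q * x 0 / v 1) • v := by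
  apply Point.ext <;>
    simp [zConfigs, toEuclideanLin_apply_zero, toEuclideanLin_apply_one] <;> field

theorem zConfigs_snd_sub_fst_apply (v p q y x : Point) :
    Matrix.toEuclideanLin (zConfigs v p q y).2.1 x - Matrix.toEuclideanLin (zConfigs v p q y).1 x =
      dist p q • perp x := by
  apply Point.ext <;> simp [zConfigs, toEuclideanLin_apply_zero, toEuclideanLin_apply_one]

theorem inner_sub_sub_eq_dist (p q y : Point) :
    ⟪q - p, y - p⟫ = (dist p q ^ 2 + dist p y ^ 2 - dist q y ^ 2) / 2 := by
  rw [real_inner_eq_norm_mul_self_add_norm_mul_self_sub_norm_sub_mul_self_div_two,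
    sub_sub_sub_cancel_right, dist_comm p q, dist_comm p y, dist_eq_norm, dist_eq_norm,
    dist_eq_norm]
  ring

/-- The height of the triangle `p, q, y` over the side `p, q`, up to the factor `dist p q`. -/
theorem dist_mul_sqrt_eq_abs_inner_perp (hpq : p ≠ q) (y : Point) :
    dist p q * √|dist p y ^ 2 - (⟪q - p, y - p⟫ / dist p q) ^ 2| = |⟪perp (q - p), y - p⟫| := by
  have hr : 0 < dist p q := dist_pos.2 hpq
  have hpyth := inner_sq_add_inner_perp_sq (q - p) (y - p)
  rw [← dist_eq_norm, ← dist_eq_norm, dist_comm q, dist_comm y] at hpyth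
  have hsq : dist p y ^ 2 - (⟪q - p, y - p⟫ / dist p q) ^ 2 =
      (⟪perp (q - p), y - p⟫ / dist p q) ^ 2 := by
    field_simp
    linarith
  rw [hsq, abs_sq, Real.sqrt_sq_eq_abs, abs_div, abs_of_pos hr, mul_div_cancel₀ _ hr.ne']

theorem exists_zConfigs_trd_apply_eq (hpq : p ≠ q) (v y : Point) :
    ∃ c, rotate c (q - p) = y - p ∧ ∀ x, Matrix.toEuclideanLin (zConfigs v p q y).2.2 x =
      Matrix.toEuclideanLin (zConfigs v p q y).1 x +
        rotate c (Matrix.toEuclideanLin (zConfigs v p q y).2.1 x -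
          Matrix.toEuclideanLin (zConfigs v p q y).1 x) := by
  have hr : dist p q ≠ 0 := dist_ne_zero.2 hpq
  set d := ⟪q - p, y - p⟫ / dist p q with hd
  have hd₁ : (dist p q ^ 2 + dist p y ^ 2 - dist q y ^ 2) / (2 * dist p q) = d := by
    rw [hd, inner_sub_sub_eq_dist]
    field_simp
  set β : ℝ := if 0 < ⟪y - p, perp (q - p)⟫ then 1 else -1 with hβ
  have hheight : β * (√|dist p y ^ 2 - d ^ 2| * dist p q) = ⟪perp (q - p), y - p⟫ := by
    rw [mul_comm √_, dist_mul_sqrt_eq_abs_inner_perp hpq, hβ, real_inner_comm]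
    split_ifs with hpos
    · rw [one_mul, abs_of_pos hpos]
    · rw [neg_one_mul, abs_of_nonpos (not_lt.1 hpos), neg_neg]
  refine ⟨!₂[d / dist p q, β * (√|dist p y ^ 2 - d ^ 2| / dist p q)], ?_, fun x => ?_⟩
  · have hscale := norm_sq_smul_eq_add_perp (q - p) (y - p)
    rw [← dist_eq_norm, dist_comm q, ← hheight, ← div_mul_cancel₀ ⟪q - p, _⟫ hr, ← hd] at hscale
    apply smul_right_injective Point (pow_ne_zero 2 hr)
    dsimp only
    rw [hscale, rotate, smul_add, smul_smul, smul_smul]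
    simp only [Matrix.cons_val_zero, Matrix.cons_val_one]
    congr 2 <;> field_simp
  · have hZ : (zConfigs v p q y).2.2 = (zConfigs v p q y).1 +
        (d / dist p q) • ((zConfigs v p q y).2.1 - (zConfigs v p q y).1) +
        (β * (√|dist p y ^ 2 - d ^ 2| / dist p q)) •
          (quarterTurn * ((zConfigs v p q y).2.1 - (zConfigs v p q y).1)) := by
      rw [← hd₁]
      exact if_neg hr
    simp only [hZ, map_add, map_smul, map_sub, LinearMap.add_apply, LinearMap.smul_apply,
      LinearMap.sub_apply, toEuclideanLin_quarterTurn_mul, add_assoc]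
    rfl

/-- Up to the position of `P x`, Z-Configs returns `p, q, y` rotated by all the angles as `x` runs
over the unit circle. -/
theorem exists_zConfigs_sub_eq_rotate (v p q y : Point) :
    ∃ u, ‖u‖ = 1 ∧ ∀ x,
      Matrix.toEuclideanLin (zConfigs v p q y).2.1 x -
        Matrix.toEuclideanLin (zConfigs v p q y).1 x = rotate (rotate u x) (q - p) ∧
      Matrix.toEuclideanLin (zConfigs v p q y).2.2 x -
        Matrix.toEuclideanLin (zConfigs v p q y).1 x = rotate (rotate u x) (y - p) := by
  rcases eq_or_ne p q with rfl | hpq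
  · obtain ⟨u, hu, hup⟩ := exists_rotate_eq (p := y - p) (q := !₂[dist p y, 0]) <| by
      simp [EuclideanSpace.norm_eq, dist_comm p y, dist_eq_norm y p]
    refine ⟨u, hu, fun x => ⟨?_, ?_⟩⟩
    · rw [zConfigs_snd_sub_fst_apply, dist_self, zero_smul, sub_self, rotate_comm]
      simp [rotate]
    · rw [rotate_comm u, ← rotate_rotate, hup, rotate_comm]
      simp [zConfigs, rotate]
  · obtain ⟨c, hc, hZ⟩ := exists_zConfigs_trd_apply_eq hpq v y
    obtain ⟨u, hu, hup⟩ := exists_rotate_eq (p := q - p) (q := !₂[0, dist p q]) <| by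
      simp [EuclideanSpace.norm_eq, dist_comm p q, dist_eq_norm q p]
    have hQ : ∀ x, Matrix.toEuclideanLin (zConfigs v p q y).2.1 x -
        Matrix.toEuclideanLin (zConfigs v p q y).1 x = rotate (rotate u x) (q - p) := fun x => by
      rw [zConfigs_snd_sub_fst_apply, rotate_comm u, ← rotate_rotate, hup, rotate_comm]
      simp [rotate]
    refine ⟨u, hu, fun x => ⟨hQ x, ?_⟩⟩
    rw [hZ, add_sub_cancel_left, hQ, rotate_rotate, rotate_comm c, ← rotate_rotate, hc]

end ZConfigs

/-! ### The alignments considered by Align -/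

section LineRep

variable {v w : Point}

theorem abs_inner_eq_one_iff_det_eq_zero (hv : ‖v‖ = 1) (hw : ‖w‖ = 1) :
    |⟪v, w⟫| = 1 ↔ det v w = 0 := by
  have hpyth := inner_sq_add_inner_perp_sq v w
  rw [hv, hw, ← det] at hpyth
  rw [← abs_one (α := ℝ), ← sq_eq_sq_iff_abs_eq_abs, ← sq_eq_zero_iff (a := det v w)]
  constructor <;> intro h <;> linarith

theorem Line.exists_inner_sub_eq {L : Line} {b : ℝ} (hv : ‖v‖ = 1)
    (h : L.carrier = hyperplane v b) :
    ∃ α ≠ 0, v = α • L.normal ∧ ∀ q, ⟪v, q⟫ - b = α * L.residual q := by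
  have mem_hyperplane : ∀ q, L.residual q = 0 → ⟪v, q⟫ = b := fun q hq =>
    h.subset (mem_carrier_iff.2 hq)
  have hfoot := mem_hyperplane _ L.residual_foot
  have hperp := mem_hyperplane (L.foot + perp L.normal) (by
    rw [residual_add, residual_foot, inner_perp_self, add_zero])
  rw [inner_add_right, hfoot, add_eq_left, real_inner_comm] at hperp
  have hparallel := norm_sq_smul_eq_add_perp L.normal v
  rw [hperp, zero_smul, add_zero] at hparallel
  have hN : ‖L.normal‖ ^ 2 ≠ 0 := by simpa using L.normal_ne
  have hvn : v = (⟪L.normal, v⟫ / ‖L.normal‖ ^ 2) • L.normal := by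
    rw [div_eq_inv_mul, mul_smul, ← hparallel, inv_smul_smul₀ hN]
  refine ⟨_, fun hα => ?_, hvn, fun q => ?_⟩
  · rw [hα, zero_smul] at hvn
    simp [hvn] at hv
  · rw [← hfoot, ← inner_sub_right, ← sub_zero (L.residual q), ← L.residual_foot, residual,
      residual, sub_sub_sub_cancel_right, ← inner_sub_right, ← real_inner_smul_left, ← hvn]

theorem abs_inner_eq_one_iff_det_normal_eq_zero {L M : Line} {b c : ℝ} (hv : ‖v‖ = 1)
    (hw : ‖w‖ = 1) (hL : L.carrier = hyperplane v b) (hM : M.carrier = hyperplane w c) :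
    |⟪v, w⟫| = 1 ↔ det L.normal M.normal = 0 := by
  obtain ⟨α, hα, hvn, -⟩ := L.exists_inner_sub_eq hv hL
  obtain ⟨β, hβ, hwn, -⟩ := M.exists_inner_sub_eq hw hM
  rw [abs_inner_eq_one_iff_det_eq_zero hv hw, hvn, hwn]
  simp [det_eq_coords, mul_mul_mul_comm α, ← mul_sub, hα, hβ]

end LineRep

section ConfigFamily

/-- The properties of the output of Z-Configs, turned by the matrix `Uᵀ` of Align, on which the
correctness of Align rests: if `P x`, `Q x`, `Z x` are the positions of `p, q, y`, then `p` is on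
the line through the origin with normal `v`, `q` on that with normal `w`, and the shape of
the triple is kept while its rotation takes all values. -/
structure IsConfigFamily (v w p q y : Point) (P Q Z : Point → Point) : Prop where
  inner_fst : ∀ x, ⟪v, P x⟫ = 0
  inner_snd : ∀ x, ⟪w, Q x⟫ = 0
  exists_rotate : ∃ u, ‖u‖ = 1 ∧ ∀ x,
    Q x - P x = rotate (rotate u x) (q - p) ∧ Z x - P x = rotate (rotate u x) (y - p)

variable {v w p q y : Point} {P Q Z : Point → Point}

theorem isConfigFamily_zConfigs (hv : ‖v‖ = 1) (hvw : det v w ≠ 0) (p q y : Point) :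
    let U := toXAxis (perp v)
    let M := zConfigs (Matrix.toEuclideanLin U (perp w)) p q y
    IsConfigFamily v w p q y (Matrix.toEuclideanLin (U.transpose * M.1))
      (Matrix.toEuclideanLin (U.transpose * M.2.1))
      (Matrix.toEuclideanLin (U.transpose * M.2.2)) := by
  intro U M
  have hvsq := norm_eq_one_iff_coords.1 hv
  refine ⟨fun x => ?_, fun x => ?_, ?_⟩
  · rw [toEuclideanLin_transpose_toXAxis_mul, inner_eq_coords, rotate_apply_zero, rotate_apply_one,
      zConfigs_fst_apply_one, perp_apply_zero, perp_apply_one]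
    ring
  · have hU : Matrix.toEuclideanLin U (perp w) 1 = det v w := by
      simp only [U, toXAxis, toEuclideanLin_apply_one, det_eq_coords, perp_apply_zero,
        perp_apply_one, Matrix.of_apply, Matrix.cons_val', Matrix.cons_val_zero,
        Matrix.cons_val_one, Matrix.cons_val_fin_one]
      ring
    have hUw : rotate (perp v) (Matrix.toEuclideanLin U (perp w)) = perp w := by
      apply Point.ext <;>
        simp only [U, toXAxis, rotate_apply_zero, rotate_apply_one, toEuclideanLin_apply_zero,
          toEuclideanLin_apply_one, perp_apply_zero, perp_apply_one, Matrix.of_apply,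
          Matrix.cons_val', Matrix.cons_val_zero, Matrix.cons_val_one, Matrix.cons_val_fin_one]
      · linear_combination (-w 1) * hvsq
      · linear_combination w 0 * hvsq
    rw [toEuclideanLin_transpose_toXAxis_mul, zConfigs_snd_apply (hU ▸ hvw), rotate_smul, hUw,
      real_inner_smul_right, inner_perp_self, mul_zero]
  · obtain ⟨u, hu, hux⟩ := exists_zConfigs_sub_eq_rotate (Matrix.toEuclideanLin U (perp w)) p q y
    refine ⟨rotate (perp v) u, by rw [norm_rotate, norm_perp, hv, hu, one_mul], fun x => ?_⟩
    simp only [U, M, toEuclideanLin_transpose_toXAxis_mul, ← rotate_sub, ← rotate_rotate _ u x,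
      ← rotate_rotate (perp v)]
    exact ⟨congrArg _ (hux x).1, congrArg _ (hux x).2⟩

theorem IsConfigFamily.inner_fst_add (h : IsConfigFamily v w p q y P Q Z) (x s : Point) :
    ⟪v, P x + s⟫ = ⟪v, s⟫ := by
  rw [inner_add_right, h.inner_fst, zero_add]

theorem IsConfigFamily.inner_snd_add (h : IsConfigFamily v w p q y P Q Z) (x s : Point) :
    ⟪w, Q x + s⟫ = ⟪w, s⟫ := by
  rw [inner_add_right, h.inner_snd, zero_add]

theorem IsConfigFamily.exists_config_of_motion (h : IsConfigFamily v w p q y P Q Z)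
    (hvw : det v w ≠ 0) {g : RigidMotion} {s : Point} (hp : ⟪v, g.move p⟫ = ⟪v, s⟫)
    (hq : ⟪w, g.move q⟫ = ⟪w, s⟫) :
    ∃ x, ‖x‖ = 1 ∧ g.move p = P x + s ∧ g.move q = Q x + s ∧ g.move y = Z x + s := by
  obtain ⟨u, hu, hux⟩ := h.exists_rotate
  obtain ⟨x, hx, hxu⟩ := exists_rotate_eq (hu.trans g.norm_dir.symm)
  obtain ⟨hQ, hZ⟩ := hux x
  rw [rotate_comm u, hxu, ← g.move_sub_move] at hQ hZ
  have hsame : g.move p - s - P x = g.move q - s - Q x := by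
    rw [sub_eq_sub_iff_sub_eq_sub, ← neg_inj, neg_sub, neg_sub, hQ, sub_sub_sub_cancel_right]
  have hzero : g.move p - s - P x = 0 := by
    apply eq_of_inner_eq hvw
    · rw [inner_sub_right, inner_sub_right, hp, h.inner_fst, sub_self, sub_zero, inner_zero_right]
    · rw [hsame, inner_sub_right, inner_sub_right, hq, h.inner_snd, sub_self, sub_zero,
        inner_zero_right]
  rw [sub_sub, sub_eq_zero, add_comm] at hzero
  refine ⟨x, hx, hzero, ?_, ?_⟩
  · rw [← sub_add_cancel (g.move q) (g.move p), ← hQ, hzero]; abel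
  · rw [← sub_add_cancel (g.move y) (g.move p), ← hZ, hzero]; abel

theorem IsConfigFamily.exists_motion_of_config (h : IsConfigFamily v w p q y P Q Z) (s : Point)
    {x : Point} (hx : ‖x‖ = 1) :
    ∃ g : RigidMotion, g.move p = P x + s ∧ g.move q = Q x + s ∧ g.move y = Z x + s := by
  obtain ⟨u, hu, hux⟩ := h.exists_rotate
  obtain ⟨hQ, hZ⟩ := hux x
  refine ⟨.ofDir (rotate u x) (by rw [norm_rotate, hu, hx, one_mul])
    (rotate (rotate u x) p - P x - s), ?_, ?_, ?_⟩ <;> rw [RigidMotion.move_ofDir]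
  · abel
  · rw [sub_eq_iff_eq_add.1 hQ, rotate_sub]; abel
  · rw [sub_eq_iff_eq_add.1 hZ, rotate_sub]; abel

end ConfigFamily

section Subroutines

variable {m : ℕ} {A : Fin m → Point × Line} {v : Fin m → Point} {b : Fin m → ℝ}

theorem mem_feasible_iff_of_carrier_eq
    (hvb : ∀ i, ‖v i‖ = 1 ∧ (A i).2.carrier = hyperplane (v i) (b i)) {j k : Fin m}
    (hjk : det (A j).2.normal (A k).2.normal ≠ 0) {g : RigidMotion} :
    g ∈ feasible (A j) (A k) ↔
      ⟪v j, g.move (A j).1⟫ = b j ∧ ⟪v k, g.move (A k).1⟫ = b k := by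
  have hgap_zero : ∀ i, gap (A i) g = 0 ↔ ⟪v i, g.move (A i).1⟫ = b i := fun i => by
    rw [gap, ← Line.mem_carrier_iff, (hvb i).2]; rfl
  simp [feasible, hjk, hgap_zero]

theorem abs_gap_le_abs_gap_iff {a : Point × Line} {v : Point} {b : ℝ} (hv : ‖v‖ = 1)
    (hvb : a.2.carrier = hyperplane v b) {g g' : RigidMotion} {s y y' : Point}
    (hg : g.move a.1 = y + s) (hg' : g'.move a.1 = y' + s) :
    |gap a g| ≤ |gap a g'| ↔ |⟪v, y⟫ - (b - ⟪v, s⟫)| ≤ |⟪v, y'⟫ - (b - ⟪v, s⟫)| := by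
  obtain ⟨α, hα, -, hres⟩ := a.2.exists_inner_sub_eq hv hvb
  rw [sub_sub_eq_add_sub, sub_sub_eq_add_sub, ← inner_add_right, ← inner_add_right, ← hg, ← hg',
    hres, hres, abs_mul, abs_mul, mul_le_mul_iff_right₀ (abs_pos.2 hα)]
  rfl

theorem crossingAlignments_eq
    (hvb : ∀ i, ‖v i‖ = 1 ∧ (A i).2.carrier = hyperplane (v i) (b i)) {j k : Fin m}
    (hjk : det (A j).2.normal (A k).2.normal ≠ 0) (l : Fin m) :
    crossingAlignments A v b j k l = closest (A j) (A k) (A l) := by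
  have hvw : det (v j) (v k) ≠ 0 := by
    rwa [Ne, ← abs_inner_eq_one_iff_det_eq_zero (hvb j).1 (hvb k).1,
      abs_inner_eq_one_iff_det_normal_eq_zero (hvb j).1 (hvb k).1 (hvb j).2 (hvb k).2]
  have hfamily := isConfigFamily_zConfigs (hvb j).1 hvw (A j).1 (A k).1 (A l).1
  have mem_feasible_iff {g} : g ∈ feasible (A j) (A k) ↔ _ :=
    mem_feasible_iff_of_carrier_eq hvb hjk
  ext g
  constructor
  · rintro ⟨s, x, ⟨hsj, hsk⟩, ⟨-, hmin⟩, hj, hk, hl⟩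
    rw [(hvb _).2] at hsj hsk
    refine ⟨mem_feasible_iff.2 ⟨?_, ?_⟩, fun g' hg' => ?_⟩
    · exact hj ▸ (hfamily.inner_fst_add x s).trans hsj
    · exact hk ▸ (hfamily.inner_snd_add x s).trans hsk
    · obtain ⟨hj', hk'⟩ := mem_feasible_iff.1 hg'
      obtain ⟨x', hx', -, -, hl'⟩ :=
        hfamily.exists_config_of_motion hvw (hj'.trans hsj.symm) (hk'.trans hsk.symm)
      exact (abs_gap_le_abs_gap_iff (hvb l).1 (hvb l).2 hl hl').2 (hmin x' hx')
  · rintro ⟨hg, hmin⟩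
    obtain ⟨hj, hk⟩ := mem_feasible_iff.1 hg
    set s := cramerPoint (v j) (v k) (b j) (b k)
    have hsj : ⟪v j, s⟫ = b j := inner_left_cramerPoint hvw _ _
    have hsk : ⟪v k, s⟫ = b k := inner_right_cramerPoint hvw _ _
    obtain ⟨x, hx, hj', hk', hl'⟩ :=
      hfamily.exists_config_of_motion hvw (hj.trans hsj.symm) (hk.trans hsk.symm)
    refine ⟨s, x, ⟨(hvb j).2 ▸ hsj, (hvb k).2 ▸ hsk⟩, ⟨hx, fun x' hx' => ?_⟩, hj', hk', hl'⟩
    obtain ⟨g', hgj', hgk', hgl'⟩ := hfamily.exists_motion_of_config s hx'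
    refine (abs_gap_le_abs_gap_iff (hvb l).1 (hvb l).2 hl' hgl').1
      (hmin g' (mem_feasible_iff.2 ⟨?_, ?_⟩))
    · exact hgj' ▸ (hfamily.inner_fst_add x' s).trans hsj
    · exact hgk' ▸ (hfamily.inner_snd_add x' s).trans hsk

theorem parallelAlignments_eq {j k : Fin m} (hjk : det (A j).2.normal (A k).2.normal = 0) :
    parallelAlignments A j k = closest (A j) (A k) (A k) := by
  simp only [parallelAlignments, closest, feasible, hjk, ne_eq, not_true_eq_false, false_implies,
    and_true, Set.mem_ofPred_eq, gap, Line.mem_carrier_iff, Line.infDist_carrier_le_iff]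

end Subroutines

/-! ### Existence of an optimum -/

section BoundedShift

open Filter Topology

variable {E : Type*} [NormedAddCommGroup E] [InnerProductSpace ℝ E] {x : ℕ → E} {u : E}

theorem tendsto_inner_atTop_of_tendsto_direction (hnorm : Tendsto (‖x ·‖) atTop atTop)
    (hdir : Tendsto (fun N => ‖x N‖⁻¹ • x N) atTop (𝓝 u)) {a : E} (ha : 0 < ⟪a, u⟫) :
    Tendsto (fun N => ⟪a, x N⟫) atTop atTop := by
  refine (hnorm.atTop_mul_pos ha (tendsto_const_nhds.inner hdir)).congr' ?_
  filter_upwards [hnorm.eventually_gt_atTop 0] with N hN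
  rw [real_inner_smul_right, mul_inv_cancel_left₀ hN.ne']

theorem eventually_abs_sub_inner_sub_le (hnorm : Tendsto (‖x ·‖) atTop atTop)
    (hdir : Tendsto (fun N => ‖x N‖⁻¹ • x N) atTop (𝓝 u)) {c : ℕ → ℝ} {M : ℝ}
    (hc : ∀ N, |c N| ≤ M) (a : E) :
    ∀ᶠ N in atTop, |c N - ⟪a, x N - u⟫| ≤ |c N - ⟪a, x N⟫| := by
  rcases lt_trichotomy ⟪a, u⟫ 0 with ha | ha | ha
  · have ha' : 0 < ⟪-a, u⟫ := by rwa [inner_neg_left, neg_pos]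
    filter_upwards [(tendsto_inner_atTop_of_tendsto_direction hnorm hdir ha').eventually_gt_atTop
      (M - ⟪a, u⟫)] with N hN
    have := abs_le.1 (hc N)
    rw [inner_neg_left] at hN
    rw [inner_sub_right, abs_of_nonneg (by linarith), abs_of_nonneg (by linarith)]
    linarith
  · exact .of_forall fun N => by rw [inner_sub_right, ha, sub_zero]
  · filter_upwards [(tendsto_inner_atTop_of_tendsto_direction hnorm hdir ha).eventually_gt_atTop
      (M + ⟪a, u⟫)] with N hN
    have := abs_le.1 (hc N)
    rw [inner_sub_right, abs_of_nonpos (by linarith), abs_of_nonpos (by linarith)]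
    linarith

theorem exists_minimal_norm_abs_sub_inner_le [ProperSpace E] {ι : Type*} (a : ι → E) (c : ι → ℝ)
    (t : E) :
    ∃ t', (∀ i, |c i - ⟪a i, t'⟫| ≤ |c i - ⟪a i, t⟫|) ∧
      ∀ y, (∀ i, |c i - ⟪a i, y⟫| ≤ |c i - ⟪a i, t'⟫|) → ‖t'‖ ≤ ‖y‖ := by
  set S : Set E := {y | ∀ i, |c i - ⟪a i, y⟫| ≤ |c i - ⟪a i, t⟫|}
  have hS : IsClosed S := by
    simp only [S, Set.ofPred_forall]
    exact isClosed_iInter fun i => isClosed_le (by fun_prop) (by fun_prop)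
  obtain ⟨t', ht', hdist⟩ := hS.exists_infDist_eq_dist ⟨t, fun i => le_rfl⟩ 0
  refine ⟨t', ht', fun y hy => ?_⟩
  have hyS : y ∈ S := fun i => (hy i).trans (ht' i)
  simpa [hdist] using Metric.infDist_le_dist_of_mem (x := 0) hyS

/-- Otherwise there would be arbitrarily long `t` that cannot be shortened in this way; but if `u`
is a limit of their directions, subtracting `u` shortens them and eventually brings all the
`⟪a i, t⟫` with `⟪a i, u⟫ ≠ 0` closer to the bounded numbers `c i`. -/
theorem exists_norm_le_abs_sub_inner_le [ProperSpace E] {ι : Type*} [Finite ι] (a : ι → E)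
    (M : ℝ) :
    ∃ B : ℝ, ∀ c : ι → ℝ, (∀ i, |c i| ≤ M) → ∀ t : E, ∃ t' : E, ‖t'‖ ≤ B ∧
      ∀ i, |c i - ⟪a i, t'⟫| ≤ |c i - ⟪a i, t⟫| := by
  by_contra! hcon
  choose c hc t ht using fun N : ℕ => hcon N
  choose x hxt hx using fun N => exists_minimal_norm_abs_sub_inner_le a (c N) (t N)
  have hlarge : ∀ N : ℕ, (N : ℝ) < ‖x N‖ := fun N => by
    by_contra! hle
    obtain ⟨i, hi⟩ := ht N (x N) hle
    exact (hxt N i).not_gt hi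
  obtain ⟨u, hu, φ, hφ, hdir⟩ := (isCompact_sphere (0 : E) 1).tendsto_subseq
    (x := fun N => ‖x N‖⁻¹ • x N) fun N => by
      rw [mem_sphere_zero_iff_norm, norm_smul, norm_inv, norm_norm,
        inv_mul_cancel₀ ((Nat.cast_nonneg N).trans_lt (hlarge N)).ne']
  rw [mem_sphere_zero_iff_norm] at hu
  have hnorm : Tendsto (fun N => ‖x (φ N)‖) atTop atTop :=
    tendsto_atTop_mono (fun N => (hlarge (φ N)).le)
      (tendsto_natCast_atTop_atTop.comp hφ.tendsto_atTop)
  have hcloser : ∀ᶠ N in atTop, ∀ i,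
      |c (φ N) i - ⟪a i, x (φ N) - u⟫| ≤ |c (φ N) i - ⟪a i, x (φ N)⟫| :=
    eventually_all.2 fun i =>
      eventually_abs_sub_inner_sub_le hnorm hdir (fun N => hc (φ N) i) (a i)
  have hforward := (tendsto_inner_atTop_of_tendsto_direction hnorm hdir (a := u)
    (by simp [hu])).eventually_gt_atTop 1
  obtain ⟨N, hN, hNu⟩ := (hcloser.and hforward).exists
  have hle := pow_le_pow_left₀ (norm_nonneg _) (hx (φ N) _ hN) 2
  rw [norm_sub_sq_real, real_inner_comm, hu] at hle
  linarith

end BoundedShift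

section Optimum

theorem IsLogLipschitz.lowerSemicontinuous {r : ℝ} {h : ℝ≥0 → ℝ≥0} (hh : IsLogLipschitz r h) :
    LowerSemicontinuous h := by
  obtain ⟨hr, hmono, hlip⟩ := hh
  intro x y hy
  rcases eq_or_ne x 0 with rfl | hx
  · exact .of_forall fun x' => hy.trans_le (hmono zero_le)
  have hcont : Continuous fun x' : ℝ≥0 => (x' / x) ^ r * h x :=
    ((NNReal.continuous_rpow_const hr.le).comp (continuous_id.div_const x)).mul continuous_const
  have hlt : y < (x / x) ^ r * h x := by rwa [div_self hx, NNReal.one_rpow, one_mul]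
  filter_upwards [hcont.continuousAt.eventually_const_lt hlt, isOpen_ne.mem_nhds hx]
    with x' hx' hx'0
  rcases le_total x x' with hle | hle
  · exact hy.trans_le (hmono hle)
  refine hx'.trans_le ?_
  calc (x' / x) ^ r * h x = (x' / x) ^ r * h (x / x' * x') := by rw [div_mul_cancel₀ _ hx'0]
    _ ≤ (x' / x) ^ r * ((x / x') ^ r * h x') := by
      gcongr
      exact hlip _ _ ((one_le_div₀ (pos_iff_ne_zero.2 hx'0)).2 hle)
    _ = h x' := by
      rw [← mul_assoc, ← NNReal.mul_rpow, div_mul_div_cancel₀ hx, div_self hx'0, NNReal.one_rpow,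
        one_mul]

theorem cost_eq_sum {n : ℕ} (z : ℝ) (lip : ℝ≥0 → ℝ≥0) (A : Fin n → Point × Line)
    (g : RigidMotion) : cost z lip A g = ∑ i, lip (Dz z (A i) g) := rfl

theorem Dz_le_mul_Dz {z : ℝ} (hz : z ≠ 0) {a : Point × Line} {g g' : RigidMotion} {C : ℝ≥0}
    (h : |gap a g| ≤ C * |gap a g'|) : Dz z a g ≤ C * Dz z a g' := by
  obtain ⟨κ, hκ⟩ := exists_Dz_eq hz a.2
  have hgap : ‖gap a g‖₊ ≤ C * ‖gap a g'‖₊ := h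
  rw [hκ a.1, hκ a.1, mul_left_comm]
  exact mul_le_mul_right hgap κ

theorem exists_norm_snd_le_abs_gap_le {n : ℕ} (A : Fin n → Point × Line) :
    ∃ B : ℝ, ∀ g : RigidMotion, ∃ t, ‖t‖ ≤ B ∧
      ∀ i, |gap (A i) (.ofDir g.dir g.norm_dir t)| ≤ |gap (A i) g| := by
  let bound i := ‖(A i).2.normal‖ * ‖(A i).1‖ + |(A i).2.offset|
  obtain ⟨B, hB⟩ := exists_norm_le_abs_sub_inner_le (fun i => (A i).2.normal) (∑ i, bound i)
  have hresidual : ∀ (g : RigidMotion) i,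
      |(A i).2.residual (rotate g.dir (A i).1)| ≤ ∑ i, bound i := fun g i => by
    refine le_trans ?_ (Finset.single_le_sum (f := bound) (fun i _ => by positivity)
      (Finset.mem_univ i))
    refine (abs_sub _ _).trans (add_le_add_left ((abs_real_inner_le_norm _ _).trans_eq ?_) _)
    rw [norm_rotate, g.norm_dir, one_mul]
  refine ⟨B, fun g => ?_⟩
  obtain ⟨t, ht, hle⟩ := hB _ (hresidual g) g.2
  exact ⟨t, ht, fun i => by rw [gap_ofDir, gap_eq]; exact hle i⟩

variable {n : ℕ} {z r : ℝ} {lip : ℝ≥0 → ℝ≥0}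

theorem exists_forall_cost_le (A : Fin n → Point × Line) (hz : z ≠ 0)
    (hlip : IsLogLipschitz r lip) : ∃ g, ∀ g', cost z lip A g ≤ cost z lip A g' := by
  choose κ hκ using fun i => exists_Dz_eq hz (A i).2
  obtain ⟨B, hB⟩ := exists_norm_snd_le_abs_gap_le A
  let f (x : Point × Point) : ℝ≥0 :=
    ∑ i, lip (κ i * ‖(A i).2.residual (rotate x.1 (A i).1 - x.2)‖₊)
  have cost_ofDir {u : Point} (hu : ‖u‖ = 1) (t : Point) :
      cost z lip A (.ofDir u hu t) = f (u, t) := by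
    simp only [cost_eq_sum, hκ _ (A _).1, RigidMotion.move_ofDir, f]
  have hlsc : LowerSemicontinuous f := by
    refine lowerSemicontinuous_sum fun i _ => hlip.lowerSemicontinuous.comp ?_
    simp only [Line.residual, rotate]
    fun_prop
  have hcompact : IsCompact (Metric.sphere (0 : Point) 1 ×ˢ Metric.closedBall (0 : Point) B) :=
    (isCompact_sphere 0 1).prod (isCompact_closedBall 0 B)
  have hnonempty : (Metric.sphere (0 : Point) 1 ×ˢ Metric.closedBall (0 : Point) B).Nonempty := by
    obtain ⟨t, ht, -⟩ := hB (1, 0)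
    exact ⟨(RigidMotion.dir (1, 0), t), mem_sphere_zero_iff_norm.2 (RigidMotion.norm_dir _),
      mem_closedBall_zero_iff.2 ht⟩
  obtain ⟨⟨u, t⟩, ⟨hu, -⟩, hmin⟩ :=
    (hlsc.lowerSemicontinuousOn _).exists_isMinOn hnonempty hcompact
  refine ⟨.ofDir u (mem_sphere_zero_iff_norm.1 hu) t, fun g => ?_⟩
  obtain ⟨t', ht', hle⟩ := hB g
  calc _ = f (u, t) := cost_ofDir _ t
    _ ≤ f (g.dir, t') :=
      hmin ⟨mem_sphere_zero_iff_norm.2 g.norm_dir, mem_closedBall_zero_iff.2 ht'⟩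
    _ = cost z lip A (.ofDir g.dir g.norm_dir t') := (cost_ofDir _ t').symm
    _ ≤ cost z lip A g := by
      rw [cost_eq_sum, cost_eq_sum]
      refine Finset.sum_le_sum fun i _ => hlip.2.1 ?_
      simpa using Dz_le_mul_Dz hz (C := 1) (by simpa using hle i)

theorem exists_optimal (A : Fin n → Point × Line) (hz : z ≠ 0) (hlip : IsLogLipschitz r lip) :
    ∃ (g : RigidMotion) (π : Equiv.Perm (Fin n)), ∀ g' π',
      cost z lip (rematch A π) g ≤ cost z lip (rematch A π') g' := by
  choose g hg using fun π => exists_forall_cost_le (rematch A π) hz hlip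
  obtain ⟨π, hπ⟩ := Finite.exists_min fun π => cost z lip (rematch A π) (g π)
  exact ⟨g π, π, fun g' π' => (hπ π').trans (hg π' g')⟩

end Optimum

/-! ### The approximation factor -/

section Selection

variable {F C : Set RigidMotion}

theorem IsSelection.nonempty (h : IsSelection F C) (hF : F.Nonempty) : C.Nonempty := by
  obtain ⟨-, ⟨-, h⟩ | ⟨-, g, rfl⟩⟩ := h
  · obtain ⟨g, hg⟩ := hF
    obtain ⟨g', hg', -⟩ := h _ ⟨g, hg, rfl⟩
    exact ⟨g', hg'.1⟩
  · exact Set.singleton_nonempty g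

theorem IsSelection.exists_fst_eq (h : IsSelection F C) (hfin : (Prod.fst '' F).Finite)
    {g : RigidMotion} (hg : g ∈ F) : ∃ g' ∈ C, g'.1 = g.1 := by
  obtain ⟨-, ⟨-, h⟩ | ⟨hinf, -⟩⟩ := h
  · exact (h _ ⟨g, hg, rfl⟩).exists
  · exact absurd hfin hinf

end Selection

section Approximation

variable {ι : Type*} {a b c : Point × Line} {g g₀ : RigidMotion}

theorem gap_snd_add (a : Point × Line) (g : RigidMotion) (t : Point) :
    gap a (g.1, g.2 + t) = gap a g - ⟪a.2.normal, t⟫ := by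
  rw [gap_eq, gap_eq, inner_add_right, ← sub_sub]
  rfl

theorem exists_gap_eq_zero_abs_gap_le_two_mul [Finite ι] [Nonempty ι] (A : ι → Point × Line)
    (g₀ : RigidMotion) :
    ∃ j g, gap (A j) g = 0 ∧ ∀ i, |gap (A i) g| ≤ 2 * |gap (A i) g₀| := by
  obtain ⟨j, hj⟩ := Finite.exists_min fun i => |gap (A i) g₀| / ‖(A i).2.normal‖
  obtain ⟨q, hq, hdist⟩ := (A j).2.exists_residual_eq_zero_dist_eq (g₀.move (A j).1)
  set t := g₀.move (A j).1 - q
  refine ⟨j, (g₀.1, g₀.2 + t), ?_, fun i => ?_⟩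
  · rw [gap_snd_add, gap, ← Line.residual_sub, sub_sub_cancel, hq]
  · have hshift : |⟪(A i).2.normal, t⟫| ≤ |gap (A i) g₀| :=
      calc |⟪(A i).2.normal, t⟫| ≤ ‖(A i).2.normal‖ * ‖t‖ := abs_real_inner_le_norm _ _
        _ = ‖(A i).2.normal‖ * (|gap (A j) g₀| / ‖(A j).2.normal‖) := by
          rw [← dist_eq_norm, hdist, gap]
        _ ≤ ‖(A i).2.normal‖ * (|gap (A i) g₀| / ‖(A i).2.normal‖) :=
          mul_le_mul_of_nonneg_left (hj i) (norm_nonneg _)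
        _ = |gap (A i) g₀| := mul_div_cancel₀ _ (norm_ne_zero_iff.2 (A i).2.normal_ne)
    rw [gap_snd_add]
    exact (abs_sub _ _).trans (by linarith)

/-- Slide along the line of `a` until the first of the other points reaches its line. -/
theorem exists_gap_eq_zero_abs_gap_le_two_mul_of_gap_eq_zero [Finite ι] {A : ι → Point × Line}
    (ha : gap a g₀ = 0) (hA : ∃ i, det a.2.normal (A i).2.normal ≠ 0) :
    ∃ k g, det a.2.normal (A k).2.normal ≠ 0 ∧ gap a g = 0 ∧ gap (A k) g = 0 ∧
      ∀ i, |gap (A i) g| ≤ 2 * |gap (A i) g₀| := by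
  obtain ⟨k, hk, hmin⟩ := Set.exists_min_image {i | det a.2.normal (A i).2.normal ≠ 0}
    (fun i => |gap (A i) g₀| / |det a.2.normal (A i).2.normal|) (Set.toFinite _) hA
  set τ := gap (A k) g₀ / det a.2.normal (A k).2.normal
  have gap_slide (c : Point × Line) :
      gap c (g₀.1, g₀.2 + τ • perp a.2.normal) = gap c g₀ - τ * det a.2.normal c.2.normal := by
    rw [gap_snd_add, real_inner_smul_right, real_inner_comm, det]
  refine ⟨k, (g₀.1, g₀.2 + τ • perp a.2.normal), hk, ?_, ?_, fun i => ?_⟩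
  · rw [gap_slide, ha, det, real_inner_comm, inner_perp_self, mul_zero, sub_zero]
  · rw [gap_slide, div_mul_cancel₀ _ hk, sub_self]
  · have hshift : |τ * det a.2.normal (A i).2.normal| ≤ |gap (A i) g₀| := by
      rcases eq_or_ne (det a.2.normal (A i).2.normal) 0 with hi | hi
      · rw [hi, mul_zero, abs_zero]
        exact abs_nonneg _
      · have hle := hmin i hi
        rwa [← abs_div, le_div_iff₀ (abs_pos.2 hi), ← abs_mul] at hle
    rw [gap_slide]
    exact (abs_sub _ _).trans (by linarith)

theorem gap_eq_gap_of_gapSlope_eq_zero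
    (hc : det a.2.normal b.2.normal = 0 → det a.2.normal c.2.normal = 0)
    (hslope : gapSlope a b c = 0) (hg : g ∈ feasible a b) (hg₀ : g₀ ∈ feasible a b) :
    gap c g = gap c g₀ := by
  rw [gap_eq_feasibleGap hc hg, gap_eq_feasibleGap hc hg₀, feasibleGap_eq, feasibleGap_eq, hslope,
    inner_zero_left, inner_zero_left]

/-- The optimal pair is the one whose exact minimizers contain the rotation closest to that of
`g₀` among the exact minimizers for all pairs. -/
theorem exists_forall_isSelection_abs_gap_le_four_mul [Finite ι] [Nonempty ι]
    {A : ι → Point × Line}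
    (hA : ∀ i, det a.2.normal b.2.normal = 0 → det a.2.normal (A i).2.normal = 0)
    (hg₀ : g₀ ∈ feasible a b) :
    ∃ l, ∀ C, IsSelection (closest a b (A l)) C →
      ∃ g ∈ C, ∀ i, |gap (A i) g| ≤ 4 * |gap (A i) g₀| := by
  have le_four_of_slope_eq_zero {i g} (hi : gapSlope a b (A i) = 0) (hg : g ∈ feasible a b) :
      |gap (A i) g| ≤ 4 * |gap (A i) g₀| := by
    rw [gap_eq_gap_of_gapSlope_eq_zero (hA i) hi hg hg₀]
    linarith [abs_nonneg (gap (A i) g₀)]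
  by_cases hall : ∀ i, gapSlope a b (A i) = 0
  · inhabit ι
    refine ⟨default, fun C hC => ?_⟩
    obtain ⟨g, hg⟩ := hC.nonempty ⟨_, candidate_mem_closest (hA default) 1⟩
    exact ⟨g, hg, fun i => le_four_of_slope_eq_zero (hall i) (hC.1 hg).1⟩
  push Not at hall
  obtain ⟨i₀, hi₀⟩ := hall
  obtain ⟨⟨l, s⟩, hl, hmin⟩ := Set.exists_min_image {x : ι × ℤˣ | gapSlope a b (A x.1) ≠ 0}
    (fun x => ‖g₀.dir - circlePt x.2 (gapSlope a b (A x.1)) (gapLevel a b (A x.1))‖)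
    (Set.toFinite _) ⟨(i₀, 1), hi₀⟩
  refine ⟨l, fun C hC => ?_⟩
  obtain ⟨g, hg, hgdir⟩ := hC.exists_fst_eq (finite_rotations_closest (hA l) hl)
    (candidate_mem_closest (hA l) s)
  rw [RigidMotion.fst_eq_fst_iff, candidate, RigidMotion.dir_ofDir] at hgdir
  have hgF := (hC.1 hg).1
  refine ⟨g, hg, fun i => ?_⟩
  by_cases hi : gapSlope a b (A i) = 0
  · exact le_four_of_slope_eq_zero hi hgF
  rw [gap_eq_feasibleGap (hA i) hgF, gap_eq_feasibleGap (hA i) hg₀, feasibleGap_eq,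
    feasibleGap_eq]
  refine abs_inner_sub_le_four_mul hi g₀.norm_dir g.norm_dir fun y hy => ?_
  obtain ⟨s', rfl⟩ := (isSphereArgmin_iff_exists_circlePt hi).1 hy
  exact hgdir ▸ hmin (i, s') hi

theorem closest_eq_of_det_eq_zero {b' : Point × Line} (h : det a.2.normal b.2.normal = 0)
    (h' : det a.2.normal b'.2.normal = 0) : closest a b c = closest a b' c := by
  simp [closest, feasible, h, h']

theorem IsAlignOutput.exists_isSelection {A : Fin 3 → Point × Line} {X : Set RigidMotion}
    (hX : IsAlignOutput A X) :
    ∃ C ⊆ X, (det (A 0).2.normal (A 1).2.normal ≠ 0 →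
        IsSelection (closest (A 0) (A 1) (A 2)) C) ∧
      (det (A 0).2.normal (A 1).2.normal = 0 → IsSelection (closest (A 0) (A 1) (A 1)) C) := by
  obtain ⟨v, b, hvb, C, hC, rfl⟩ := hX
  have hparallel := abs_inner_eq_one_iff_det_normal_eq_zero (hvb 0).1 (hvb 1).1 (hvb 0).2.2
    (hvb 1).2.2
  refine ⟨C 0 1 2, fun g hg => ⟨0, 1, 2, by decide, hg⟩, fun hdet => ?_, fun hdet => ?_⟩
  · rw [← crossingAlignments_eq (fun i => ⟨(hvb i).1, (hvb i).2.2⟩) hdet]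
    exact (hC 0 1 2 (by decide)).1 (mt hparallel.1 hdet)
  · rw [← parallelAlignments_eq hdet]
    exact (hC 0 1 2 (by decide)).2 (hparallel.2 hdet)

theorem exists_forall_isAlignOutput_abs_gap_le {n : ℕ} [NeZero n] (A : Fin n → Point × Line)
    (g₀ : RigidMotion) :
    ∃ e : Fin 3 → Fin n, ∀ X, IsAlignOutput (fun i => A (e i)) X →
      ∃ g ∈ X, ∀ i, |gap (A i) g| ≤ 16 * |gap (A i) g₀| := by
  obtain ⟨j, g₁, hj, h₁⟩ := exists_gap_eq_zero_abs_gap_le_two_mul A g₀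
  by_cases hpar : ∀ i, det (A j).2.normal (A i).2.normal = 0
  · have hfeas : g₁ ∈ feasible (A j) (A j) := ⟨hj, fun _ => hj⟩
    obtain ⟨l, hl⟩ := exists_forall_isSelection_abs_gap_le_four_mul (fun i _ => hpar i) hfeas
    refine ⟨![j, l, l], fun X hX => ?_⟩
    obtain ⟨C, hCX, -, hC⟩ := hX.exists_isSelection
    obtain ⟨g, hg, h⟩ := hl C (closest_eq_of_det_eq_zero (hpar j) (hpar l) ▸ hC (hpar l))
    exact ⟨g, hCX hg, fun i => by linarith [h i, h₁ i, abs_nonneg (gap (A i) g₀)]⟩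
  · push Not at hpar
    obtain ⟨k, g₂, hk, hj₂, hk₂, h₂⟩ :=
      exists_gap_eq_zero_abs_gap_le_two_mul_of_gap_eq_zero hj hpar
    obtain ⟨l, hl⟩ := exists_forall_isSelection_abs_gap_le_four_mul (A := A)
      (fun i h => absurd h hk) (show g₂ ∈ feasible (A j) (A k) from ⟨hj₂, fun _ => hk₂⟩)
    refine ⟨![j, k, l], fun X hX => ?_⟩
    obtain ⟨C, hCX, hC, -⟩ := hX.exists_isSelection
    obtain ⟨g, hg, h⟩ := hl C (hC hk)
    exact ⟨g, hCX hg, fun i => by linarith [h i, h₁ i, h₂ i]⟩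

variable {n : ℕ} {z r : ℝ} {lip : ℝ≥0 → ℝ≥0} {A : Fin n → Point × Line}

theorem cost_le_rpow_mul_cost (hz : z ≠ 0) (hlip : IsLogLipschitz r lip) {C : ℝ≥0} (hC : 1 ≤ C)
    (h : ∀ i, |gap (A i) g| ≤ C * |gap (A i) g₀|) :
    cost z lip A g ≤ C ^ r * cost z lip A g₀ := by
  rw [cost_eq_sum, cost_eq_sum, Finset.mul_sum]
  refine Finset.sum_le_sum fun i _ => ?_
  exact (hlip.2.1 (Dz_le_mul_Dz hz (h i))).trans (hlip.2.2 C _ hC)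

theorem IsAlignMatchOutput.cost_le [NeZero n] {out : RigidMotion × Equiv.Perm (Fin n)}
    (hout : IsAlignMatchOutput z lip A out) (hz : z ≠ 0) (hlip : IsLogLipschitz r lip)
    (g₀ : RigidMotion) (π₀ : Equiv.Perm (Fin n)) :
    cost z lip (rematch A out.2) out.1 ≤ 16 ^ r * cost z lip (rematch A π₀) g₀ := by
  obtain ⟨X, πhat, hX, hπ, S, rfl, -, hbest⟩ := hout
  obtain ⟨e, he⟩ := exists_forall_isAlignOutput_abs_gap_le (rematch A π₀) g₀
  obtain ⟨g, hg, h⟩ := he _ (hX e fun i => π₀ (e i))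
  calc cost z lip (rematch A out.2) out.1 ≤ cost z lip (rematch A (πhat g)) g :=
        hbest (g, πhat g) ⟨⟨_, _, hg⟩, rfl⟩
    _ ≤ cost z lip (rematch A π₀) g := hπ g ⟨_, _, hg⟩ π₀
    _ ≤ 16 ^ r * cost z lip (rematch A π₀) g₀ :=
      cost_le_rpow_mul_cost hz hlip (by norm_num) h

end Approximation

end PointsToLines

namespace RealRAM

/-! ### Running times and weakest preconditions -/

section WeakestPrecondition

/-- The names of the arrays of natural numbers that a program writes to. -/
def Prog.natWrites : Prog → List ℕ
  | skip => []
  | setNat a _ _ => [a]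
  | setReal _ _ _ _ => []
  | seq P Q => P.natWrites ++ Q.natWrites
  | ite _ P Q => P.natWrites ++ Q.natWrites
  | loop _ P => P.natWrites

/-- The names of the arrays of real numbers that a program writes to. -/
def Prog.realWrites : Prog → List ℕ
  | skip => []
  | setNat _ _ _ => []
  | setReal a _ _ _ => [a]
  | seq P Q => P.realWrites ++ Q.realWrites
  | ite _ P Q => P.realWrites ++ Q.realWrites
  | loop _ P => P.realWrites

/-- A bound for the running time of a program all of whose loops make at most `B` iterations. -/
def Prog.timeBound (B : ℕ) : Prog → ℕ
  | skip => 1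
  | setNat _ i e => i.time + e.time + 1
  | setReal _ i j e => i.time + j.time + e.time + 1
  | seq P Q => P.timeBound B + Q.timeBound B
  | ite t P Q => t.time + (P.timeBound B + Q.timeBound B)
  | loop t P => t.time + B * (t.time + P.timeBound B)

open Polynomial in
theorem Prog.exists_timeBound_eq_eval (P : Prog) :
    ∃ p : ℕ[X], ∀ B, P.timeBound B = p.eval B := by
  induction P with
  | skip => exact ⟨1, fun B => by simp [timeBound]⟩
  | setNat _ i e => exact ⟨C (i.time + e.time + 1), fun B => by simp [timeBound]⟩
  | setReal _ i j e => exact ⟨C (i.time + j.time + e.time + 1), fun B => by simp [timeBound]⟩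
  | seq _ _ hP hQ =>
    obtain ⟨⟨p, hp⟩, q, hq⟩ := And.intro hP hQ
    exact ⟨p + q, fun B => by simp [timeBound, hp, hq]⟩
  | ite t _ _ hP hQ =>
    obtain ⟨⟨p, hp⟩, q, hq⟩ := And.intro hP hQ
    exact ⟨C t.time + (p + q), fun B => by simp [timeBound, hp, hq]⟩
  | loop t _ hP =>
    obtain ⟨p, hp⟩ := hP
    exact ⟨C t.time + X * (C t.time + p), fun B => by simp [timeBound, hp]⟩

theorem Prog.exists_timeBound_le (P : Prog) :
    ∃ K d : ℕ, ∀ B, 1 ≤ B → P.timeBound B ≤ K * B ^ d := by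
  obtain ⟨p, hp⟩ := P.exists_timeBound_eq_eval
  refine ⟨p.eval 1, p.natDegree, fun B hB => ?_⟩
  rw [hp, Polynomial.eval_eq_sum_range, Polynomial.eval_eq_sum_range, Finset.sum_mul]
  refine Finset.sum_le_sum fun i hi => ?_
  rw [one_pow, mul_one]
  exact Nat.mul_le_mul_left _ (Nat.pow_le_pow_right hB (Finset.mem_range_succ_iff.mp hi))

@[simp] theorem Mem.writeNat_real (σ : Mem) (a i x : ℕ) : (σ.writeNat a i x).real = σ.real := rfl

@[simp] theorem Mem.writeReal_nat (σ : Mem) (a i j : ℕ) (x : ℝ) :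
    (σ.writeReal a i j x).nat = σ.nat := rfl

theorem Mem.writeNat_nat (σ : Mem) (a i x b : ℕ) : (σ.writeNat a i x).nat b =
    if b = a then Function.update (σ.nat a) i x else σ.nat b := by
  simp [writeNat, Function.update_apply]

theorem Mem.writeNat_ne (σ : Mem) {a b : ℕ} (i x : ℕ) (h : b ≠ a) :
    (σ.writeNat a i x).nat b = σ.nat b := by
  simp [writeNat_nat, h]

@[simp] theorem Mem.writeNat_same (σ : Mem) (a i x : ℕ) :
    (σ.writeNat a i x).nat a = Function.update (σ.nat a) i x := by
  simp [writeNat_nat]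

theorem Mem.writeReal_ne (σ : Mem) {a b : ℕ} (i j : ℕ) (x : ℝ) (h : b ≠ a) :
    (σ.writeReal a i j x).real b = σ.real b := by
  simp [writeReal, h]

theorem Mem.writeReal_same (σ : Mem) (a i j : ℕ) (x : ℝ) (i' j' : ℕ) :
    (σ.writeReal a i j x).real a i' j' = if i' = i ∧ j' = j then x else σ.real a i' j' := by
  simp only [writeReal, Function.update_self, Function.update_apply]
  split_ifs <;> simp_all

/-- The memories agree on the arrays that the program does not write to. -/
structure Frame (P : Prog) (σ τ : Mem) : Prop where
  nat : ∀ a, a ∉ P.natWrites → τ.nat a = σ.nat a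
  real : ∀ a, a ∉ P.realWrites → τ.real a = σ.real a

theorem Frame.refl (P : Prog) (σ : Mem) : Frame P σ σ :=
  ⟨fun _ _ => rfl, fun _ _ => rfl⟩

theorem Frame.trans {P : Prog} {σ₁ σ₂ σ₃ : Mem} (h₁₂ : Frame P σ₁ σ₂) (h₂₃ : Frame P σ₂ σ₃) :
    Frame P σ₁ σ₃ :=
  ⟨fun a ha => (h₂₃.nat a ha).trans (h₁₂.nat a ha),
    fun a ha => (h₂₃.real a ha).trans (h₁₂.real a ha)⟩

theorem Frame.mono {P P' : Prog} {σ τ : Mem} (h : Frame P σ τ)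
    (hnat : P.natWrites ⊆ P'.natWrites) (hreal : P.realWrites ⊆ P'.realWrites) : Frame P' σ τ :=
  ⟨fun a ha => h.nat a fun ha' => ha (hnat ha'), fun a ha => h.real a fun ha' => ha (hreal ha')⟩

theorem frame_writeNat {P : Prog} {a : ℕ} (ha : a ∈ P.natWrites) (σ : Mem) (i x : ℕ) :
    Frame P σ (σ.writeNat a i x) :=
  ⟨fun _ hb => Mem.writeNat_ne _ _ _ fun h => hb (h ▸ ha), fun _ _ => rfl⟩

theorem frame_writeReal {P : Prog} {a : ℕ} (ha : a ∈ P.realWrites) (σ : Mem) (i j : ℕ) (x : ℝ) :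
    Frame P σ (σ.writeReal a i j x) :=
  ⟨fun _ _ => rfl, fun _ hb => Mem.writeReal_ne _ _ _ _ fun h => hb (h ▸ ha)⟩

theorem Run.frame {O : Oracle} {P : Prog} {σ τ : Mem} {T : ℕ} (h : Run O P σ τ T) :
    Frame P σ τ := by
  induction h with
  | skip σ => exact .refl _ _
  | setNat => exact frame_writeNat (by simp [Prog.natWrites]) ..
  | setReal => exact frame_writeReal (by simp [Prog.realWrites]) ..
  | seq _ _ h₁ h₂ =>
    exact (h₁.mono (List.subset_append_left _ _) (List.subset_append_left _ _)).trans
      (h₂.mono (List.subset_append_right _ _) (List.subset_append_right _ _))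
  | iteTrue _ _ h => exact h.mono (List.subset_append_left _ _) (List.subset_append_left _ _)
  | iteFalse _ _ h => exact h.mono (List.subset_append_right _ _) (List.subset_append_right _ _)
  | loopTrue _ _ _ h₁ h₂ =>
    exact (h₁.mono (P' := .loop _ _) (List.Subset.refl _) (List.Subset.refl _)).trans h₂
  | loopFalse _ => exact .refl _ _

/-- Started in `σ`, the program halts in a memory that satisfies `Q`, within the time bound for
loops of at most `B` iterations. -/
def Wp (B : ℕ) (O : Oracle) (P : Prog) (σ : Mem) (Q : Mem → Prop) : Prop :=
  ∃ τ T, Run O P σ τ T ∧ T ≤ P.timeBound B ∧ Q τ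

variable {B : ℕ} {O : Oracle}

theorem Wp.conseq {P : Prog} {σ : Mem} {Q Q' : Mem → Prop} (h : Wp B O P σ Q)
    (hQ : ∀ τ, Frame P σ τ → Q τ → Q' τ) : Wp B O P σ Q' := by
  obtain ⟨τ, T, hrun, hT, hτ⟩ := h
  exact ⟨τ, T, hrun, hT, hQ τ hrun.frame hτ⟩

theorem wp_skip {σ : Mem} {Q : Mem → Prop} (h : Q σ) : Wp B O .skip σ Q :=
  ⟨σ, 1, .skip σ, le_rfl, h⟩

theorem wp_setNat {a : ℕ} {i e : NExp} {σ : Mem} {Q : Mem → Prop}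
    (h : Q (σ.writeNat a (i.eval σ) (e.eval σ))) : Wp B O (.setNat a i e) σ Q :=
  ⟨_, _, .setNat a i e σ, le_rfl, h⟩

theorem wp_setReal {a : ℕ} {i j : NExp} {e : RExp} {σ : Mem} {Q : Mem → Prop}
    (h : Q (σ.writeReal a (i.eval σ) (j.eval σ) (e.eval O σ))) :
    Wp B O (.setReal a i j e) σ Q :=
  ⟨_, _, .setReal a i j e σ, le_rfl, h⟩

theorem wp_seq {P₁ P₂ : Prog} {σ : Mem} {Q : Mem → Prop}
    (h : Wp B O P₁ σ fun τ => Wp B O P₂ τ Q) : Wp B O (.seq P₁ P₂) σ Q := by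
  obtain ⟨τ₁, T₁, hrun₁, hT₁, τ₂, T₂, hrun₂, hT₂, hτ₂⟩ := h
  exact ⟨τ₂, T₁ + T₂, .seq hrun₁ hrun₂, add_le_add hT₁ hT₂, hτ₂⟩

theorem wp_ite {t : Test} {P₁ P₂ : Prog} {σ : Mem} {Q : Mem → Prop}
    (htrue : t.holds O σ → Wp B O P₁ σ Q) (hfalse : ¬ t.holds O σ → Wp B O P₂ σ Q) :
    Wp B O (.ite t P₁ P₂) σ Q := by
  by_cases ht : t.holds O σ
  · obtain ⟨τ, T, hrun, hT, hτ⟩ := htrue ht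
    exact ⟨τ, _, .iteTrue ht hrun, by simp only [Prog.timeBound]; lia, hτ⟩
  · obtain ⟨τ, T, hrun, hT, hτ⟩ := hfalse ht
    exact ⟨τ, _, .iteFalse ht hrun, by simp only [Prog.timeBound]; lia, hτ⟩

/-- The variable held in the first cell of an array. -/
abbrev nvar (a : ℕ) : NExp := .get a (.const 0)

/-- The statement `c := c + 1`. -/
def increment (c : ℕ) : Prog := .setNat c (.const 0) (.add (nvar c) (.const 1))

/-- The test `c < N`. -/
def counterLt (c : ℕ) (N : NExp) : Test := .natLe (.add (nvar c) (.const 1)) N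

/-- `for c = 0, …, N - 1 do body`. -/
def forLoop (c : ℕ) (N : NExp) (body : Prog) : Prog :=
  .seq (.setNat c (.const 0) (.const 0)) (.loop (counterLt c N) (.seq body (increment c)))

@[simp] theorem forLoop_natWrites (c : ℕ) (N : NExp) (body : Prog) :
    (forLoop c N body).natWrites = c :: (body.natWrites ++ [c]) := rfl

@[simp] theorem forLoop_realWrites (c : ℕ) (N : NExp) (body : Prog) :
    (forLoop c N body).realWrites = body.realWrites := by
  simp [forLoop, increment, Prog.realWrites]

theorem counterLt_holds {σ : Mem} {c : ℕ} {N : NExp} :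
    (counterLt c N).holds O σ ↔ σ.nat c 0 < N.eval σ := Iff.rfl

theorem run_increment (σ : Mem) (c : ℕ) :
    Run O (increment c) σ (σ.writeNat c 0 (σ.nat c 0 + 1)) ((increment c).timeBound B) :=
  .setNat c (.const 0) (.add (nvar c) (.const 1)) σ

theorem exists_run_loop_of_forall_wp {c : ℕ} {N : NExp} {body : Prog} {σ : Mem} {Q : Mem → Prop}
    (n : ℕ) (I : ℕ → Mem → Prop) (hc : c ∉ body.natWrites)
    (hN : ∀ τ, Frame (forLoop c N body) σ τ → N.eval τ = n)
    (hstep : ∀ i < n, ∀ τ, Frame (forLoop c N body) σ τ → τ.nat c 0 = i → I i τ →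
      Wp B O body τ fun τ' => I (i + 1) (τ'.writeNat c 0 (i + 1)))
    (hend : ∀ τ, Frame (forLoop c N body) σ τ → I n τ → Q τ) (m : ℕ) :
    ∀ i τ, i + m = n → Frame (forLoop c N body) σ τ → τ.nat c 0 = i → I i τ →
      ∃ τ' T, Run O (.loop (counterLt c N) (.seq body (increment c))) τ τ' T ∧
        T ≤ (counterLt c N).time +
          m * ((counterLt c N).time + (Prog.seq body (increment c)).timeBound B) ∧ Q τ' := by
  induction m with
  | zero =>
    intro i τ hi hF hci hI
    refine ⟨τ, _, .loopFalse ?_, by simp, hend τ hF (hi ▸ hI)⟩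
    rw [counterLt_holds, hN τ hF]
    lia
  | succ m ih =>
    intro i τ hi hF hci hI
    obtain ⟨τ₁, T₁, hbody, hT₁, hI₁⟩ := hstep i (by lia) τ hF hci hI
    have hcτ₁ : τ₁.nat c 0 = i := by rw [hbody.frame.nat c hc, hci]
    have hF₁ : Frame (forLoop c N body) σ (τ₁.writeNat c 0 (i + 1)) :=
      (hF.trans (hbody.frame.mono (by simp) (by simp))).trans (frame_writeNat (by simp) ..)
    obtain ⟨τ', T', hloop, hT', hτ'⟩ := ih (i + 1) _ (by lia) hF₁ (by simp) hI₁
    have hincr := run_increment (O := O) (B := B) τ₁ c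
    rw [hcτ₁] at hincr
    refine ⟨τ', _, .loopTrue ?_ (.seq hbody hincr) hloop, ?_, hτ'⟩
    · rw [counterLt_holds, hN τ hF]
      lia
    · rw [add_mul, one_mul]
      simp only [Prog.timeBound] at hT' ⊢
      lia

theorem wp_forLoop {c : ℕ} {N : NExp} {body : Prog} {σ : Mem} {Q : Mem → Prop} (n : ℕ)
    (I : ℕ → Mem → Prop) (hn : n ≤ B) (hc : c ∉ body.natWrites)
    (hN : ∀ τ, Frame (forLoop c N body) σ τ → N.eval τ = n)
    (h0 : I 0 (σ.writeNat c 0 0))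
    (hstep : ∀ i < n, ∀ τ, Frame (forLoop c N body) σ τ → τ.nat c 0 = i → I i τ →
      Wp B O body τ fun τ' => I (i + 1) (τ'.writeNat c 0 (i + 1)))
    (hend : ∀ τ, Frame (forLoop c N body) σ τ → I n τ → Q τ) :
    Wp B O (forLoop c N body) σ Q := by
  refine wp_seq (wp_setNat ?_)
  obtain ⟨τ', T, hrun, hT, hτ'⟩ := exists_run_loop_of_forall_wp n I hc hN hstep hend n 0 _
    (by lia) (frame_writeNat (by simp) σ 0 0) (by simp) h0
  refine ⟨τ', T, hrun, hT.trans ?_, hτ'⟩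
  simp only [Prog.timeBound]
  gcongr

end WeakestPrecondition

/-! ### Alternating trees in the assignment problem -/

/-- Feasible dual variables of the assignment problem with the costs `c`. -/
def DualFeasible (n : ℕ) (c : ℕ → ℕ → ℝ) (u v : ℕ → ℝ) : Prop :=
  ∀ i < n, ∀ j < n, u i + v j ≤ c i j

/-- An injective assignment `f` of columns to the first `k` rows along tight edges. -/
structure TightMatching (n k : ℕ) (c : ℕ → ℕ → ℝ) (u v : ℕ → ℝ) (f : ℕ → ℕ) : Prop where
  lt : ∀ i < k, f i < n
  inj : ∀ i < k, ∀ j < k, f i = f j → i = j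
  tight : ∀ i < k, u i + v (f i) = c i (f i)

/-- A tree in the bipartite graph of the tight edges, with the rows `s 0 = k, s 1, …, s g` and the
columns `t 1, …, t h`: the parent of the column `t a` is the row `s (w a)`. The edges from the
columns to their child rows are left to `AltTree.matched`. -/
structure TightTree (n k g h : ℕ) (c : ℕ → ℕ → ℝ) (u v : ℕ → ℝ) (s t w : ℕ → ℕ) : Prop where
  root : s 0 = k
  row_lt : ∀ a, 1 ≤ a → a ≤ g → s a < k
  col_lt : ∀ a, 1 ≤ a → a ≤ h → t a < n
  col_inj : ∀ a, 1 ≤ a → a ≤ h → ∀ b, 1 ≤ b → b ≤ h → t a = t b → a = b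
  parent_lt : ∀ a, 1 ≤ a → a ≤ h → w a < a
  tight : ∀ a, 1 ≤ a → a ≤ h → u (s (w a)) + v (t a) = c (s (w a)) (t a)

/-- An alternating tree with respect to the matching `f`, rooted at the unmatched row `k`. -/
structure AltTree (n k h : ℕ) (c : ℕ → ℕ → ℝ) (u v : ℕ → ℝ) (f s t w : ℕ → ℕ) : Prop
    extends TightTree n k h h c u v s t w where
  matched : ∀ a, 1 ≤ a → a ≤ h → f (s a) = t a

/-- The positive entries of `inS` and `inT` mark the rows and the columns of a tree. -/
structure Marks (n h : ℕ) (s t inS inT : ℕ → ℕ) : Prop where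
  rows : ∀ i < n, 1 ≤ inS i ↔ ∃ a ≤ h, s a = i
  cols : ∀ j < n, 1 ≤ inT j ↔ ∃ a, 1 ≤ a ∧ a ≤ h ∧ t a = j

/-- The vector `u` with `δ` added at the marked positions below `n`. -/
def shiftMarked (n : ℕ) (δ : ℝ) (mark : ℕ → ℕ) (u : ℕ → ℝ) : ℕ → ℝ := fun i =>
  if i < n ∧ 1 ≤ mark i then u i + δ else u i

section

variable {n k g h : ℕ} {c : ℕ → ℕ → ℝ} {u v : ℕ → ℝ} {f s t w inS inT : ℕ → ℕ}

theorem TightMatching.update {r j k' : ℕ} (hf : TightMatching n k c u v f)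
    (hk' : ∀ i < k', i ≠ r → i < k) (hj : j < n) (hfree : ∀ i < k, f i ≠ j)
    (htight : u r + v j = c r j) : TightMatching n k' c u v (Function.update f r j) := by
  refine ⟨fun i hi => ?_, fun i hi i' hi' hii' => ?_, fun i hi => ?_⟩
  · rcases eq_or_ne i r with rfl | hir
    · simpa using hj
    · simpa [hir] using hf.lt i (hk' i hi hir)
  · rcases eq_or_ne i r with hir | hir <;> rcases eq_or_ne i' r with hir' | hir'
    · rw [hir, hir']
    · rw [hir, Function.update_self, Function.update_of_ne hir'] at hii'
      exact absurd hii'.symm (hfree i' (hk' i' hi' hir'))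
    · rw [hir', Function.update_self, Function.update_of_ne hir] at hii'
      exact absurd hii' (hfree i (hk' i hi hir))
    · rw [Function.update_of_ne hir, Function.update_of_ne hir'] at hii'
      exact hf.inj i (hk' i hi hir) i' (hk' i' hi' hir') hii'
  · rcases eq_or_ne i r with rfl | hir
    · simpa using htight
    · simpa [hir] using hf.tight i (hk' i hi hir)

theorem TightMatching.exists_perm_forall_sum_le (hf : TightMatching n n c u v f)
    (hd : DualFeasible n c u v) :
    ∃ π : Equiv.Perm (Fin n), (∀ i : Fin n, f i = π i) ∧
      ∀ π' : Equiv.Perm (Fin n), ∑ i : Fin n, c i (π i) ≤ ∑ i : Fin n, c i (π' i) := by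
  have hinj : Function.Injective fun i : Fin n => (⟨f i, hf.lt i i.2⟩ : Fin n) :=
    fun i j hij => Fin.ext (hf.inj i i.2 j j.2 (Fin.mk.inj hij))
  refine ⟨.ofBijective _ (Finite.injective_iff_bijective.1 hinj), fun i => rfl, fun π' => ?_⟩
  set π := Equiv.ofBijective _ (Finite.injective_iff_bijective.1 hinj)
  calc ∑ i : Fin n, c i (π i) = ∑ i : Fin n, (u i + v (π i)) :=
        Finset.sum_congr rfl fun i _ => (hf.tight i i.2).symm
    _ = ∑ i : Fin n, (u i + v (π' i)) := by
        rw [Finset.sum_add_distrib, Finset.sum_add_distrib,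
          Equiv.sum_comp π (fun j : Fin n => v j), Equiv.sum_comp π' (fun j : Fin n => v j)]
    _ ≤ ∑ i : Fin n, c i (π' i) := Finset.sum_le_sum fun i _ => hd i i.2 _ (π' i).2

theorem TightTree.row_le (ht : TightTree n k g h c u v s t w) {a : ℕ} (ha : a ≤ g) : s a ≤ k := by
  rcases Nat.eq_zero_or_pos a with rfl | ha'
  · exact ht.root.le
  · exact (ht.row_lt a ha' ha).le

theorem TightTree.addColumn (ht : TightTree n k h h c u v s t w) {i j : ℕ} (hi : i ≤ h) (hj : j < n)
    (hnew : ∀ a, 1 ≤ a → a ≤ h → t a ≠ j) (htight : u (s i) + v j = c (s i) j) :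
    TightTree n k h (h + 1) c u v s (Function.update t (h + 1) j)
      (Function.update w (h + 1) i) := by
  have hne : ∀ {a}, a ≤ h → a ≠ h + 1 := by lia
  refine ⟨ht.root, ht.row_lt, fun a ha hah => ?_, fun a ha hah b hb hbh hab => ?_,
    fun a ha hah => ?_, fun a ha hah => ?_⟩
  · rcases Nat.le_succ_iff.1 hah with hah | rfl
    · simpa [hne hah] using ht.col_lt a ha hah
    · simpa using hj
  · rcases Nat.le_succ_iff.1 hah with hah | rfl <;> rcases Nat.le_succ_iff.1 hbh with hbh | rfl
    · simp only [Function.update_of_ne (hne hah), Function.update_of_ne (hne hbh)] at hab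
      exact ht.col_inj a ha hah b hb hbh hab
    · simp only [Function.update_of_ne (hne hah), Function.update_self] at hab
      exact absurd hab (hnew a ha hah)
    · simp only [Function.update_of_ne (hne hbh), Function.update_self] at hab
      exact absurd hab.symm (hnew b hb hbh)
    · rfl
  · rcases Nat.le_succ_iff.1 hah with hah | rfl
    · simpa [hne hah] using ht.parent_lt a ha hah
    · simpa using Nat.lt_succ_of_le hi
  · rcases Nat.le_succ_iff.1 hah with hah | rfl
    · simpa [hne hah] using ht.tight a ha hah
    · simpa using htight

theorem TightTree.addRow {r : ℕ} (ht : TightTree n k h (h + 1) c u v s t w)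
    (hmatched : ∀ a, 1 ≤ a → a ≤ h → f (s a) = t a) (hr : r < k) (hfr : f r = t (h + 1)) :
    AltTree n k (h + 1) c u v f (Function.update s (h + 1) r) t w := by
  have hs : ∀ {a}, a ≤ h → Function.update s (h + 1) r a = s a :=
    fun ha => Function.update_of_ne (by lia) _ _
  refine ⟨⟨(hs h.zero_le).trans ht.root, fun a ha hah => ?_, ht.col_lt, ht.col_inj, ht.parent_lt,
    fun a ha hah => ?_⟩, fun a ha hah => ?_⟩
  · rcases Nat.le_succ_iff.1 hah with hah | rfl
    · simpa only [hs hah] using ht.row_lt a ha hah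
    · simpa using hr
  · have := ht.parent_lt a ha hah
    rw [hs (by lia)]
    exact ht.tight a ha hah
  · rcases Nat.le_succ_iff.1 hah with hah | rfl
    · simpa only [hs hah] using hmatched a ha hah
    · simpa using hfr

theorem Marks.addRow {r : ℕ} (hm : Marks n h s t inS inT) :
    Marks n (h + 1) (Function.update s (h + 1) r) t (Function.update inS r 1)
      (Function.update inT (t (h + 1)) 1) := by
  have hs : ∀ {a}, a ≤ h → Function.update s (h + 1) r a = s a :=
    fun ha => Function.update_of_ne (by lia) _ _
  refine ⟨fun i hi => ?_, fun j hj => ?_⟩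
  · rcases eq_or_ne i r with rfl | hir
    · simpa using ⟨h + 1, le_rfl, by simp⟩
    · rw [Function.update_of_ne hir, hm.rows i hi]
      constructor
      · rintro ⟨a, ha, rfl⟩
        exact ⟨a, by lia, hs ha⟩
      · rintro ⟨a, ha, rfl⟩
        rcases Nat.le_succ_iff.1 ha with ha | rfl
        · exact ⟨a, ha, (hs ha).symm⟩
        · simp at hir
  · rcases eq_or_ne j (t (h + 1)) with rfl | hjt
    · simpa using ⟨h + 1, by lia, le_rfl, rfl⟩
    · rw [Function.update_of_ne hjt, hm.cols j hj]
      constructor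
      · rintro ⟨a, ha, hah, rfl⟩
        exact ⟨a, ha, by lia, rfl⟩
      · rintro ⟨a, ha, hah, rfl⟩
        rcases Nat.le_succ_iff.1 hah with hah | rfl
        · exact ⟨a, ha, hah, rfl⟩
        · exact absurd rfl hjt

theorem AltTree.height_le (ht : AltTree n k h c u v f s t w) : h ≤ k := by
  have hinj : Set.InjOn s (Finset.Icc 1 h) := by
    intro a ha b hb hab
    simp only [Finset.coe_Icc, Set.mem_Icc] at ha hb
    refine ht.col_inj a ha.1 ha.2 b hb.1 hb.2 ?_
    rw [← ht.matched a ha.1 ha.2, ← ht.matched b hb.1 hb.2, hab]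
  have hmaps : Set.MapsTo s (Finset.Icc 1 h) (Finset.range k) := by
    intro a ha
    simp only [Finset.coe_Icc, Set.mem_Icc] at ha
    simpa using ht.row_lt a ha.1 ha.2
  simpa using Finset.card_le_card_of_injOn s hmaps hinj

theorem AltTree.exists_unmarked (ht : AltTree n k h c u v f s t w) (hm : Marks n h s t inS inT)
    (hk : k < n) : ∃ j < n, inT j = 0 := by
  by_contra! hmarked
  have hsub : Finset.range n ⊆ (Finset.Icc 1 h).image t := by
    intro j hj
    rw [Finset.mem_range] at hj
    obtain ⟨a, ha, hah, rfl⟩ := (hm.cols j hj).1 (Nat.one_le_iff_ne_zero.2 (hmarked j hj))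
    exact Finset.mem_image_of_mem t (Finset.mem_Icc.2 ⟨ha, hah⟩)
  have hcard := (Finset.card_le_card hsub).trans Finset.card_image_le
  have hhk := ht.height_le
  simp only [Finset.card_range, Nat.card_Icc] at hcard
  lia

theorem DualFeasible.shiftMarked {δ : ℝ} (hd : DualFeasible n c u v) (hm : Marks n h s t inS inT)
    (hδ : ∀ a ≤ h, ∀ j < n, inT j = 0 → δ ≤ c (s a) j - u (s a) - v j) (hδ0 : 0 ≤ δ) :
    DualFeasible n c (shiftMarked n δ inS u) (shiftMarked n (-δ) inT v) := by
  intro i hi j hj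
  have hij := hd i hi j hj
  simp only [RealRAM.shiftMarked, hi, hj, true_and]
  split_ifs with hiS hjT hjT
  · linarith
  · obtain ⟨a, ha, rfl⟩ := (hm.rows i hi).1 hiS
    linarith [hδ a ha j hj (by lia)]
  · linarith
  · exact hij

theorem AltTree.marked_iff (ht : AltTree n k h c u v f s t w) (hf : TightMatching n k c u v f)
    (hm : Marks n h s t inS inT) (hk : k ≤ n) {i : ℕ} (hi : i < k) :
    1 ≤ inS i ↔ 1 ≤ inT (f i) := by
  rw [hm.rows i (by lia), hm.cols _ (hf.lt i hi)]
  constructor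
  · rintro ⟨a, hah, rfl⟩
    have ha : a ≠ 0 := by
      rintro rfl
      exact hi.ne ht.root
    exact ⟨a, by lia, hah, (ht.matched a (by lia) hah).symm⟩
  · rintro ⟨a, ha, hah, hta⟩
    exact ⟨a, hah, hf.inj _ (ht.row_lt a ha hah) _ hi ((ht.matched a ha hah).trans hta)⟩

theorem TightMatching.shiftMarked (δ : ℝ) (hf : TightMatching n k c u v f)
    (ht : AltTree n k h c u v f s t w) (hm : Marks n h s t inS inT) (hk : k ≤ n) :
    TightMatching n k c (shiftMarked n δ inS u) (shiftMarked n (-δ) inT v) f := by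
  refine ⟨hf.lt, hf.inj, fun i hi => ?_⟩
  have htight := hf.tight i hi
  simp only [RealRAM.shiftMarked, hi.trans_le hk, hf.lt i hi, true_and, ht.marked_iff hf hm hk hi]
  split_ifs <;> linarith

theorem Marks.shiftMarked_row (hm : Marks n h s t inS inT) (δ : ℝ) {a : ℕ} (ha : a ≤ h)
    (hsa : s a < n) : shiftMarked n δ inS u (s a) = u (s a) + δ := by
  rw [shiftMarked, if_pos ⟨hsa, (hm.rows _ hsa).2 ⟨a, ha, rfl⟩⟩]

theorem Marks.shiftMarked_col (hm : Marks n h s t inS inT) (δ : ℝ) {a : ℕ} (ha : 1 ≤ a)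
    (hah : a ≤ h) (hta : t a < n) : shiftMarked n δ inT v (t a) = v (t a) + δ := by
  rw [shiftMarked, if_pos ⟨hta, (hm.cols _ hta).2 ⟨a, ha, hah, rfl⟩⟩]

theorem TightTree.shiftMarked (δ : ℝ) (ht : TightTree n k h h c u v s t w)
    (hm : Marks n h s t inS inT) (hk : k < n) :
    TightTree n k h h c (shiftMarked n δ inS u) (shiftMarked n (-δ) inT v) s t w := by
  refine ⟨ht.root, ht.row_lt, ht.col_lt, ht.col_inj, ht.parent_lt, fun a ha hah => ?_⟩
  have hwa : w a ≤ h := (ht.parent_lt a ha hah).le.trans hah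
  rw [hm.shiftMarked_row δ hwa ((ht.row_le hwa).trans_lt hk),
    hm.shiftMarked_col (-δ) ha hah (ht.col_lt a ha hah)]
  linarith [ht.tight a ha hah]

theorem TightTree.addColumn_shiftMarked (ht : TightTree n k h h c u v s t w)
    (hm : Marks n h s t inS inT) (hk : k < n) {i j : ℕ} (hi : i ≤ h) (hj : j < n)
    (hjT : inT j = 0) {δ : ℝ} (hδ : δ = c (s i) j - u (s i) - v j) :
    TightTree n k h (h + 1) c (RealRAM.shiftMarked n δ inS u) (RealRAM.shiftMarked n (-δ) inT v) s
      (Function.update t (h + 1) j) (Function.update w (h + 1) i) := by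
  refine (ht.shiftMarked δ hm hk).addColumn hi hj (fun a ha hah hta => ?_) ?_
  · have := (hm.cols j hj).2 ⟨a, ha, hah, hta⟩
    lia
  · have hcol : RealRAM.shiftMarked n (-δ) inT v j = v j := by simp [RealRAM.shiftMarked, hjT]
    rw [hm.shiftMarked_row δ hi ((ht.row_le hi).trans_lt hk), hcol, hδ]
    ring

/-- The state of an augmentation along the path from the free column `t (h + 1)` of a tree to its
root `k`, when the path is flipped below its column `t x`: this column is free now, and row `k` is
matched once `x = 0`. -/
structure Augmenting (n k x : ℕ) (c : ℕ → ℕ → ℝ) (u v : ℕ → ℝ) (f s t : ℕ → ℕ) : Prop where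
  matching : TightMatching n (if x = 0 then k + 1 else k) c u v f
  matched : ∀ a, 1 ≤ a → a < x → f (s a) = t a
  free : 1 ≤ x → ∀ i < k, f i ≠ t x

theorem Augmenting.step {x : ℕ} (ha : Augmenting n k x c u v f s t)
    (ht : TightTree n k h (h + 1) c u v s t w) (hx : 1 ≤ x) (hxh : x ≤ h + 1) :
    Augmenting n k (w x) c u v (Function.update f (s (w x)) (t x)) s t := by
  have hf := ha.matching
  have hwx := ht.parent_lt x hx hxh
  rw [if_neg (by lia)] at hf
  refine ⟨hf.update (fun i hi hir => ?_) (ht.col_lt x hx hxh) (ha.free hx) (ht.tight x hx hxh),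
    fun a ha1 hax => ?_, fun hw1 i hi => ?_⟩
  · split_ifs at hi with hw0
    · rw [hw0, ht.root] at hir
      lia
    · exact hi
  · have hne : s a ≠ s (w x) := by
      intro hs
      have heq : t a = t (w x) := by
        rw [← ha.matched a ha1 (by lia), hs, ha.matched (w x) (by lia) hwx]
      exact hax.ne (ht.col_inj a ha1 (by lia) (w x) (by lia) (by lia) heq)
    rw [Function.update_of_ne hne, ha.matched a ha1 (by lia)]
  · rcases eq_or_ne i (s (w x)) with rfl | his
    · rw [Function.update_self]
      exact fun heq => hwx.ne' (ht.col_inj x hx hxh (w x) hw1 (by lia) heq)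
    · rw [Function.update_of_ne his, ← ha.matched (w x) hw1 hwx]
      exact fun heq => his (hf.inj i hi _ (ht.row_lt _ hw1 (by lia)) heq)

end

/-! ### The Hungarian method -/

section HungarianProgram

attribute [simp] NExp.eval RExp.eval Test.holds Mem.writeNat_nat

@[simp] theorem Mem.writeReal_real (σ : Mem) (a i j : ℕ) (x : ℝ) (b : ℕ) :
    (σ.writeReal a i j x).real b =
      if b = a then fun i' j' => if i' = i ∧ j' = j then x else σ.real a i' j' else σ.real b := by
  split_ifs with h
  · subst h
    funext i' j'
    exact Mem.writeReal_same σ b i j x i' j'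
  · exact Mem.writeReal_ne σ i j x h

-- Arrays of natural numbers and arrays of real numbers are numbered independently. The numbers of
-- `size`, `outPerm`, `input` and `outMotion` are prescribed by `inputMem` and `HoldsOutput`.
namespace Reg

@[simp] abbrev size : ℕ := 0
@[simp] abbrev outPerm : ℕ := 1
@[simp] abbrev rowMatch : ℕ := 2
@[simp] abbrev treeRow : ℕ := 3
@[simp] abbrev treeCol : ℕ := 4
@[simp] abbrev treeParent : ℕ := 5
@[simp] abbrev rowMark : ℕ := 6
@[simp] abbrev colMark : ℕ := 7
@[simp] abbrev curRow : ℕ := 8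
@[simp] abbrev height : ℕ := 9
@[simp] abbrev point₁ : ℕ := 10
@[simp] abbrev point₂ : ℕ := 11
@[simp] abbrev point₃ : ℕ := 12
@[simp] abbrev line₁ : ℕ := 13
@[simp] abbrev line₂ : ℕ := 14
@[simp] abbrev line₃ : ℕ := 15
@[simp] abbrev i : ℕ := 16
@[simp] abbrev j : ℕ := 17
@[simp] abbrev found : ℕ := 18
@[simp] abbrev bestPos : ℕ := 19
@[simp] abbrev bestCol : ℕ := 20
@[simp] abbrev colMatched : ℕ := 21
@[simp] abbrev pathPos : ℕ := 22
@[simp] abbrev done : ℕ := 23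
@[simp] abbrev seen : ℕ := 24

@[simp] abbrev input : ℕ := 0
@[simp] abbrev outMotion : ℕ := 1
@[simp] abbrev motion : ℕ := 2
@[simp] abbrev costs : ℕ := 3
@[simp] abbrev rowDual : ℕ := 4
@[simp] abbrev colDual : ℕ := 5
@[simp] abbrev leastSlack : ℕ := 6
@[simp] abbrev bestCost : ℕ := 7
@[simp] abbrev curCost : ℕ := 8

end Reg

/-- The real variable held in the first cell of an array. -/
abbrev rvar (a : ℕ) : RExp := .get a (.const 0) (.const 0)

/-- Starts a tree that consists of the row `curRow` only. -/
def initTree : Prog :=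
  .seq (forLoop Reg.i (nvar Reg.size)
    (.seq (.setNat Reg.rowMark (nvar Reg.i) (.const 0))
      (.setNat Reg.colMark (nvar Reg.i) (.const 0))))
  (.seq (.setNat Reg.treeRow (.const 0) (nvar Reg.curRow))
  (.seq (.setNat Reg.rowMark (nvar Reg.curRow) (.const 1))
    (.setNat Reg.done (.const 0) (.const 0))))

/-- The slack of the edge from the row at position `i` of the tree to the column `j`. -/
def slackExp : RExp :=
  .sub (.sub (.get Reg.costs (.get Reg.treeRow (nvar Reg.i)) (nvar Reg.j))
    (.get Reg.rowDual (.get Reg.treeRow (nvar Reg.i)) (.const 0)))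
    (.get Reg.colDual (nvar Reg.j) (.const 0))

/-- Records the edge at hand if it is the first one or beats the best one recorded so far. -/
def offerEdge : Prog :=
  .ite (.and (.natLe (.const 1) (nvar Reg.found)) (.realLe (rvar Reg.leastSlack) slackExp)) .skip
    (.seq (.setReal Reg.leastSlack (.const 0) (.const 0) slackExp)
    (.seq (.setNat Reg.bestPos (.const 0) (nvar Reg.i))
    (.seq (.setNat Reg.bestCol (.const 0) (nvar Reg.j))
      (.setNat Reg.found (.const 0) (.const 1)))))

/-- Finds an edge of least slack among those from the rows of the tree to the columns outside it. -/
def findLeastSlack : Prog :=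
  .seq (.setNat Reg.found (.const 0) (.const 0))
    (forLoop Reg.i (.add (nvar Reg.height) (.const 1))
      (forLoop Reg.j (nvar Reg.size)
        (.ite (.natLe (.get Reg.colMark (nvar Reg.j)) (.const 0)) offerEdge .skip)))

/-- Adds `e` to the entry `i` of an array of dual variables if that entry is marked. -/
def shiftCell (dual mark : ℕ) (e : RExp) : Prog :=
  .ite (.natLe (.const 1) (.get mark (nvar Reg.i)))
    (.setReal dual (nvar Reg.i) (.const 0) (.add (.get dual (nvar Reg.i) (.const 0)) e)) .skip

/-- Changes the dual variables of the marked rows and columns by the least slack, so that the edge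
found becomes tight and those of the tree stay tight. -/
def updateDuals : Prog :=
  forLoop Reg.i (nvar Reg.size)
    (.seq (shiftCell Reg.rowDual Reg.rowMark (rvar Reg.leastSlack))
      (shiftCell Reg.colDual Reg.colMark (.sub (.const 0) (rvar Reg.leastSlack))))

/-- Grows the tree by a column, which is neither marked nor counted in `height` yet. -/
def addColumn : Prog :=
  .seq findLeastSlack
  (.seq updateDuals
  (.seq (.setNat Reg.treeCol (.add (nvar Reg.height) (.const 1)) (nvar Reg.bestCol))
    (.setNat Reg.treeParent (.add (nvar Reg.height) (.const 1)) (nvar Reg.bestPos))))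

/-- Searches for the row that is matched to the new column. -/
def searchRow : Prog :=
  .seq (.setNat Reg.colMatched (.const 0) (.const 0))
    (forLoop Reg.i (nvar Reg.curRow)
      (.ite (.and (.natLe (.get Reg.rowMatch (nvar Reg.i)) (nvar Reg.bestCol))
          (.natLe (nvar Reg.bestCol) (.get Reg.rowMatch (nvar Reg.i))))
        (.seq (.setNat Reg.treeRow (.add (nvar Reg.height) (.const 1)) (nvar Reg.i))
          (.setNat Reg.colMatched (.const 0) (.const 1)))
        .skip))

/-- Marks the new column and its row. -/
def markLast : Prog :=
  .seq (.setNat Reg.rowMark (.get Reg.treeRow (.add (nvar Reg.height) (.const 1))) (.const 1))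
    (.setNat Reg.colMark (.get Reg.treeCol (.add (nvar Reg.height) (.const 1))) (.const 1))

/-- Flips the matching along the path from the new column to the root of the tree. After `pathPos`
has become `0`, the remaining iterations are idle. -/
def augment : Prog :=
  .seq (.setNat Reg.pathPos (.const 0) (.add (nvar Reg.height) (.const 1)))
    (forLoop Reg.i (.add (nvar Reg.size) (.const 1))
      (.ite (.natLe (.const 1) (nvar Reg.pathPos))
        (.seq (.setNat Reg.rowMatch (.get Reg.treeRow (.get Reg.treeParent (nvar Reg.pathPos)))
            (.get Reg.treeCol (nvar Reg.pathPos)))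
          (.setNat Reg.pathPos (.const 0) (.get Reg.treeParent (nvar Reg.pathPos))))
        .skip))

/-- Grows the tree by a column and either its row or, if it is unmatched, an augmentation. -/
def treeStep : Prog :=
  .seq addColumn
  (.seq searchRow
    (.ite (.natLe (.const 1) (nvar Reg.colMatched)) markLast
      (.seq augment (.setNat Reg.done (.const 0) (.const 1)))))

/-- Matches the row `curRow`. After the augmentation, the remaining iterations are idle. -/
def matchRow : Prog :=
  .seq initTree
    (forLoop Reg.height (nvar Reg.size)
      (.ite (.natLe (nvar Reg.done) (.const 0)) treeStep .skip))

/-- The Hungarian method for the assignment problem with the costs in `Reg.costs`. -/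
def hungarian : Prog :=
  .seq (forLoop Reg.i (nvar Reg.size)
    (.seq (.setReal Reg.rowDual (nvar Reg.i) (.const 0) (.const 0))
      (.setReal Reg.colDual (nvar Reg.i) (.const 0) (.const 0))))
    (forLoop Reg.curRow (nvar Reg.size) matchRow)

/-- The dual variables of the rows. -/
def Mem.rowDual (σ : Mem) : ℕ → ℝ := fun i => σ.real Reg.rowDual i 0

/-- The dual variables of the columns. -/
def Mem.colDual (σ : Mem) : ℕ → ℝ := fun j => σ.real Reg.colDual j 0

/-- The slack of the edge from the row at position `p.1` of the tree to the column `p.2`. -/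
def Mem.slack (σ : Mem) (p : ℕ × ℕ) : ℝ :=
  σ.real Reg.costs (σ.nat Reg.treeRow p.1) p.2 - σ.rowDual (σ.nat Reg.treeRow p.1) - σ.colDual p.2

/-- The edge recorded by `offerEdge`. -/
def Mem.best (σ : Mem) : ℕ × ℕ := (σ.nat Reg.bestPos 0, σ.nat Reg.bestCol 0)

/-- The memory records an edge of least slack among the edges in `D`, or that `D` is empty. -/
def HoldsLeast (slack : ℕ × ℕ → ℝ) (D : Set (ℕ × ℕ)) (τ : Mem) : Prop :=
  τ.nat Reg.found 0 = 0 ∧ D = ∅ ∨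
  τ.nat Reg.found 0 = 1 ∧ τ.best ∈ D ∧ τ.real Reg.leastSlack 0 0 = slack τ.best ∧
    ∀ p ∈ D, slack τ.best ≤ slack p

variable {B : ℕ} {O : Oracle} {n : ℕ}

theorem wp_initTree {σ : Mem} (hn : σ.nat Reg.size 0 = n) (hB : n ≤ B) :
    Wp B O initTree σ fun τ =>
      (∀ i < n, τ.nat Reg.rowMark i = if i = σ.nat Reg.curRow 0 then 1 else 0) ∧
      (∀ j < n, τ.nat Reg.colMark j = 0) ∧
      τ.nat Reg.treeRow 0 = σ.nat Reg.curRow 0 ∧ τ.nat Reg.done 0 = 0 := by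
  refine wp_seq (wp_forLoop n
    (fun i τ => ∀ j < i, τ.nat Reg.rowMark j = 0 ∧ τ.nat Reg.colMark j = 0) hB (by decide)
    (fun τ hF => ?_) (by simp) (fun i hi τ _ hc hI => ?_) (fun τ hF hI => ?_))
  · simpa +decide [hF.nat] using hn
  · refine wp_seq (wp_setNat (wp_setNat fun j hj => ?_))
    rcases Nat.lt_succ_iff_lt_or_eq.1 hj with hj | rfl
    · simp [hc, hj.ne, hI j hj]
    · simp [hc]
  · refine wp_seq (wp_setNat (wp_seq (wp_setNat (wp_setNat ?_))))
    have hrow := hF.nat Reg.curRow (by decide)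
    refine ⟨fun i hi => ?_, fun j hj => ?_, ?_, ?_⟩
    · simp [hrow, hI i hi, Function.update_apply]
    · simp [hI j hj]
    · simp [hrow]
    · simp

theorem wp_offerEdge {τ : Mem} {slack : ℕ × ℕ → ℝ} {D : Set (ℕ × ℕ)} {a j : ℕ}
    (ha : τ.nat Reg.i 0 = a) (hj : τ.nat Reg.j 0 = j) (hs : slackExp.eval O τ = slack (a, j))
    (hI : HoldsLeast slack D τ) :
    Wp B O offerEdge τ (HoldsLeast slack (insert (a, j) D)) := by
  refine wp_ite (fun ht => wp_skip ?_) (fun ht => ?_)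
  · simp only [Test.holds, hs] at ht
    rcases hI with ⟨hfound, -⟩ | ⟨hfound, hD, hbest, hle⟩
    · simp [hfound] at ht
    · have hnew : slack τ.best ≤ slack (a, j) := hbest ▸ ht.2
      exact .inr ⟨hfound, .inr hD, hbest, by simpa [hnew] using hle⟩
  · simp only [Test.holds, NExp.eval, RExp.eval, hs, not_and, not_le] at ht
    refine wp_seq (wp_setReal (wp_seq (wp_setNat (wp_seq (wp_setNat (wp_setNat (.inr ?_)))))))
    rw [hs]
    have hnew : ∀ p ∈ D, slack (a, j) ≤ slack p := by
      rcases hI with ⟨-, rfl⟩ | ⟨hfound, -, hbest, hle⟩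
      · simp
      · exact fun p hp => (hbest ▸ ht hfound.ge).le.trans (hle p hp)
    simpa [Mem.best, ha, hj] using hnew

theorem HoldsLeast.writeNat_iff {slack : ℕ × ℕ → ℝ} {D : Set (ℕ × ℕ)} {τ : Mem} {a i x : ℕ}
    (hfound : Reg.found ≠ a) (hpos : Reg.bestPos ≠ a) (hcol : Reg.bestCol ≠ a) :
    HoldsLeast slack D (τ.writeNat a i x) ↔ HoldsLeast slack D τ := by
  simp only [HoldsLeast, Mem.best, Mem.writeNat_ne _ _ _ hfound, Mem.writeNat_ne _ _ _ hpos,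
    Mem.writeNat_ne _ _ _ hcol, Mem.writeNat_real]

theorem wp_findLeastSlack_column {σ : Mem} {i : ℕ} (hi : σ.nat Reg.i 0 = i)
    (hn : σ.nat Reg.size 0 = n) (hB : n ≤ B)
    (hI : HoldsLeast σ.slack {p | p.1 < i ∧ p.2 < n ∧ σ.nat Reg.colMark p.2 = 0} σ) :
    Wp B O (forLoop Reg.j (nvar Reg.size)
      (.ite (.natLe (.get Reg.colMark (nvar Reg.j)) (.const 0)) offerEdge .skip)) σ
      (HoldsLeast σ.slack {p | p.1 < i + 1 ∧ p.2 < n ∧ σ.nat Reg.colMark p.2 = 0}) := by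
  refine wp_forLoop n (fun m => HoldsLeast σ.slack
      {p | (p.1 < i ∧ p.2 < n ∨ p.1 = i ∧ p.2 < m) ∧ σ.nat Reg.colMark p.2 = 0}) hB (by decide)
    (fun τ hF => ?_) ?_ (fun m hm τ hF hj hI => ?_) (fun τ _ hI => ?_)
  · simpa +decide [hF.nat] using hn
  · rw [HoldsLeast.writeNat_iff (by decide) (by decide) (by decide)]
    simpa [and_assoc] using hI
  · have hslack : slackExp.eval O τ = σ.slack (i, m) := by
      simp +decide [slackExp, Mem.slack, Mem.rowDual, Mem.colDual, hF.nat, hF.real, hi, hj]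
    have hmark : τ.nat Reg.colMark m = σ.nat Reg.colMark m := by simp +decide [hF.nat]
    refine wp_ite (fun ht => ?_) (fun ht => wp_skip ?_) <;>
      simp only [Test.holds, NExp.eval, hj, hmark, nonpos_iff_eq_zero] at ht
    · refine (wp_offerEdge (by simp +decide [hF.nat, hi]) hj hslack hI).conseq fun τ' _ hI' => ?_
      rw [HoldsLeast.writeNat_iff (by decide) (by decide) (by decide)]
      convert hI' using 1
      ext ⟨a, j⟩
      simp only [Set.mem_ofPred_eq, Set.mem_insert_iff, Prod.mk.injEq]
      grind
    · rw [HoldsLeast.writeNat_iff (by decide) (by decide) (by decide)]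
      convert hI using 1
      ext ⟨a, j⟩
      simp only [Set.mem_ofPred_eq]
      grind
  · convert hI using 1
    ext ⟨a, j⟩
    simp only [Set.mem_ofPred_eq]
    lia

theorem wp_findLeastSlack {σ : Mem} (hn : σ.nat Reg.size 0 = n) (hB : n ≤ B)
    (hB' : σ.nat Reg.height 0 + 1 ≤ B) (hex : ∃ j < n, σ.nat Reg.colMark j = 0) :
    Wp B O findLeastSlack σ fun τ =>
      τ.nat Reg.bestPos 0 ≤ σ.nat Reg.height 0 ∧ τ.nat Reg.bestCol 0 < n ∧
      σ.nat Reg.colMark (τ.nat Reg.bestCol 0) = 0 ∧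
      τ.real Reg.leastSlack 0 0 = σ.slack τ.best ∧
      ∀ a ≤ σ.nat Reg.height 0, ∀ j < n, σ.nat Reg.colMark j = 0 →
        τ.real Reg.leastSlack 0 0 ≤ σ.slack (a, j) := by
  refine wp_seq (wp_setNat (wp_forLoop (σ.nat Reg.height 0 + 1)
    (fun i => HoldsLeast σ.slack {p | p.1 < i ∧ p.2 < n ∧ σ.nat Reg.colMark p.2 = 0})
    hB' (by decide) (fun τ hF => ?_) (.inl ?_) (fun i _ τ hF hc hI => ?_) (fun τ _ hI => ?_)))
  · simp +decide [hF.nat]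
  · simp
  · have hslack : τ.slack = σ.slack := by
      funext p
      simp +decide [Mem.slack, Mem.rowDual, Mem.colDual, hF.nat, hF.real]
    have hmark : τ.nat Reg.colMark = σ.nat Reg.colMark := by simp +decide [hF.nat]
    refine (wp_findLeastSlack_column hc (by simpa +decide [hF.nat] using hn) hB
      (by rwa [hslack, hmark])).conseq fun τ' _ hI' => ?_
    rw [HoldsLeast.writeNat_iff (by decide) (by decide) (by decide)]
    rwa [hslack, hmark] at hI'
  · obtain ⟨j, hj, hmark⟩ := hex
    rcases hI with ⟨-, hempty⟩ | ⟨-, ⟨hpos, hcol, hbest⟩, hslack, hle⟩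
    · exact absurd (show (0, j) ∈ (∅ : Set (ℕ × ℕ)) from hempty ▸ ⟨by simp, hj, hmark⟩) (by simp)
    · exact ⟨Nat.lt_succ_iff.1 hpos, hcol, hbest, hslack,
        fun a ha j hj hj' => hslack ▸ hle (a, j) ⟨Nat.lt_succ_iff.2 ha, hj, hj'⟩⟩

theorem shiftMarked_succ (m : ℕ) (δ : ℝ) (mark : ℕ → ℕ) (u : ℕ → ℝ) :
    shiftMarked (m + 1) δ mark u =
      if 1 ≤ mark m then Function.update (shiftMarked m δ mark u) m (shiftMarked m δ mark u m + δ)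
      else shiftMarked m δ mark u := by
  funext i
  rcases eq_or_ne i m with rfl | him
  · split_ifs with hmark <;> simp [shiftMarked, hmark]
  · have hlt : i < m + 1 ↔ i < m := by lia
    split_ifs <;> simp [shiftMarked, him, hlt]

theorem wp_shiftCell {dual mark : ℕ} {e : RExp} {τ : Mem} {m : ℕ} {δ : ℝ} {u : ℕ → ℝ}
    (hi : τ.nat Reg.i 0 = m) (he : e.eval O τ = δ)
    (hu : (fun i => τ.real dual i 0) = shiftMarked m δ (τ.nat mark) u) :
    Wp B O (shiftCell dual mark e) τ fun τ' =>
      (fun i => τ'.real dual i 0) = shiftMarked (m + 1) δ (τ.nat mark) u := by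
  rw [shiftMarked_succ, ← hu]
  refine wp_ite (fun ht => wp_setReal ?_) (fun ht => wp_skip ?_)
  · simp only [Test.holds, NExp.eval, hi] at ht
    funext i
    simp [ht, hi, he, Function.update_apply]
  · simp only [Test.holds, NExp.eval, hi] at ht
    simp [ht]

theorem wp_updateDuals {σ : Mem} {δ : ℝ} (hn : σ.nat Reg.size 0 = n) (hB : n ≤ B)
    (hδ : σ.real Reg.leastSlack 0 0 = δ) :
    Wp B O updateDuals σ fun τ =>
      τ.rowDual = shiftMarked n δ (σ.nat Reg.rowMark) σ.rowDual ∧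
      τ.colDual = shiftMarked n (-δ) (σ.nat Reg.colMark) σ.colDual := by
  refine wp_forLoop n (fun m τ =>
      τ.rowDual = shiftMarked m δ (σ.nat Reg.rowMark) σ.rowDual ∧
      τ.colDual = shiftMarked m (-δ) (σ.nat Reg.colMark) σ.colDual)
    hB (by decide) (fun τ hF => ?_) ?_ (fun m _ τ hF hi hI => ?_) (fun τ _ hI => hI)
  · simpa +decide [hF.nat] using hn
  · constructor <;> funext i <;> simp [shiftMarked, Mem.rowDual, Mem.colDual]
  · have hrowMark := hF.nat Reg.rowMark (by decide)
    have hcolMark := hF.nat Reg.colMark (by decide)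
    have hδτ : τ.real Reg.leastSlack 0 0 = δ := by simpa +decide [hF.real] using hδ
    refine wp_seq ((wp_shiftCell (e := rvar Reg.leastSlack) hi hδτ
      (hrowMark ▸ hI.1)).conseq fun τ₁ hF₁ hrow => ?_)
    have hcol₁ : (fun j => τ₁.real Reg.colDual j 0) =
        shiftMarked m (-δ) (τ₁.nat Reg.colMark) σ.colDual := by
      have h₁ := hF₁.nat Reg.colMark (by decide)
      have h₂ := hF₁.real Reg.colDual (by decide)
      rw [h₁, h₂, hcolMark]
      exact hI.2
    have hδ₁ : (RExp.sub (.const 0) (rvar Reg.leastSlack)).eval O τ₁ = -δ := by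
      simpa +decide [hF₁.real] using hδτ
    have hi₁ : τ₁.nat Reg.i 0 = m := by simpa +decide [hF₁.nat] using hi
    refine (wp_shiftCell hi₁ hδ₁ hcol₁).conseq fun τ₂ hF₂ hcol => ⟨?_, ?_⟩
    · rw [← hrowMark, ← hrow, ← hF₂.real Reg.rowDual (by decide)]
      rfl
    · rw [← hcolMark, ← hF₁.nat Reg.colMark (by decide), ← hcol]
      rfl

end HungarianProgram

section HungarianCorrectness

/-- The memory holds the state of the Hungarian method after the matching of the first `k` rows. -/
structure SolvedRows (n k : ℕ) (c : ℕ → ℕ → ℝ) (σ : Mem) : Prop where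
  feasible : DualFeasible n c σ.rowDual σ.colDual
  matching : TightMatching n k c σ.rowDual σ.colDual (σ.nat Reg.rowMatch)

/-- The memory holds an alternating tree of height `h` for the matching of row `k`. -/
structure GrowingTree (n k h : ℕ) (c : ℕ → ℕ → ℝ) (σ : Mem) : Prop
    extends SolvedRows n k c σ where
  tree : AltTree n k h c σ.rowDual σ.colDual (σ.nat Reg.rowMatch) (σ.nat Reg.treeRow)
    (σ.nat Reg.treeCol) (σ.nat Reg.treeParent)
  marks : Marks n h (σ.nat Reg.treeRow) (σ.nat Reg.treeCol) (σ.nat Reg.rowMark)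
    (σ.nat Reg.colMark)

/-- The memory holds an alternating tree of height `h` together with one more column, which is
neither marked nor followed by a row yet. -/
structure HalfGrownTree (n k h : ℕ) (c : ℕ → ℕ → ℝ) (σ : Mem) : Prop
    extends SolvedRows n k c σ where
  height_lt : h < n
  tree : TightTree n k h (h + 1) c σ.rowDual σ.colDual (σ.nat Reg.treeRow) (σ.nat Reg.treeCol)
    (σ.nat Reg.treeParent)
  matched : ∀ a, 1 ≤ a → a ≤ h → σ.nat Reg.rowMatch (σ.nat Reg.treeRow a) = σ.nat Reg.treeCol a
  marks : Marks n h (σ.nat Reg.treeRow) (σ.nat Reg.treeCol) (σ.nat Reg.rowMark)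
    (σ.nat Reg.colMark)

/-- The state after `h` iterations of the loop that matches row `k`. -/
def RowState (n k : ℕ) (c : ℕ → ℕ → ℝ) (h : ℕ) (σ : Mem) : Prop :=
  σ.nat Reg.done 0 = 0 ∧ GrowingTree n k h c σ ∨ σ.nat Reg.done 0 = 1 ∧ SolvedRows n (k + 1) c σ

variable {B : ℕ} {O : Oracle} {n k h : ℕ} {c : ℕ → ℕ → ℝ} {σ τ : Mem}

@[simp] theorem Mem.writeNat_rowDual (a i x : ℕ) : (σ.writeNat a i x).rowDual = σ.rowDual := rfl

@[simp] theorem Mem.writeNat_colDual (a i x : ℕ) : (σ.writeNat a i x).colDual = σ.colDual := rfl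

theorem SolvedRows.congr (hσ : SolvedRows n k c σ) (hu : τ.rowDual = σ.rowDual)
    (hv : τ.colDual = σ.colDual) (hf : τ.nat Reg.rowMatch = σ.nat Reg.rowMatch) :
    SolvedRows n k c τ :=
  ⟨by simpa only [hu, hv] using hσ.feasible, by simpa only [hu, hv, hf] using hσ.matching⟩

theorem Marks.update_col {s t inS inT : ℕ → ℕ} (hm : Marks n h s t inS inT) (j : ℕ) :
    Marks n h s (Function.update t (h + 1) j) inS inT := by
  refine ⟨hm.rows, fun j' hj' => (hm.cols j' hj').trans (exists_congr fun a => ?_)⟩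
  refine and_congr_right fun _ => and_congr_right fun ha => ?_
  rw [Function.update_of_ne (by lia)]

theorem GrowingTree.addColumn (hσ : GrowingTree n k h c σ) (hkn : k < n)
    (hc : σ.real Reg.costs = c) {i j : ℕ} {δ : ℝ} (hi : i ≤ h) (hj : j < n)
    (hjT : σ.nat Reg.colMark j = 0) (hδ : δ = σ.slack (i, j))
    (hmin : ∀ a ≤ h, ∀ j < n, σ.nat Reg.colMark j = 0 → δ ≤ σ.slack (a, j))
    (hu : τ.rowDual = shiftMarked n δ (σ.nat Reg.rowMark) σ.rowDual)
    (hv : τ.colDual = shiftMarked n (-δ) (σ.nat Reg.colMark) σ.colDual)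
    (hcol : τ.nat Reg.treeCol = Function.update (σ.nat Reg.treeCol) (h + 1) j)
    (hpar : τ.nat Reg.treeParent = Function.update (σ.nat Reg.treeParent) (h + 1) i)
    (hframe : ∀ a ∈ [Reg.rowMatch, Reg.treeRow, Reg.rowMark, Reg.colMark], τ.nat a = σ.nat a) :
    HalfGrownTree n k h c τ := by
  simp only [Mem.slack, hc] at hδ hmin
  simp only [List.forall_mem_cons, List.not_mem_nil] at hframe
  obtain ⟨hf, hrow, hrowMark, hcolMark, -⟩ := hframe
  have hδ0 : 0 ≤ δ := by
    have := hσ.feasible _ ((hσ.tree.row_le hi).trans_lt hkn) j hj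
    linarith
  refine ⟨⟨?_, ?_⟩, hσ.tree.height_le.trans_lt hkn, ?_, fun a ha hah => ?_, ?_⟩
  · rw [hu, hv]
    exact hσ.feasible.shiftMarked hσ.marks hmin hδ0
  · rw [hu, hv, hf]
    exact hσ.matching.shiftMarked δ hσ.tree hσ.marks hkn.le
  · rw [hu, hv, hrow, hcol, hpar]
    exact hσ.tree.addColumn_shiftMarked hσ.marks hkn hi hj hjT hδ
  · rw [hf, hrow, hcol, Function.update_of_ne (by lia)]
    exact hσ.tree.matched a ha hah
  · rw [hrow, hcol, hrowMark, hcolMark]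
    exact hσ.marks.update_col j

theorem wp_addColumn (hn : σ.nat Reg.size 0 = n) (hB : n ≤ B) (hkn : k < n)
    (hh : σ.nat Reg.height 0 = h) (hc : σ.real Reg.costs = c) (hσ : GrowingTree n k h c σ) :
    Wp B O addColumn σ fun τ =>
      HalfGrownTree n k h c τ ∧ τ.nat Reg.treeCol (h + 1) = τ.nat Reg.bestCol 0 := by
  have hhk := hσ.tree.height_le
  refine wp_seq ((wp_findLeastSlack hn hB (by lia) (hσ.tree.exists_unmarked hσ.marks hkn)).conseq
    fun τ₁ hF₁ ⟨hi, hj, hjT, hδ, hmin⟩ => ?_)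
  refine wp_seq ((wp_updateDuals (n := n) (by simpa +decide [hF₁.nat] using hn) hB rfl).conseq
    fun τ₂ hF₂ ⟨hu, hv⟩ => wp_seq (wp_setNat (wp_setNat ?_)))
  have hu₁ : τ₁.rowDual = σ.rowDual := by simp +decide [funext_iff, Mem.rowDual, hF₁.real]
  have hv₁ : τ₁.colDual = σ.colDual := by simp +decide [funext_iff, Mem.colDual, hF₁.real]
  rw [hu₁, hF₁.nat Reg.rowMark (by decide)] at hu
  rw [hv₁, hF₁.nat Reg.colMark (by decide)] at hv
  rw [hh] at hi hmin
  refine ⟨hσ.addColumn hkn hc hi hj hjT hδ hmin hu hv ?_ ?_ ?_, ?_⟩ <;>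
    simp +decide [hF₁.nat, hF₂.nat, hh]

theorem wp_searchRow {j : ℕ} (hk : σ.nat Reg.curRow 0 = k) (hB : k ≤ B)
    (hh : σ.nat Reg.height 0 = h) (hj : σ.nat Reg.bestCol 0 = j) :
    Wp B O searchRow σ fun τ =>
      (τ.nat Reg.colMatched 0 = 0 ∧ (∀ r < k, σ.nat Reg.rowMatch r ≠ j) ∧
        τ.nat Reg.treeRow = σ.nat Reg.treeRow) ∨
      (τ.nat Reg.colMatched 0 = 1 ∧ ∃ r < k, σ.nat Reg.rowMatch r = j ∧
        τ.nat Reg.treeRow = Function.update (σ.nat Reg.treeRow) (h + 1) r) := by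
  refine wp_seq (wp_setNat (wp_forLoop k (fun m τ =>
      (τ.nat Reg.colMatched 0 = 0 ∧ (∀ r < m, σ.nat Reg.rowMatch r ≠ j) ∧
        τ.nat Reg.treeRow = σ.nat Reg.treeRow) ∨
      (τ.nat Reg.colMatched 0 = 1 ∧ ∃ r < m, σ.nat Reg.rowMatch r = j ∧
        τ.nat Reg.treeRow = Function.update (σ.nat Reg.treeRow) (h + 1) r)) hB (by decide)
    (fun τ hF => ?_) (by simp) (fun m _ τ hF hi hI => ?_) (fun τ _ hI => hI)))
  · simpa +decide [hF.nat] using hk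
  · have hmatch : τ.nat Reg.rowMatch = σ.nat Reg.rowMatch := by simp +decide [hF.nat]
    have hcol : τ.nat Reg.bestCol 0 = j := by simpa +decide [hF.nat] using hj
    have hheight : τ.nat Reg.height 0 = h := by simpa +decide [hF.nat] using hh
    refine wp_ite (fun ht => wp_seq (wp_setNat (wp_setNat (.inr ?_)))) (fun ht => wp_skip ?_) <;>
      simp only [Test.holds, NExp.eval, hi, hmatch, hcol] at ht
    · refine ⟨by simp, m, m.lt_succ_self, le_antisymm ht.1 ht.2, ?_⟩
      rcases hI with ⟨-, -, hrow⟩ | ⟨-, r, -, -, hrow⟩ <;> simp [hi, hheight, hrow]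
    · rcases hI with ⟨hfound, hne, hrow⟩ | ⟨hfound, r, hr, hrj, hrow⟩
      · refine .inl ⟨by simpa using hfound, fun r hr => ?_, by simpa using hrow⟩
        rcases Nat.lt_succ_iff_lt_or_eq.1 hr with hr | rfl
        · exact hne r hr
        · lia
      · exact .inr ⟨by simpa using hfound, r, by lia, hrj, by simpa using hrow⟩

theorem HalfGrownTree.augmenting (hσ : HalfGrownTree n k h c σ)
    (hfree : ∀ i < k, σ.nat Reg.rowMatch i ≠ σ.nat Reg.treeCol (h + 1)) :
    Augmenting n k (h + 1) c σ.rowDual σ.colDual (σ.nat Reg.rowMatch) (σ.nat Reg.treeRow)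
      (σ.nat Reg.treeCol) :=
  ⟨by simpa using hσ.matching, fun a ha hah => hσ.matched a ha (Nat.le_of_lt_succ hah),
    fun _ => hfree⟩

theorem wp_augment (hn : σ.nat Reg.size 0 = n) (hB : n + 1 ≤ B) (hh : σ.nat Reg.height 0 = h)
    (hσ : HalfGrownTree n k h c σ)
    (hfree : ∀ i < k, σ.nat Reg.rowMatch i ≠ σ.nat Reg.treeCol (h + 1)) :
    Wp B O augment σ (SolvedRows n (k + 1) c) := by
  have hhn := hσ.height_lt
  refine wp_seq (wp_setNat (wp_forLoop (n + 1) (fun m τ =>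
      Augmenting n k (τ.nat Reg.pathPos 0) c σ.rowDual σ.colDual (τ.nat Reg.rowMatch)
        (σ.nat Reg.treeRow) (σ.nat Reg.treeCol) ∧
      (τ.nat Reg.pathPos 0 = 0 ∨ τ.nat Reg.pathPos 0 + m ≤ h + 1)) hB (by decide)
    (fun τ hF => ?_) ?_ (fun m _ τ hF _ hI => ?_) (fun τ hF ⟨hI, hle⟩ => ?_)))
  · simpa +decide [hF.nat] using hn
  · simpa [hh] using hσ.augmenting hfree
  · have hrow : τ.nat Reg.treeRow = σ.nat Reg.treeRow := by simp +decide [hF.nat]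
    have hcol : τ.nat Reg.treeCol = σ.nat Reg.treeCol := by simp +decide [hF.nat]
    have hpar : τ.nat Reg.treeParent = σ.nat Reg.treeParent := by simp +decide [hF.nat]
    obtain ⟨hI, hle⟩ := hI
    refine wp_ite (fun ht => wp_seq (wp_setNat (wp_setNat ?_))) (fun ht => wp_skip ?_) <;>
      simp only [Test.holds, NExp.eval] at ht
    · have hx : τ.nat Reg.pathPos 0 ≤ h + 1 := by lia
      have hstep := hI.step hσ.tree ht hx
      have hlt := hσ.tree.parent_lt _ ht hx
      simp only [NExp.eval, Mem.writeNat_nat, hrow, hcol, hpar]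
      exact ⟨by simpa using hstep, .inr (by simp; lia)⟩
    · exact ⟨by simpa using hI, .inl (by simp; lia)⟩
  · have hu : τ.rowDual = σ.rowDual := by simp +decide [funext_iff, Mem.rowDual, hF.real]
    have hv : τ.colDual = σ.colDual := by simp +decide [funext_iff, Mem.colDual, hF.real]
    have hpos : τ.nat Reg.pathPos 0 = 0 := hle.resolve_right (by lia)
    have hmatching := hI.matching
    rw [if_pos hpos] at hmatching
    exact ⟨hu ▸ hv ▸ hσ.feasible, hu ▸ hv ▸ hmatching⟩

theorem HalfGrownTree.addRow (hσ : HalfGrownTree n k h c σ) {r : ℕ} (hr : r < k)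
    (hfr : σ.nat Reg.rowMatch r = σ.nat Reg.treeCol (h + 1))
    (hreal : τ.real = σ.real)
    (hrow : τ.nat Reg.treeRow = Function.update (σ.nat Reg.treeRow) (h + 1) r)
    (hrowMark : τ.nat Reg.rowMark = Function.update (σ.nat Reg.rowMark) r 1)
    (hcolMark : τ.nat Reg.colMark =
      Function.update (σ.nat Reg.colMark) (σ.nat Reg.treeCol (h + 1)) 1)
    (hframe : ∀ a ∈ [Reg.rowMatch, Reg.treeCol, Reg.treeParent], τ.nat a = σ.nat a) :
    GrowingTree n k (h + 1) c τ := by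
  simp only [List.forall_mem_cons, List.not_mem_nil] at hframe
  obtain ⟨hf, hcol, hpar, -⟩ := hframe
  have hu : τ.rowDual = σ.rowDual := funext fun i => by rw [Mem.rowDual, Mem.rowDual, hreal]
  have hv : τ.colDual = σ.colDual := funext fun i => by rw [Mem.colDual, Mem.colDual, hreal]
  refine ⟨hσ.congr hu hv hf, ?_, ?_⟩
  · rw [hu, hv, hf, hrow, hcol, hpar]
    exact hσ.tree.addRow hσ.matched hr hfr
  · rw [hrow, hcol, hrowMark, hcolMark]
    exact hσ.marks.addRow

theorem HalfGrownTree.frame_searchRow (hσ : HalfGrownTree n k h c σ)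
    (hF : Frame searchRow σ τ) (hrow : τ.nat Reg.treeRow = σ.nat Reg.treeRow) :
    HalfGrownTree n k h c τ := by
  have hu : τ.rowDual = σ.rowDual := by simp +decide [funext_iff, Mem.rowDual, hF.real]
  have hv : τ.colDual = σ.colDual := by simp +decide [funext_iff, Mem.colDual, hF.real]
  have hf : τ.nat Reg.rowMatch = σ.nat Reg.rowMatch := hF.nat _ (by decide)
  have hcol : τ.nat Reg.treeCol = σ.nat Reg.treeCol := hF.nat _ (by decide)
  refine ⟨hσ.congr hu hv hf, hσ.height_lt, ?_, ?_, ?_⟩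
  · rw [hu, hv, hrow, hcol, hF.nat Reg.treeParent (by decide)]
    exact hσ.tree
  · rw [hf, hrow, hcol]
    exact hσ.matched
  · rw [hrow, hcol, hF.nat Reg.rowMark (by decide), hF.nat Reg.colMark (by decide)]
    exact hσ.marks

theorem wp_markLast (hh : σ.nat Reg.height 0 = h) (hτ : HalfGrownTree n k h c τ)
    (hF : Frame searchRow τ σ) {r : ℕ} (hr : r < k)
    (hfr : τ.nat Reg.rowMatch r = τ.nat Reg.treeCol (h + 1))
    (hrow : σ.nat Reg.treeRow = Function.update (τ.nat Reg.treeRow) (h + 1) r) :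
    Wp B O markLast σ (GrowingTree n k (h + 1) c) := by
  refine wp_seq (wp_setNat (wp_setNat ?_))
  refine hτ.addRow hr hfr ?_ ?_ ?_ ?_ ?_
  · exact funext fun a => hF.real a (by simp [searchRow, Prog.realWrites])
  · simpa using hrow
  · simp +decide [hF.nat, hh, hrow]
  · simp +decide [hF.nat, hh]
  · simp +decide [hF.nat]

theorem wp_treeStep (hn : σ.nat Reg.size 0 = n) (hB : n + 1 ≤ B) (hk : σ.nat Reg.curRow 0 = k)
    (hkn : k < n) (hh : σ.nat Reg.height 0 = h) (hc : σ.real Reg.costs = c)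
    (hdone : σ.nat Reg.done 0 = 0) (hσ : GrowingTree n k h c σ) :
    Wp B O treeStep σ (RowState n k c (h + 1)) := by
  refine wp_seq ((wp_addColumn hn (by lia) hkn hh hc hσ).conseq fun τ₁ hF₁ ⟨hτ₁, hcol⟩ => ?_)
  have hh₁ : τ₁.nat Reg.height 0 = h := by simpa +decide [hF₁.nat] using hh
  refine wp_seq ((wp_searchRow (k := k) (by simpa +decide [hF₁.nat] using hk) (by lia) hh₁
    hcol.symm).conseq fun τ₂ hF₂ hsearch => ?_)
  have hh₂ : τ₂.nat Reg.height 0 = h := by simpa +decide [hF₂.nat] using hh₁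
  refine wp_ite (fun ht => ?_) (fun ht => wp_seq ?_)
  · obtain ⟨hfound, -⟩ | ⟨-, r, hr, hfr, hrow⟩ := hsearch
    · simp [hfound] at ht
    · refine (wp_markLast hh₂ hτ₁ hF₂ hr hfr hrow).conseq fun τ₃ hF₃ hτ₃ => .inl ⟨?_, hτ₃⟩
      simpa +decide [hF₁.nat, hF₂.nat, hF₃.nat] using hdone
  · obtain ⟨-, hfree, hrow⟩ | ⟨hfound, -⟩ := hsearch
    · refine (wp_augment (n := n) (by simpa +decide [hF₁.nat, hF₂.nat] using hn) hB hh₂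
        (hτ₁.frame_searchRow hF₂ hrow) ?_).conseq fun τ₃ _ hτ₃ => wp_setNat (.inr ⟨by simp, ?_⟩)
      · simpa +decide [hF₂.nat] using hfree
      · exact hτ₃.congr rfl rfl (by simp)
    · simp [hfound] at ht

theorem RowState.writeNat_height (hσ : RowState n k c h σ) (x : ℕ) :
    RowState n k c h (σ.writeNat Reg.height 0 x) := by
  obtain ⟨hdone, hσ⟩ | ⟨hdone, hσ⟩ := hσ
  · refine .inl ⟨by simpa using hdone, hσ.congr rfl rfl (by simp), ?_, ?_⟩
    · simpa using hσ.tree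
    · simpa using hσ.marks
  · exact .inr ⟨by simpa using hdone, hσ.congr rfl rfl (by simp)⟩

theorem SolvedRows.growingTree_zero (hσ : SolvedRows n k c σ) (hroot : σ.nat Reg.treeRow 0 = k)
    (hrowMark : ∀ i < n, σ.nat Reg.rowMark i = if i = k then 1 else 0)
    (hcolMark : ∀ j < n, σ.nat Reg.colMark j = 0) : GrowingTree n k 0 c σ := by
  refine ⟨hσ, ⟨⟨hroot, ?_, ?_, ?_, ?_, ?_⟩, ?_⟩, fun i hi => ?_, fun j hj => ?_⟩
  all_goals try exact fun a h₁ h₀ => by lia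
  · rw [hrowMark i hi]
    split_ifs with hik
    · simp [hik, hroot]
    · simp [hroot, Ne.symm hik]
  · simp [hcolMark j hj]

theorem wp_matchRow (hn : σ.nat Reg.size 0 = n) (hB : n + 1 ≤ B) (hk : σ.nat Reg.curRow 0 = k)
    (hkn : k < n) (hc : σ.real Reg.costs = c) (hσ : SolvedRows n k c σ) :
    Wp B O matchRow σ (SolvedRows n (k + 1) c) := by
  refine wp_seq ((wp_initTree hn (by lia)).conseq fun τ₁ hF₁ ⟨hrow, hcol, hroot, hdone⟩ => ?_)
  rw [hk] at hrow hroot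
  have hσ₁ : SolvedRows n k c τ₁ :=
    hσ.congr (by simp +decide [funext_iff, Mem.rowDual, hF₁.real])
      (by simp +decide [funext_iff, Mem.colDual, hF₁.real]) (hF₁.nat _ (by decide))
  refine wp_forLoop n (RowState n k c) (by lia) (by decide) (fun τ hF => ?_) ?_
    (fun h _ τ hF hh hI => ?_) (fun τ _ hI => ?_)
  · simpa +decide [hF.nat, hF₁.nat] using hn
  · exact RowState.writeNat_height (.inl ⟨hdone, hσ₁.growingTree_zero hroot hrow hcol⟩) _
  · refine wp_ite (fun ht => ?_) (fun ht => wp_skip ?_) <;>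
      simp only [Test.holds, NExp.eval, nonpos_iff_eq_zero] at ht
    · obtain ⟨-, hτ⟩ | ⟨hdone, -⟩ := hI
      · refine (wp_treeStep (n := n) (c := c) (by simpa +decide [hF.nat, hF₁.nat] using hn) hB
          (by simpa +decide [hF.nat, hF₁.nat] using hk) hkn hh
          (by simpa +decide [hF.real, hF₁.real] using hc) ht hτ).conseq fun τ' _ hτ' => ?_
        exact hτ'.writeNat_height _
      · simp [ht] at hdone
    · obtain ⟨hdone, -⟩ | hτ := hI
      · exact absurd hdone ht
      · refine RowState.writeNat_height (.inr hτ) _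
  · obtain ⟨-, hτ⟩ | ⟨-, hτ⟩ := hI
    · exact absurd hτ.tree.height_le hkn.not_ge
    · exact hτ

theorem wp_hungarian (hn : σ.nat Reg.size 0 = n) (hB : n + 1 ≤ B)
    (hpos : ∀ i < n, ∀ j < n, 0 ≤ σ.real Reg.costs i j) :
    Wp B O hungarian σ fun τ => ∃ π : Equiv.Perm (Fin n),
      (∀ i : Fin n, τ.nat Reg.rowMatch i = π i) ∧
      ∀ π' : Equiv.Perm (Fin n),
        ∑ i : Fin n, σ.real Reg.costs i (π i) ≤ ∑ i : Fin n, σ.real Reg.costs i (π' i) := by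
  refine wp_seq (wp_forLoop n (fun m τ => ∀ i < m, τ.rowDual i = 0 ∧ τ.colDual i = 0)
    (by lia) (by decide) (fun τ hF => ?_) (by simp) (fun m _ τ _ hi hI => ?_)
    (fun τ₁ hF₁ hI => ?_))
  · simpa +decide [hF.nat] using hn
  · refine wp_seq (wp_setReal (wp_setReal fun i him => ?_))
    rcases Nat.lt_succ_iff_lt_or_eq.1 him with him | rfl
    · simpa [Mem.rowDual, Mem.colDual, hi, him.ne] using hI i him
    · simp [Mem.rowDual, Mem.colDual, hi]
  · refine wp_forLoop n (fun k => SolvedRows n k (σ.real Reg.costs)) (by lia) (by decide)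
      (fun τ hF => ?_) ⟨fun i hi j hj => ?_, ?_⟩ (fun k hk τ hF hrow hτ => ?_)
      (fun τ _ hτ => hτ.matching.exists_perm_forall_sum_le hτ.feasible)
    · simpa +decide [hF.nat, hF₁.nat] using hn
    · have huv : τ₁.rowDual i + τ₁.colDual j = 0 := by rw [(hI i hi).1, (hI j hj).2, add_zero]
      exact huv.trans_le (hpos i hi j hj)
    · exact ⟨by simp, by simp, by simp⟩
    · refine (wp_matchRow (n := n) (by simpa +decide [hF.nat, hF₁.nat] using hn) hB hrow hk
        (by simp +decide [hF.real, hF₁.real]) hτ).conseq fun τ' _ hτ' => ?_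
      exact hτ'.congr rfl rfl (by simp)

end HungarianCorrectness

end RealRAM

/-! ### Computing the candidates -/

namespace PointsToLines

/-- The candidate of sign `s` for an iteration of Align. For parallel lines `a.2` and `b.2` the
third pair is ignored and the point of `b` is itself brought as close as possible to its line. -/
def alignCandidate (a b c : Point × Line) (s : ℤˣ) : RigidMotion :=
  candidate a b (if det a.2.normal b.2.normal = 0 then b else c) s

end PointsToLines

namespace RealRAM

open PointsToLines

/-- A pair of expressions for the coordinates of a point. The operations mirror those on points. -/
structure VecExp where
  fst : RExp
  snd : RExp

namespace VecExp

/-- The point given by the values of the two coordinates. -/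
def eval (O : Oracle) (σ : Mem) (e : VecExp) : Point := !₂[e.fst.eval O σ, e.snd.eval O σ]

def const (k l : ℕ) : VecExp := ⟨.const k, .const l⟩

def add (e f : VecExp) : VecExp := ⟨.add e.fst f.fst, .add e.snd f.snd⟩

def sub (e f : VecExp) : VecExp := ⟨.sub e.fst f.fst, .sub e.snd f.snd⟩

def smul (c : RExp) (e : VecExp) : VecExp := ⟨.mul c e.fst, .mul c e.snd⟩

def perp (e : VecExp) : VecExp := ⟨.sub (.const 0) e.snd, e.fst⟩

def rotate (e f : VecExp) : VecExp := add (smul e.fst f) (smul e.snd f.perp)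

def dot (e f : VecExp) : RExp := .add (.mul e.fst f.fst) (.mul e.snd f.snd)

def det (e f : VecExp) : RExp := dot e.perp f

variable {O : Oracle} {σ : Mem}

@[simp] theorem eval_zero (e : VecExp) : e.eval O σ 0 = e.fst.eval O σ := rfl

@[simp] theorem eval_one (e : VecExp) : e.eval O σ 1 = e.snd.eval O σ := rfl

@[simp] theorem eval_const (k l : ℕ) : (const k l).eval O σ = !₂[(k : ℝ), (l : ℝ)] := rfl

@[simp] theorem eval_add (e f : VecExp) : (add e f).eval O σ = e.eval O σ + f.eval O σ :=
  Point.ext rfl rfl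

@[simp] theorem eval_sub (e f : VecExp) : (sub e f).eval O σ = e.eval O σ - f.eval O σ :=
  Point.ext rfl rfl

@[simp] theorem eval_smul (c : RExp) (e : VecExp) :
    (smul c e).eval O σ = c.eval O σ • e.eval O σ :=
  Point.ext rfl rfl

@[simp] theorem eval_perp (e : VecExp) : e.perp.eval O σ = PointsToLines.perp (e.eval O σ) :=
  Point.ext (by simp [perp]) (by simp [perp])

@[simp] theorem eval_rotate (e f : VecExp) :
    (rotate e f).eval O σ = PointsToLines.rotate (e.eval O σ) (f.eval O σ) := by
  simp [rotate, PointsToLines.rotate]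

@[simp] theorem eval_dot (e f : VecExp) :
    (dot e f).eval O σ = inner ℝ (e.eval O σ) (f.eval O σ) :=
  (inner_eq_coords (e.eval O σ) (f.eval O σ)).symm

@[simp] theorem eval_det (e f : VecExp) :
    (det e f).eval O σ = PointsToLines.det (e.eval O σ) (f.eval O σ) := by
  simp [det, PointsToLines.det]

end VecExp

variable {O : Oracle} {σ : Mem}

def RExp.abs (e : RExp) : RExp := .sqrt (.mul e e)

@[simp] theorem RExp.eval_abs (e : RExp) : e.abs.eval O σ = |e.eval O σ| :=
  Real.sqrt_mul_self_eq_abs _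

def RExp.max (e f : RExp) : RExp := .div (.add (.add e f) (.abs (.sub f e))) (.const 2)

@[simp] theorem RExp.eval_max (e f : RExp) :
    (e.max f).eval O σ = Max.max (e.eval O σ) (f.eval O σ) := by
  simp [RExp.max, sup_eq_half_smul_add_add_abs_sub ℝ, div_eq_inv_mul]

def RExp.min (e f : RExp) : RExp := .div (.sub (.add e f) (.abs (.sub f e))) (.const 2)

@[simp] theorem RExp.eval_min (e f : RExp) :
    (e.min f).eval O σ = Min.min (e.eval O σ) (f.eval O σ) := by
  simp [RExp.min, inf_eq_half_smul_add_sub_abs_sub ℝ, div_eq_inv_mul]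

def signExp (s : ℤˣ) : RExp := if s = 1 then .const 1 else .sub (.const 0) (.const 1)

@[simp] theorem eval_signExp (s : ℤˣ) : (signExp s).eval O σ = s := by
  rcases Int.units_eq_one_or s with rfl | rfl <;> simp [signExp]

def VecExp.norm (e : VecExp) : RExp := .sqrt (e.dot e)

@[simp] theorem VecExp.eval_norm (e : VecExp) : e.norm.eval O σ = ‖e.eval O σ‖ := by
  simp [norm]

/-- The expression for `clampedLevel`. -/
def clampedLevelExp (a : VecExp) (c : RExp) : RExp :=
  .max (.sub (.const 0) a.norm) (.min a.norm c)

@[simp] theorem eval_clampedLevelExp (a : VecExp) (c : RExp) :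
    (clampedLevelExp a c).eval O σ = clampedLevel (a.eval O σ) (c.eval O σ) := by
  simp [clampedLevelExp, clampedLevel]

/-- The expression for `circlePt` in the case `a ≠ 0`. -/
def circleExp (s : ℤˣ) (a : VecExp) (c : RExp) : VecExp :=
  .smul (.div (.const 1) (a.dot a))
    (.add (.smul (clampedLevelExp a c) a)
      (.smul (.mul (signExp s)
        (.sqrt (.sub (a.dot a) (.mul (clampedLevelExp a c) (clampedLevelExp a c))))) a.perp))

theorem eval_circleExp (s : ℤˣ) {a : VecExp} (ha : a.eval O σ ≠ 0) (c : RExp) :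
    (circleExp s a c).eval O σ = circlePt s (a.eval O σ) (c.eval O σ) := by
  simp [circleExp, circlePt, ha, pow_two]

/-- Expressions for a point and a line. -/
structure PairExp where
  point : VecExp
  normal : VecExp
  offset : RExp

namespace PairExp

/-- The expressions evaluate to the pair `x`. -/
structure Denotes (O : Oracle) (σ : Mem) (a : PairExp) (x : Point × Line) : Prop where
  point : a.point.eval O σ = x.1
  normal : a.normal.eval O σ = x.2.normal
  offset : a.offset.eval O σ = x.2.offset

/-- The expression for `Line.residual`. -/
def residual (a : PairExp) (q : VecExp) : RExp := .sub (a.normal.dot q) a.offset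

/-- The expression for `Line.foot`. -/
def foot (a : PairExp) : VecExp := .smul (.div a.offset (a.normal.dot a.normal)) a.normal

variable {a : PairExp} {x : Point × Line}

theorem Denotes.eval_residual (ha : a.Denotes O σ x) (q : VecExp) :
    (a.residual q).eval O σ = x.2.residual (q.eval O σ) := by
  simp [residual, Line.residual, ha.normal, ha.offset]

theorem Denotes.eval_foot (ha : a.Denotes O σ x) : a.foot.eval O σ = x.2.foot := by
  simp [foot, Line.foot, ha.normal, ha.offset]

end PairExp

/-- The translation `feasibleShift` in the case of parallel lines. -/
def parallelShift (a : PairExp) (u : VecExp) : VecExp := (u.rotate a.point).sub a.foot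

/-- The translation `feasibleShift` in the case of crossing lines. -/
def crossingShift (a b : PairExp) (u : VecExp) : VecExp :=
  .smul (.div (.const 1) (a.normal.det b.normal))
    ((a.normal.perp.smul (b.residual (u.rotate b.point))).sub
      (b.normal.perp.smul (a.residual (u.rotate a.point))))

/-- The expression for `feasibleGap`, where `shift` is the one for `feasibleShift`. -/
def gapExp (shift : VecExp → VecExp) (c : PairExp) (u : VecExp) : RExp :=
  c.residual ((u.rotate c.point).sub (shift u))

/-- The expression for `gapSlope`. -/
def slopeExp (shift : VecExp → VecExp) (c : PairExp) : VecExp where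
  fst := .sub (gapExp shift c (.const 1 0)) (gapExp shift c (.const 0 0))
  snd := .sub (gapExp shift c (.const 0 1)) (gapExp shift c (.const 0 0))

/-- The expression for `gapLevel`. -/
def levelExp (shift : VecExp → VecExp) (c : PairExp) : RExp :=
  .sub (.const 0) (gapExp shift c (.const 0 0))

section

variable {a b c : PairExp} {x y w : Point × Line}

theorem eval_parallelShift (ha : a.Denotes O σ x) (hdet : det x.2.normal y.2.normal = 0)
    (u : VecExp) : (parallelShift a u).eval O σ = feasibleShift x y (u.eval O σ) := by
  simp [parallelShift, feasibleShift, hdet, ha.eval_foot, ha.point]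

theorem eval_crossingShift (ha : a.Denotes O σ x) (hb : b.Denotes O σ y)
    (hdet : det x.2.normal y.2.normal ≠ 0) (u : VecExp) :
    (crossingShift a b u).eval O σ = feasibleShift x y (u.eval O σ) := by
  simp [crossingShift, feasibleShift, cramerPoint, hdet, ha.eval_residual, hb.eval_residual,
    ha.point, hb.point, ha.normal, hb.normal]

/-- The expressions evaluate to the data from which `candidate x y w` is computed. -/
structure DenotesCandidate (O : Oracle) (σ : Mem) (shift : VecExp → VecExp) (c : PairExp)
    (x y w : Point × Line) : Prop where
  shift : ∀ u, (shift u).eval O σ = feasibleShift x y (u.eval O σ)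
  pair : c.Denotes O σ w

variable {shift : VecExp → VecExp}

theorem DenotesCandidate.eval_gapExp (h : DenotesCandidate O σ shift c x y w) (u : VecExp) :
    (gapExp shift c u).eval O σ = feasibleGap x y w (u.eval O σ) := by
  simp [gapExp, feasibleGap, h.pair.eval_residual, h.pair.point, h.shift]

theorem DenotesCandidate.eval_slopeExp (h : DenotesCandidate O σ shift c x y w) :
    (slopeExp shift c).eval O σ = gapSlope x y w := by
  have hzero : (!₂[0, 0] : Point) = 0 := Point.ext rfl rfl
  apply Point.ext <;> simp [slopeExp, gapSlope, h.eval_gapExp, hzero]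

theorem DenotesCandidate.eval_levelExp (h : DenotesCandidate O σ shift c x y w) :
    (levelExp shift c).eval O σ = gapLevel x y w := by
  have hzero : (!₂[0, 0] : Point) = 0 := Point.ext rfl rfl
  simp [levelExp, gapLevel, h.eval_gapExp, hzero]

/-- The array `arr` holds the alignment `g`, in the format of `HoldsOutput`. -/
def HoldsMotion (arr : ℕ) (g : RigidMotion) (σ : Mem) : Prop :=
  (∀ i j : Fin 2, σ.real arr i j = (g.1 : Matrix (Fin 2) (Fin 2) ℝ) i j) ∧
  ∀ j : Fin 2, σ.real arr 2 j = g.2 j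

/-- Stores the alignment whose rotation turns `(1, 0)` to `u` and whose translation is `t`. -/
def storeMotion (u t : VecExp) : Prog :=
  .seq (.setReal Reg.motion (.const 0) (.const 0) u.fst)
  (.seq (.setReal Reg.motion (.const 0) (.const 1) (.sub (.const 0) u.snd))
  (.seq (.setReal Reg.motion (.const 1) (.const 0) u.snd)
  (.seq (.setReal Reg.motion (.const 1) (.const 1) u.fst)
  (.seq (.setReal Reg.motion (.const 2) (.const 0) t.fst)
    (.setReal Reg.motion (.const 2) (.const 1) t.snd)))))

/-- The test `e = 0`. -/
def isZero (e : RExp) : Test := .and (.realLe e (.const 0)) (.realLe (.const 0) e)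

theorem isZero_holds {e : RExp} : (isZero e).holds O σ ↔ e.eval O σ = 0 := by
  simp [isZero, le_antisymm_iff]

/-- Stores the candidate of sign `s` for the third pair `c`. For a vanishing slope, this is given by
`(1, 0)`, as in `circlePt`. -/
def computeMotion (s : ℤˣ) (shift : VecExp → VecExp) (c : PairExp) : Prog :=
  let e : VecExp := .const 1 0
  let u : VecExp := circleExp s (slopeExp shift c) (levelExp shift c)
  .ite (isZero ((slopeExp shift c).dot (slopeExp shift c)))
    (storeMotion e (shift e)) (storeMotion u (shift u))

variable {B : ℕ}

theorem wp_storeMotion {u t : VecExp} {g : RigidMotion}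
    (hu : ∀ τ, Frame (storeMotion u t) σ τ → u.eval O τ = g.dir)
    (ht : ∀ τ, Frame (storeMotion u t) σ τ → t.eval O τ = g.2) :
    Wp B O (storeMotion u t) σ (HoldsMotion Reg.motion g) := by
  have hset : ∀ {τ : Mem} {i j : ℕ} {e : RExp} {x : ℝ} {Q : Mem → Prop},
      Frame (storeMotion u t) σ τ → e.eval O τ = x →
      (Frame (storeMotion u t) σ (τ.writeReal Reg.motion i j x) →
        Q (τ.writeReal Reg.motion i j x)) →
      Wp B O (.setReal Reg.motion (.const i) (.const j) e) τ Q := by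
    rintro τ i j e _ Q hτ rfl h
    exact wp_setReal
      (h (hτ.trans (frame_writeReal (by simp [storeMotion, Prog.realWrites]) τ i j _)))
  simp only [WithLp.ext_iff, funext_iff, Fin.forall_fin_two, VecExp.eval_zero,
    VecExp.eval_one] at hu ht
  refine wp_seq (hset (.refl _ _) (hu _ (.refl _ _)).1 fun h₁ =>
    wp_seq (hset h₁ (x := -g.dir 1) (by simp [(hu _ h₁).2]) fun h₂ =>
    wp_seq (hset h₂ (hu _ h₂).2 fun h₃ => wp_seq (hset h₃ (hu _ h₃).1 fun h₄ =>
    wp_seq (hset h₄ (ht _ h₄).1 fun h₅ => hset h₅ (ht _ h₅).2 fun _ =>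
    ⟨fun i j => ?_, fun j => ?_⟩)))))
  · rw [g.matrix_eq]
    fin_cases i <;> fin_cases j <;> simp
  · fin_cases j <;> simp

theorem wp_computeMotion {s : ℤˣ}
    (h : ∀ τ, Frame (computeMotion s shift c) σ τ → DenotesCandidate O τ shift c x y w) :
    Wp B O (computeMotion s shift c) σ (HoldsMotion Reg.motion (candidate x y w s)) := by
  have hslope := (h σ (.refl _ _)).eval_slopeExp
  refine wp_ite (fun ht => wp_storeMotion (fun τ hτ => ?_) fun τ hτ => ?_)
    fun ht => wp_storeMotion (fun τ hτ => ?_) fun τ hτ => ?_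
  all_goals
    simp only [isZero_holds, VecExp.eval_dot, inner_self_eq_zero, hslope] at ht
    replace hτ := h τ (hτ.mono (by simp [computeMotion, Prog.natWrites, storeMotion])
      (by simp [computeMotion, Prog.realWrites, storeMotion]))
    have hslope := hτ.eval_slopeExp
    have hlevel := hτ.eval_levelExp
  · simp [candidate, circlePt, ht]
  · rw [hτ.shift]
    change _ = feasibleShift x y (circlePt ..)
    simp [circlePt, ht]
  · rw [eval_circleExp _ (by simpa only [hslope] using ht), hslope, hlevel, candidate,
      RigidMotion.dir_ofDir]
  · rw [hτ.shift, eval_circleExp _ (by simpa only [hslope] using ht), hslope, hlevel]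
    rfl
/-- Stores the alignment `alignCandidate`. -/
def computeCandidate (s : ℤˣ) (a b c : PairExp) : Prog :=
  .ite (isZero (a.normal.det b.normal)) (computeMotion s (parallelShift a) b)
    (computeMotion s (crossingShift a b) c)

theorem wp_computeCandidate {s : ℤˣ}
    (ha : ∀ τ, Frame (computeCandidate s a b c) σ τ → a.Denotes O τ x)
    (hb : ∀ τ, Frame (computeCandidate s a b c) σ τ → b.Denotes O τ y)
    (hc : ∀ τ, Frame (computeCandidate s a b c) σ τ → c.Denotes O τ w) :
    Wp B O (computeCandidate s a b c) σ (HoldsMotion Reg.motion (alignCandidate x y w s)) := by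
  have hdet : (a.normal.det b.normal).eval O σ = det x.2.normal y.2.normal := by
    rw [VecExp.eval_det, (ha σ (.refl _ _)).normal, (hb σ (.refl _ _)).normal]
  refine wp_ite (fun ht => ?_) fun ht => ?_ <;> rw [isZero_holds, hdet] at ht
  · rw [alignCandidate, if_pos ht]
    refine wp_computeMotion fun τ hτ => ?_
    have hF := hτ.mono (P' := computeCandidate s a b c)
      (List.subset_append_left _ _) (List.subset_append_left _ _)
    exact ⟨eval_parallelShift (ha τ hF) ht, hb τ hF⟩
  · rw [alignCandidate, if_neg ht]
    refine wp_computeMotion fun τ hτ => ?_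
    have hF := hτ.mono (P' := computeCandidate s a b c)
      (List.subset_append_right _ _) (List.subset_append_right _ _)
    exact ⟨eval_crossingShift (ha τ hF) (hb τ hF) ht, hc τ hF⟩

end

end RealRAM

/-! ### The program for Align+Match -/

namespace PointsToLines

/-- The alignment and the matching `out` have the least cost among all matchings for the
alignments in `D`. -/
structure IsBest {n : ℕ} (z : ℝ) (lip : ℝ≥0 → ℝ≥0) (A : Fin n → Point × Line)
    (D : Set RigidMotion) (out : RigidMotion × Equiv.Perm (Fin n)) : Prop where
  mem : out.1 ∈ D
  le : ∀ g ∈ D, ∀ π, cost z lip (rematch A out.2) out.1 ≤ cost z lip (rematch A π) g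

variable {n : ℕ} {z : ℝ} {lip : ℝ≥0 → ℝ≥0} {A : Fin n → Point × Line} {D : Set RigidMotion}
  {out : RigidMotion × Equiv.Perm (Fin n)} {g : RigidMotion} {π : Equiv.Perm (Fin n)}

theorem IsBest.insert_of_le (h : IsBest z lip A D out) (hπ : IsOptimalMatching z lip A g π)
    (hle : cost z lip (rematch A out.2) out.1 ≤ cost z lip (rematch A π) g) :
    IsBest z lip A (insert g D) out where
  mem := .inr h.mem
  le := by
    rintro g' (rfl | hg') π'
    · exact hle.trans (hπ π')
    · exact h.le g' hg' π'

theorem IsOptimalMatching.isBest_insert (hπ : IsOptimalMatching z lip A g π)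
    (hle : ∀ g' ∈ D, ∀ π', cost z lip (rematch A π) g ≤ cost z lip (rematch A π') g') :
    IsBest z lip A (insert g D) (g, π) where
  mem := .inl rfl
  le := by
    rintro g' (rfl | hg') π'
    · exact hπ π'
    · exact hle g' hg' π'

theorem coe_cost_rematch : (cost z lip (rematch A π) g : ℝ) =
    ∑ i, (lip (Dz z ((A i).1, (A (π i)).2) g) : ℝ) := by
  rw [cost_eq_sum, NNReal.coe_sum]
  rfl

end PointsToLines

namespace RealRAM

open PointsToLines

/-- The input point of index `p` paired with the input line of index `l`. -/
def pairExp (p l : ℕ) : PairExp where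
  point := ⟨.get Reg.input (nvar p) (.const 0), .get Reg.input (nvar p) (.const 1)⟩
  normal := ⟨.get Reg.input (nvar l) (.const 2), .get Reg.input (nvar l) (.const 3)⟩
  offset := .get Reg.input (nvar l) (.const 4)

/-- The image of the point of `a` under the current alignment. -/
def movedPoint (a : PairExp) : VecExp :=
  (VecExp.rotate ⟨.get Reg.motion (.const 0) (.const 0), .get Reg.motion (.const 1) (.const 0)⟩
    a.point).sub ⟨.get Reg.motion (.const 2) (.const 0), .get Reg.motion (.const 2) (.const 1)⟩

/-- The cost of the pair `a` under the current alignment. -/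
def costExp (a : PairExp) : RExp :=
  .lip (.lineDist (movedPoint a).fst (movedPoint a).snd a.normal.fst a.normal.snd a.offset)

/-- Stores the costs of all pairs under the current alignment. -/
def fillCosts : Prog :=
  forLoop Reg.i (nvar Reg.size) (forLoop Reg.j (nvar Reg.size)
    (.setReal Reg.costs (nvar Reg.i) (nvar Reg.j) (costExp (pairExp Reg.i Reg.j))))

/-- Stores the cost of the current matching. -/
def sumCosts : Prog :=
  .seq (.setReal Reg.curCost (.const 0) (.const 0) (.const 0))
    (forLoop Reg.i (nvar Reg.size)
      (.setReal Reg.curCost (.const 0) (.const 0)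
        (.add (rvar Reg.curCost) (.get Reg.costs (nvar Reg.i) (.get Reg.rowMatch (nvar Reg.i))))))

/-- Computes an optimal matching for the current alignment and its cost. -/
def matchPairs : Prog := .seq fillCosts (.seq hungarian sumCosts)

def copyEntry (i j : ℕ) : Prog :=
  .setReal Reg.outMotion (.const i) (.const j) (.get Reg.motion (.const i) (.const j))

def copyMotion : Prog :=
  .seq (copyEntry 0 0) (.seq (copyEntry 0 1) (.seq (copyEntry 1 0)
    (.seq (copyEntry 1 1) (.seq (copyEntry 2 0) (copyEntry 2 1)))))

/-- Makes the current alignment and matching the output. -/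
def copyOutput : Prog :=
  .seq copyMotion
  (.seq (.setReal Reg.bestCost (.const 0) (.const 0) (rvar Reg.curCost))
  (.seq (.setNat Reg.seen (.const 0) (.const 1))
    (forLoop Reg.i (nvar Reg.size)
      (.setNat Reg.outPerm (nvar Reg.i) (.get Reg.rowMatch (nvar Reg.i))))))

/-- Replaces the output by the current alignment and matching if they are the first or better. -/
def keepBest : Prog :=
  .ite (.and (.natLe (.const 1) (nvar Reg.seen)) (.realLe (rvar Reg.bestCost) (rvar Reg.curCost)))
    .skip copyOutput

/-- Processes the candidate of sign `s` for the current triple of points and lines. -/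
def processCandidate (s : ℤˣ) : Prog :=
  .seq (computeCandidate s (pairExp Reg.point₁ Reg.line₁) (pairExp Reg.point₂ Reg.line₂)
    (pairExp Reg.point₃ Reg.line₃)) (.seq matchPairs keepBest)

/-- Processes both candidates for the current triple of points and lines. -/
def processTuple : Prog := .seq (processCandidate 1) (processCandidate (-1))

/-- The program for Align+Match. -/
def alignMatch : Prog :=
  forLoop Reg.point₁ (nvar Reg.size) (forLoop Reg.point₂ (nvar Reg.size)
  (forLoop Reg.point₃ (nvar Reg.size) (forLoop Reg.line₁ (nvar Reg.size)
  (forLoop Reg.line₂ (nvar Reg.size) (forLoop Reg.line₃ (nvar Reg.size) processTuple)))))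

variable {B : ℕ} {O : Oracle} {n : ℕ} {A : Fin n → Point × Line} {σ : Mem} {g : RigidMotion}
  {π : Equiv.Perm (Fin n)}

/-- The memory holds the input `A`. -/
structure HoldsInput (A : Fin n → Point × Line) (σ : Mem) : Prop where
  size : σ.nat Reg.size 0 = n
  data : σ.real Reg.input = (inputMem A).real Reg.input

theorem HoldsInput.frame {P : Prog} {τ : Mem} (h : HoldsInput A σ) (hF : Frame P σ τ)
    (hsize : Reg.size ∉ P.natWrites) (hinput : Reg.input ∉ P.realWrites) : HoldsInput A τ :=
  ⟨by rw [hF.nat _ hsize, h.size], by rw [hF.real _ hinput, h.data]⟩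

theorem HoldsInput.denotes_pairExp (h : HoldsInput A σ) {p l : ℕ} {i j : Fin n}
    (hp : σ.nat p 0 = i) (hl : σ.nat l 0 = j) :
    (pairExp p l).Denotes O σ ((A i).1, (A j).2) := by
  refine ⟨Point.ext ?_ ?_, Point.ext ?_ ?_, ?_⟩ <;>
    simp [pairExp, hp, hl, show σ.real 0 = _ from h.data, inputMem]

theorem HoldsMotion.congr {arr arr' : ℕ} {τ : Mem} (h : HoldsMotion arr g σ)
    (harr : τ.real arr' = σ.real arr) : HoldsMotion arr' g τ := by
  simpa only [HoldsMotion, harr] using h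

theorem HoldsMotion.eval_movedPoint (h : HoldsMotion Reg.motion g σ) {a : PairExp}
    {x : Point × Line} (ha : a.Denotes O σ x) : (movedPoint a).eval O σ = g.move x.1 := by
  have hentry : ∀ i j : Fin 2, _ := h.1
  simp only [g.matrix_eq, Fin.forall_fin_two] at hentry
  have hshift : ∀ j : Fin 2, _ := h.2
  simp only [Fin.forall_fin_two] at hshift
  have hdir : VecExp.eval O σ ⟨.get Reg.motion (.const 0) (.const 0),
      .get Reg.motion (.const 1) (.const 0)⟩ = g.dir :=
    Point.ext (by simpa using hentry.1.1) (by simpa using hentry.2.1)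
  have htrans : VecExp.eval O σ ⟨.get Reg.motion (.const 2) (.const 0),
      .get Reg.motion (.const 2) (.const 1)⟩ = g.2 :=
    Point.ext (by simpa using hshift.1) (by simpa using hshift.2)
  rw [movedPoint, VecExp.eval_sub, VecExp.eval_rotate, hdir, htrans, ha.point, g.move_eq]

theorem HoldsMotion.eval_costExp (h : HoldsMotion Reg.motion g σ) {a : PairExp}
    {x : Point × Line} (ha : a.Denotes O σ x) : (costExp a).eval O σ = O.lip (Dz O.z x g) := by
  change (O.lip (lzDist O.z ((movedPoint a).eval O σ)
    (hyperplane (a.normal.eval O σ) (a.offset.eval O σ)) : ℝ).toNNReal : ℝ) = _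
  rw [h.eval_movedPoint ha, ha.normal, ha.offset, Real.toNNReal_coe]
  rfl

theorem wp_fillCosts (hA : HoldsInput A σ) (hg : HoldsMotion Reg.motion g σ) (hB : n ≤ B) :
    Wp B O fillCosts σ fun τ =>
      ∀ i j : Fin n, τ.real Reg.costs i j = O.lip (Dz O.z ((A i).1, (A j).2) g) := by
  refine wp_forLoop n (fun m τ => ∀ i j : Fin n, (i : ℕ) < m →
      τ.real Reg.costs i j = O.lip (Dz O.z ((A i).1, (A j).2) g))
    hB (by decide) (fun τ hF => ?_) (by simp) (fun m hm τ hF hi hI => ?_)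
    fun τ _ hI i j => hI i j i.2
  · simpa +decide [hF.nat] using hA.size
  refine wp_forLoop n (fun l τ => ∀ i j : Fin n, (i : ℕ) < m ∨ ((i : ℕ) = m ∧ (j : ℕ) < l) →
      τ.real Reg.costs i j = O.lip (Dz O.z ((A i).1, (A j).2) g)) hB (by decide)
    (fun τ' hF' => ?_) (fun i j h => ?_) (fun l hl τ' hF' hj hI' => ?_)
    fun τ' _ hI' i j hi => hI' i j (by lia)
  · simpa +decide [hF.nat, hF'.nat] using hA.size
  · exact hI i j (by lia)
  have hi' : τ'.nat Reg.i 0 = m := by simpa +decide [hF'.nat] using hi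
  have hA' : HoldsInput A τ' :=
    (hA.frame hF (by decide) (by decide)).frame hF' (by decide) (by decide)
  have hg' : HoldsMotion Reg.motion g τ' :=
    (hg.congr (hF.real _ (by decide))).congr (hF'.real _ (by decide))
  have hcost := hg'.eval_costExp (hA'.denotes_pairExp (O := O) (i := ⟨m, hm⟩) (j := ⟨l, hl⟩) hi' hj)
  refine wp_setReal fun i j h => ?_
  simp only [hcost, Mem.writeNat_real, NExp.eval, hi', hj, Mem.writeReal_same]
  split_ifs with hij
  · rw [show i = ⟨m, hm⟩ from Fin.ext hij.1, show j = ⟨l, hl⟩ from Fin.ext hij.2]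
  · exact hI' i j (by lia)

theorem wp_sumCosts (hn : σ.nat Reg.size 0 = n) (hB : n ≤ B)
    (hπ : ∀ i : Fin n, σ.nat Reg.rowMatch i = π i) :
    Wp B O sumCosts σ fun τ =>
      τ.real Reg.curCost 0 0 = ∑ i : Fin n, σ.real Reg.costs i (π i) := by
  refine wp_seq (wp_setReal (wp_forLoop n (fun m τ => τ.real Reg.curCost 0 0 =
    ∑ i ∈ Finset.range m, σ.real Reg.costs i (σ.nat Reg.rowMatch i)) hB (by decide)
    (fun τ hF => ?_) (by simp) (fun m _ τ hF hi hI => wp_setReal ?_) fun τ _ hI => ?_))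
  · simpa +decide [hF.nat] using hn
  · subst hi
    rw [Finset.sum_range_succ, ← hI]
    simp +decide [hF.nat, hF.real]
  · rw [hI, Finset.sum_range]
    exact Finset.sum_congr rfl fun i _ => by rw [hπ]

theorem wp_matchPairs (hA : HoldsInput A σ) (hg : HoldsMotion Reg.motion g σ) (hB : n + 1 ≤ B) :
    Wp B O matchPairs σ fun τ => ∃ π : Equiv.Perm (Fin n),
      (∀ i : Fin n, τ.nat Reg.rowMatch i = π i) ∧ IsOptimalMatching O.z O.lip A g π ∧
      τ.real Reg.curCost 0 0 = cost O.z O.lip (rematch A π) g := by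
  refine wp_seq ((wp_fillCosts hA hg (by lia)).conseq fun τ₁ hF₁ hcosts => ?_)
  have hA₁ := hA.frame hF₁ (by decide) (by decide)
  refine wp_seq ((wp_hungarian hA₁.size hB fun i hi j hj => ?_).conseq
    fun τ₂ hF₂ ⟨π, hπ, hopt⟩ => ?_)
  · rw [hcosts ⟨i, hi⟩ ⟨j, hj⟩]
    exact NNReal.coe_nonneg _
  have hA₂ := hA₁.frame hF₂ (by decide) (by decide)
  refine (wp_sumCosts hA₂.size (by lia) hπ).conseq fun τ₃ hF₃ hsum => ⟨π, ?_, fun π' => ?_, ?_⟩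
  · simpa +decide [hF₃.nat] using hπ
  · rw [← NNReal.coe_le_coe, coe_cost_rematch, coe_cost_rematch]
    simpa only [hcosts] using hopt π'
  · rw [hsum, hF₂.real _ (by decide), coe_cost_rematch]
    simp only [hcosts]

theorem wp_copyMotion (hg : HoldsMotion Reg.motion g σ) :
    Wp B O copyMotion σ (HoldsMotion Reg.outMotion g) := by
  refine wp_seq (wp_setReal (wp_seq (wp_setReal (wp_seq (wp_setReal (wp_seq (wp_setReal (wp_seq
    (wp_setReal (wp_setReal ⟨fun i j => ?_, fun j => ?_⟩))))))))))
  · have hij := hg.1 i j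
    fin_cases i <;> fin_cases j <;> simpa using hij
  · have hj := hg.2 j
    fin_cases j <;> simpa using hj

theorem wp_copyOutput (hn : σ.nat Reg.size 0 = n) (hB : n ≤ B) (hg : HoldsMotion Reg.motion g σ)
    (hπ : ∀ i : Fin n, σ.nat Reg.rowMatch i = π i) :
    Wp B O copyOutput σ fun τ => HoldsOutput τ (g, π) ∧ τ.nat Reg.seen 0 = 1 ∧
      τ.real Reg.bestCost 0 0 = σ.real Reg.curCost 0 0 := by
  refine wp_seq ((wp_copyMotion hg).conseq fun τ₁ hF₁ hmotion => wp_seq (wp_setReal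
    (wp_seq (wp_setNat (wp_forLoop n
    (fun m τ => ∀ i : Fin n, (i : ℕ) < m → τ.nat Reg.outPerm i = π i) hB (by decide)
    (fun τ hF => ?_) (by simp) (fun m _ τ hF hi hI => wp_setNat fun i him => ?_)
    fun τ hF hI => ⟨?_, ?_, ?_⟩)))))
  · simpa +decide [hF.nat, hF₁.nat] using hn
  · have hrow : τ.nat Reg.rowMatch i = π i := by simpa +decide [hF.nat, hF₁.nat] using hπ i
    rcases Nat.lt_succ_iff_lt_or_eq.1 him with h | h
    · simp [hi, h.ne, hI i h]
    · simp [hi, ← h, hrow]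
  · exact and_assoc.1 ⟨hmotion.congr (by simp +decide [hF.real]), fun i => hI i i.2⟩
  · simp +decide [hF.nat]
  · simp +decide [hF.real, hF₁.real]

/-- The memory holds the input and, unless `D` is empty, a best output for `D`. -/
structure BestOf (O : Oracle) (A : Fin n → Point × Line) (D : Set RigidMotion) (σ : Mem) :
    Prop where
  input : HoldsInput A σ
  best : (σ.nat Reg.seen 0 = 0 ∧ D = ∅) ∨
    (σ.nat Reg.seen 0 = 1 ∧ ∃ out : RigidMotion × Equiv.Perm (Fin n),
      HoldsOutput σ out ∧ IsBest O.z O.lip A D out ∧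
      σ.real Reg.bestCost 0 0 = cost O.z O.lip (rematch A out.2) out.1)

variable {D : Set RigidMotion}

theorem BestOf.congr {τ : Mem} (h : BestOf O A D σ)
    (hnat : ∀ a ∈ [Reg.size, Reg.outPerm, Reg.seen], τ.nat a = σ.nat a)
    (hreal : ∀ a ∈ [Reg.input, Reg.outMotion, Reg.bestCost], τ.real a = σ.real a) :
    BestOf O A D τ := by
  simp only [List.forall_mem_cons] at hnat hreal
  refine ⟨⟨hnat.1 ▸ h.input.size, hreal.1 ▸ h.input.data⟩, ?_⟩
  simpa only [HoldsOutput, hnat, hreal] using h.best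

theorem wp_keepBest (hB : n ≤ B) (h : BestOf O A D σ) (hg : HoldsMotion Reg.motion g σ)
    (hπ : ∀ i : Fin n, σ.nat Reg.rowMatch i = π i) (hopt : IsOptimalMatching O.z O.lip A g π)
    (hcost : σ.real Reg.curCost 0 0 = cost O.z O.lip (rematch A π) g) :
    Wp B O keepBest σ (BestOf O A (insert g D)) := by
  refine wp_ite (fun ht => wp_skip ⟨h.input, ?_⟩) fun ht => ?_ <;>
    simp only [Test.holds, NExp.eval, RExp.eval, hcost] at ht
  · rcases h.best with ⟨h₀, -⟩ | ⟨h₁, out, hout, hbest, hbestCost⟩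
    · lia
    · rw [hbestCost, NNReal.coe_le_coe] at ht
      exact .inr ⟨h₁, out, hout, hbest.insert_of_le hopt ht.2, hbestCost⟩
  · refine (wp_copyOutput h.input.size hB hg hπ).conseq fun τ hF ⟨hout, hseen, hbestCost⟩ =>
      ⟨h.input.frame hF (by decide) (by decide),
        .inr ⟨hseen, (g, π), hout, hopt.isBest_insert fun g' hg' π' => ?_, hbestCost.trans hcost⟩⟩
    rcases h.best with ⟨-, rfl⟩ | ⟨h₁, out, -, hbest, houtCost⟩
    · exact absurd hg' (Set.notMem_empty _)
    · rw [houtCost, h₁, NNReal.coe_le_coe] at ht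
      exact (not_le.1 fun hle => ht ⟨le_rfl, hle⟩).le.trans (hbest.le g' hg' π')

/-- The registers of the loops of `alignMatch` hold the indices of three points and lines. -/
structure HoldsTuple (p l : Fin 3 → Fin n) (σ : Mem) : Prop where
  point₁ : σ.nat Reg.point₁ 0 = p 0
  point₂ : σ.nat Reg.point₂ 0 = p 1
  point₃ : σ.nat Reg.point₃ 0 = p 2
  line₁ : σ.nat Reg.line₁ 0 = l 0
  line₂ : σ.nat Reg.line₂ 0 = l 1
  line₃ : σ.nat Reg.line₃ 0 = l 2

variable {p l : Fin 3 → Fin n}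

theorem HoldsTuple.congr {τ : Mem} (h : HoldsTuple p l σ)
    (hnat : ∀ a ∈ [Reg.point₁, Reg.point₂, Reg.point₃, Reg.line₁, Reg.line₂, Reg.line₃],
      τ.nat a = σ.nat a) : HoldsTuple p l τ := by
  simp only [List.forall_mem_cons] at hnat
  obtain ⟨h₁, h₂, h₃, h₄, h₅, h₆, -⟩ := hnat
  exact ⟨h₁ ▸ h.point₁, h₂ ▸ h.point₂, h₃ ▸ h.point₃, h₄ ▸ h.line₁, h₅ ▸ h.line₂, h₆ ▸ h.line₃⟩

/-- The candidate of sign `s` for the points `p` and the lines `l`. -/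
def tupleCandidate (A : Fin n → Point × Line) (p l : Fin 3 → Fin n) (s : ℤˣ) : RigidMotion :=
  alignCandidate ((A (p 0)).1, (A (l 0)).2) ((A (p 1)).1, (A (l 1)).2) ((A (p 2)).1, (A (l 2)).2) s

theorem computeCandidate_natWrites (s : ℤˣ) (a b c : PairExp) :
    (computeCandidate s a b c).natWrites = [] := rfl

theorem mem_computeCandidate_realWrites {s : ℤˣ} {a b c : PairExp} {arr : ℕ} :
    arr ∈ (computeCandidate s a b c).realWrites ↔ arr = Reg.motion := by
  simp [computeCandidate, computeMotion, storeMotion, Prog.realWrites]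

theorem wp_processCandidate (hB : n + 1 ≤ B) (s : ℤˣ) (h : BestOf O A D σ)
    (ht : HoldsTuple p l σ) :
    Wp B O (processCandidate s) σ (BestOf O A (insert (tupleCandidate A p l s) D)) := by
  have hinput : ∀ {a b c : PairExp} {τ : Mem}, Frame (computeCandidate s a b c) σ τ →
      HoldsInput A τ := fun hF =>
    h.input.frame hF (by simp [computeCandidate_natWrites])
      (by simp [mem_computeCandidate_realWrites])
  have htuple : ∀ {a b c : PairExp} {τ : Mem}, Frame (computeCandidate s a b c) σ τ →
      HoldsTuple p l τ := fun hF =>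
    ht.congr fun _ _ => hF.nat _ (by simp [computeCandidate_natWrites])
  refine wp_seq ((wp_computeCandidate
    (fun τ hτ => (hinput hτ).denotes_pairExp (htuple hτ).point₁ (htuple hτ).line₁)
    (fun τ hτ => (hinput hτ).denotes_pairExp (htuple hτ).point₂ (htuple hτ).line₂)
    fun τ hτ => (hinput hτ).denotes_pairExp (htuple hτ).point₃ (htuple hτ).line₃).conseq
    fun τ₁ hF₁ hg₁ => ?_)
  have h₁ : BestOf O A D τ₁ := h.congr (fun a _ => hF₁.nat a (by simp [computeCandidate_natWrites]))
    (by simp [hF₁.real, mem_computeCandidate_realWrites])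
  refine wp_seq ((wp_matchPairs h₁.input hg₁ hB).conseq fun τ₂ hF₂ ⟨π, hπ, hopt, hcost⟩ => ?_)
  exact wp_keepBest (by lia) (h₁.congr (by simp +decide [hF₂.nat]) (by simp +decide [hF₂.real]))
    (hg₁.congr (hF₂.real _ (by decide))) hπ hopt hcost

theorem wp_processTuple (hB : n + 1 ≤ B) (h : BestOf O A D σ) (ht : HoldsTuple p l σ) :
    Wp B O processTuple σ (BestOf O A (D ∪ Set.range (tupleCandidate A p l))) := by
  refine wp_seq ((wp_processCandidate hB 1 h ht).conseq fun τ₁ hF₁ h₁ => ?_)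
  have ht₁ : HoldsTuple p l τ₁ := ht.congr (by simp +decide [hF₁.nat])
  refine (wp_processCandidate hB (-1) h₁ ht₁).conseq fun τ₂ _ h₂ => ?_
  have hsigns : (Set.univ : Set ℤˣ) = {1, -1} := by
    ext s
    simp [Int.units_eq_one_or]
  rwa [← Set.image_univ, hsigns, Set.image_pair, Set.union_insert, Set.union_singleton,
    Set.insert_comm]

theorem wp_forLoop_union {c : ℕ} {body : Prog} (hB : n ≤ B)
    (hc : c ∉ [Reg.size, Reg.outPerm, Reg.seen]) (hcbody : c ∉ body.natWrites)
    (hsize : Reg.size ∉ body.natWrites) (E : Fin n → Set RigidMotion) (h : BestOf O A D σ)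
    (hstep : ∀ i : Fin n, ∀ D τ, Frame (forLoop c (nvar Reg.size) body) σ τ → τ.nat c 0 = i →
      BestOf O A D τ → Wp B O body τ (BestOf O A (D ∪ E i))) :
    Wp B O (forLoop c (nvar Reg.size) body) σ (BestOf O A (D ∪ ⋃ i, E i)) := by
  have hwrite : ∀ {D τ} x, BestOf O A D τ → BestOf O A D (τ.writeNat c 0 x) := fun x h =>
    h.congr (fun a ha => Mem.writeNat_ne _ _ _ fun hac => hc (hac ▸ ha)) fun _ _ => rfl
  refine wp_forLoop n (fun m => BestOf O A (D ∪ ⋃ i ∈ {i : Fin n | (i : ℕ) < m}, E i)) hB hcbody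
    (fun τ hF => ?_) (hwrite 0 (by simpa using h)) (fun m hm τ hF hi hI => ?_)
    fun τ _ hI => by simpa using hI
  · have hsizeLoop : Reg.size ∉ (forLoop c (nvar Reg.size) body).natWrites := by
      simp_all [eq_comm]
    simp [hF.nat _ hsizeLoop, h.input.size]
  · have hinsert : {i : Fin n | (i : ℕ) < m + 1} = insert ⟨m, hm⟩ {i : Fin n | (i : ℕ) < m} := by
      ext i
      simp only [Set.mem_ofPred_eq, Set.mem_insert_iff, Fin.ext_iff]
      lia
    rw [hinsert, Set.biUnion_insert, Set.union_comm (E _), ← Set.union_assoc]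
    exact (hstep ⟨m, hm⟩ _ τ hF hi hI).conseq fun _ _ => hwrite (m + 1)

/-- The candidates for all triples of points and of lines. -/
def allCandidates (A : Fin n → Point × Line) : Set RigidMotion :=
  ⋃ (i₁ : Fin n) (i₂ : Fin n) (i₃ : Fin n) (j₁ : Fin n) (j₂ : Fin n) (j₃ : Fin n),
    Set.range (tupleCandidate A ![i₁, i₂, i₃] ![j₁, j₂, j₃])

theorem mem_allCandidates : g ∈ allCandidates A ↔ ∃ p l s, tupleCandidate A p l s = g := by
  simp only [allCandidates, Set.mem_iUnion, Set.mem_range]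
  constructor
  · rintro ⟨i₁, i₂, i₃, j₁, j₂, j₃, s, rfl⟩
    exact ⟨_, _, s, rfl⟩
  · rintro ⟨p, l, s, rfl⟩
    exact ⟨p 0, p 1, p 2, l 0, l 1, l 2, s, rfl⟩

theorem wp_alignMatch (hB : n + 1 ≤ B) (h : BestOf O A ∅ σ) :
    Wp B O alignMatch σ (BestOf O A (allCandidates A)) := by
  have hn : n ≤ B := by lia
  rw [← Set.empty_union (allCandidates A)]
  refine wp_forLoop_union hn (by decide) (by decide) (by decide) _ h fun i₁ _ τ₁ _ h₁ h => ?_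
  refine wp_forLoop_union hn (by decide) (by decide) (by decide) _ h fun i₂ _ τ₂ F₂ h₂ h => ?_
  refine wp_forLoop_union hn (by decide) (by decide) (by decide) _ h fun i₃ _ τ₃ F₃ h₃ h => ?_
  refine wp_forLoop_union hn (by decide) (by decide) (by decide) _ h fun j₁ _ τ₄ F₄ h₄ h => ?_
  refine wp_forLoop_union hn (by decide) (by decide) (by decide) _ h fun j₂ _ τ₅ F₅ h₅ h => ?_
  refine wp_forLoop_union hn (by decide) (by decide) (by decide) _ h fun j₃ _ τ₆ F₆ h₆ h => ?_
  refine wp_processTuple hB h ⟨?_, ?_, ?_, ?_, ?_, h₆⟩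
  · simpa +decide [F₂.nat, F₃.nat, F₄.nat, F₅.nat, F₆.nat] using h₁
  · simpa +decide [F₃.nat, F₄.nat, F₅.nat, F₆.nat] using h₂
  · simpa +decide [F₄.nat, F₅.nat, F₆.nat] using h₃
  · simpa +decide [F₅.nat, F₆.nat] using h₄
  · simpa +decide [F₆.nat] using h₅

end RealRAM

namespace PointsToLines

open RealRAM

theorem Line.exists_unit_normal (L : Line) :
    ∃ (v : Point) (b : ℝ), ‖v‖ = 1 ∧ 0 ≤ b ∧ L.carrier = hyperplane v b := by
  have hcarrier : ∀ s : ℝ, s ≠ 0 → L.carrier = hyperplane (s • L.normal) (s * L.offset) := by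
    intro s hs
    ext q
    simp only [carrier, hyperplane, Set.mem_ofPred_eq, real_inner_smul_left]
    exact (mul_right_inj' hs).symm
  have hnorm : 0 < ‖L.normal‖ := norm_pos_iff.2 L.normal_ne
  obtain ⟨s, hs, hoffset⟩ : ∃ s : ℝ, |s| = ‖L.normal‖⁻¹ ∧ 0 ≤ s * L.offset := by
    rcases le_total 0 L.offset with h | h
    · exact ⟨‖L.normal‖⁻¹, abs_of_pos (inv_pos.2 hnorm), by positivity⟩
    · exact ⟨-‖L.normal‖⁻¹, by rw [abs_neg, abs_of_pos (inv_pos.2 hnorm)],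
        mul_nonneg_of_nonpos_of_nonpos (by simp) h⟩
  refine ⟨s • L.normal, s * L.offset, ?_, hoffset, hcarrier s ?_⟩
  · rw [norm_smul, Real.norm_eq_abs, hs, inv_mul_cancel₀ hnorm.ne']
  · rw [← abs_pos, hs]
    exact inv_pos.2 hnorm

theorem isAlignOutput_alignCandidate {m : ℕ} (A : Fin m → Point × Line) :
    IsAlignOutput A {g | ∃ j k l, j ≠ k ∧ g ∈ Set.range (alignCandidate (A j) (A k) (A l))} := by
  choose v b hv using fun i => (A i).2.exists_unit_normal
  have hparallel : ∀ j k, |inner ℝ (v j) (v k)| = 1 ↔ det (A j).2.normal (A k).2.normal = 0 :=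
    fun j k => abs_inner_eq_one_iff_det_normal_eq_zero (hv j).1 (hv k).1 (hv j).2.2 (hv k).2.2
  refine ⟨v, b, hv, fun j k l => Set.range (alignCandidate (A j) (A k) (A l)),
    fun j k l _ => ⟨fun h => ?_, fun h => ?_⟩, rfl⟩
  · rw [ne_eq, hparallel] at h
    have hcandidate : alignCandidate (A j) (A k) (A l) = candidate (A j) (A k) (A l) :=
      funext fun s => by rw [alignCandidate, if_neg h]
    rw [crossingAlignments_eq (fun i => ⟨(hv i).1, (hv i).2.2⟩) h]
    simpa only [hcandidate] using isSelection_range_candidate fun h₀ => absurd h₀ h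
  · rw [hparallel] at h
    have hcandidate : alignCandidate (A j) (A k) (A l) = candidate (A j) (A k) (A k) :=
      funext fun s => by rw [alignCandidate, if_pos h]
    rw [parallelAlignments_eq h]
    simpa only [hcandidate] using isSelection_range_candidate fun _ => h

variable {n : ℕ} {z : ℝ} {lip : ℝ≥0 → ℝ≥0} {A : Fin n → Point × Line}
  {out : RigidMotion × Equiv.Perm (Fin n)}

theorem exists_isOptimalMatching (g : RigidMotion) : ∃ π, IsOptimalMatching z lip A g π :=
  Finite.exists_min fun π => cost z lip (rematch A π) g

theorem IsBest.isAlignMatchOutput (h : IsBest z lip A (allCandidates A) out) :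
    IsAlignMatchOutput z lip A out := by
  choose π hπ using exists_isOptimalMatching (z := z) (lip := lip) (A := A)
  let X (p l : Fin 3 → Fin n) : Set RigidMotion :=
    {g | ∃ a b c : Fin 3, a ≠ b ∧ g ∈ Set.range (alignCandidate
      ((A (p a)).1, (A (l a)).2) ((A (p b)).1, (A (l b)).2) ((A (p c)).1, (A (l c)).2))}
  have hX : ∀ g, (∃ p l, g ∈ X p l) ↔ g ∈ allCandidates A := by
    intro g
    rw [mem_allCandidates]
    constructor
    · rintro ⟨p, l, a, b, c, -, s, rfl⟩
      exact ⟨![p a, p b, p c], ![l a, l b, l c], s, rfl⟩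
    · rintro ⟨p, l, s, rfl⟩
      exact ⟨p, l, 0, 1, 2, by decide, s, rfl⟩
  classical
  refine ⟨X, Function.update π out.1 out.2, fun p l => isAlignOutput_alignCandidate _,
    fun g _ => ?_, _, rfl, ⟨(hX _).2 h.mem, by simp⟩, fun u hu => h.le u.1 ((hX _).1 hu.1) u.2⟩
  rcases eq_or_ne g out.1 with rfl | hg
  · rw [Function.update_self]
    exact h.le _ h.mem
  · rw [Function.update_of_ne hg]
    exact hπ g

theorem one_le_wFactor (z : ℝ) : 1 ≤ wFactor z := by
  rw [wFactor]
  split_ifs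
  · exact le_rfl
  · exact NNReal.le_sqrt_iff_sq_le.2 (by norm_num)

end PointsToLines

namespace RealRAM

open PointsToLines

variable {n : ℕ}

theorem exists_run_alignMatch [NeZero n] (z : ℝ) (lip : ℝ≥0 → ℝ≥0) (A : Fin n → Point × Line) :
    ∃ (τ : Mem) (T : ℕ) (out : RigidMotion × Equiv.Perm (Fin n)),
      Run ⟨lip, z⟩ alignMatch (inputMem A) τ T ∧ T ≤ alignMatch.timeBound (n + 1) ∧
      HoldsOutput τ out ∧ IsAlignMatchOutput z lip A out := by
  have hstart : BestOf ⟨lip, z⟩ A ∅ (inputMem A) :=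
    ⟨⟨by simp [inputMem], rfl⟩, .inl ⟨by simp [inputMem], rfl⟩⟩
  obtain ⟨τ, T, hrun, hT, hτ⟩ := wp_alignMatch (B := n + 1) le_rfl hstart
  rcases hτ.best with ⟨-, hempty⟩ | ⟨-, out, hout, hbest, -⟩
  · have hmem : tupleCandidate A 0 0 1 ∈ allCandidates A := mem_allCandidates.2 ⟨0, 0, 1, rfl⟩
    simp [hempty] at hmem
  · exact ⟨τ, T, out, hrun, hT, hout, hbest.isAlignMatchOutput⟩

end RealRAM

end

open PointsToLines in
theorem mainTheorem3_general :
    (∀ (n : ℕ) (A : Fin n → Point × Line) (z r : ℝ) (lip : ℝ≥0 → ℝ≥0),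
      0 < n → 0 < z → IsLogLipschitz r lip →
      ∃ opt : ℝ≥0,
        IsLeast (Set.range fun u : RigidMotion × Equiv.Perm (Fin n) =>
          cost z lip (rematch A u.2) u.1) opt ∧
        ∀ out : RigidMotion × Equiv.Perm (Fin n), IsAlignMatchOutput z lip A out →
          cost z lip (rematch A out.2) out.1 ≤ 16 ^ r * opt) ∧
    (∃ (P : RealRAM.Prog) (K d : ℕ),
      ∀ (n : ℕ) (A : Fin n → Point × Line) (z : ℝ) (lip : ℝ≥0 → ℝ≥0), 0 < n →
        ∃ (τ : RealRAM.Mem) (T : ℕ) (out : RigidMotion × Equiv.Perm (Fin n)),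
          RealRAM.Run ⟨lip, z⟩ P (RealRAM.inputMem A) τ T ∧ T ≤ K * n ^ d ∧
          RealRAM.HoldsOutput τ out ∧ IsAlignMatchOutput z lip A out) := by
  refine ⟨fun n A z r lip hn hz hlip => ?_, ?_⟩
  · have : NeZero n := ⟨hn.ne'⟩
    obtain ⟨g, π, hopt⟩ := exists_optimal A hz.ne' hlip
    refine ⟨cost z lip (rematch A π) g, ⟨⟨(g, π), rfl⟩, ?_⟩,
      fun out hout => hout.cost_le hz.ne' hlip g π⟩
    rintro _ ⟨u, rfl⟩
    exact hopt u.1 u.2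
  · obtain ⟨K, d, hK⟩ := RealRAM.alignMatch.exists_timeBound_le
    refine ⟨RealRAM.alignMatch, K * 2 ^ d, d, fun n A z lip hn => ?_⟩
    have : NeZero n := ⟨hn.ne'⟩
    obtain ⟨τ, T, out, hrun, hT, hout⟩ := RealRAM.exists_run_alignMatch z lip A
    refine ⟨τ, T, out, hrun, hT.trans ((hK _ (by lia)).trans ?_), hout⟩
    rw [mul_assoc, ← mul_pow]
    gcongr
    lia

open PointsToLines in
theorem mainTheorem3 :
    (∀ (n : ℕ) (A : Fin n → Point × Line) (z r : ℝ) (lip : ℝ≥0 → ℝ≥0),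
      3 ≤ n → 1 ≤ z → IsLogLipschitz r lip →
      ∃ opt : ℝ≥0,
        IsLeast (Set.range fun u : RigidMotion × Equiv.Perm (Fin n) =>
          cost z lip (rematch A u.2) u.1) opt ∧
        ∀ out : RigidMotion × Equiv.Perm (Fin n), IsAlignMatchOutput z lip A out →
          cost z lip (rematch A out.2) out.1 ≤ (wFactor z * 16) ^ r * opt) ∧
    (∃ (P : RealRAM.Prog) (K d : ℕ),
      ∀ (n : ℕ) (A : Fin n → Point × Line) (z r : ℝ) (lip : ℝ≥0 → ℝ≥0),
        3 ≤ n → 1 ≤ z → IsLogLipschitz r lip →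
        ∃ (τ : RealRAM.Mem) (T : ℕ) (out : RigidMotion × Equiv.Perm (Fin n)),
          RealRAM.Run ⟨lip, z⟩ P (RealRAM.inputMem A) τ T ∧ T ≤ K * n ^ d ∧
          RealRAM.HoldsOutput τ out ∧ IsAlignMatchOutput z lip A out) := by
  obtain ⟨happrox, P, K, d, hP⟩ := mainTheorem3_general
  refine ⟨fun n A z r lip hn hz hlip => ?_,
    P, K, d, fun n A z _ lip hn _ _ => hP n A z lip (by lia)⟩
  obtain ⟨opt, hopt, hle⟩ := happrox n A z r lip (by lia) (by linarith) hlip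
  refine ⟨opt, hopt, fun out hout => (hle out hout).trans ?_⟩
  have hr : 0 ≤ r := hlip.1.le
  gcongr
  exact le_mul_of_one_le_left' (one_le_wFactor z)
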